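/- Let $\mathrm{IZF}_R$ be the intuitionistic first-order theory (logic without equality) with binary relation symbols $\in,=$, with function symbols $\emptyset,\ \{\cdot,\cdot\},\ \omega,\ \bigcup,\ P$ and, for every formula $\phi$ of the language (terms and formulas being defined by mutual induction), function symbols $S_\phi$ and $R_\phi$, and with the following axioms, where $0=\emptyset$ and $S(b)=\bigcup\{b,\{b,b\}\}$: - (EXT) $\forall a,b.\ a=b\leftrightarrow\forall c.\ (c\in a\leftrightarrow c\in b)$; - (L$_\phi$) $\forall a,b,\bar f.\ a=b\wedge\phi(a,\bar f)\to\phi(b,\bar f)$; - (EMPTY) $\forall c.\ c\in\emptyset\leftrightarrow\bot$; - (PAIR) $\forall a,b,c.\ c\in\{a,b\}\leftrightarrow c=a\vee c=b$; - (INF) $\forall c.\ c\in\omega\leftrightarrow c=0\vee\exists b\in\omega.\ c=S(b)$; - (SEP$_\phi$) $\forall\bar f,a,c.\ c\in S_\phi(a,\bar f)\leftrightarrow c\in a\wedge\phi(c,\bar f)$; - (UNION) $\forall a,c.\ c\in\bigcup a\leftrightarrow\exists b\in a.\ c\in b$; - (POWER) $\forall a,c.\ c\in P(a)\leftrightarrow\forall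 b.\ (b\in c\to b\in a)$; - (REPL$_\phi$) $\forall\bar f,a,c.\ c\in R_\phi(a,\bar f)\leftrightarrow(\forall x\in a\,\exists!y.\ \phi(x,y,\bar f))\wedge(\exists x\in a.\ \phi(x,c,\bar f))$; - (IND$_\phi$) $\forall\bar f.\ (\forall a.\ (\forall b\in a.\ \phi(b,\bar f))\to\phi(a,\bar f))\to\forall a.\ \phi(a,\bar f)$. The theory $\mathrm{IZF}^-_{R\omega}$ is obtained by adding constants $V_1,V_2,\dots$ to the language (the schemas range over the extended language) and, with $V_0:=\omega$, for every $i>0$ the axiom $$\forall c.\ c\in V_i\leftrightarrow\phi_1^i(c)\wedge\forall d.\ (\phi_2^i(d)\to c\in d).$$ Here $\phi_1^i(c)$ says that $c=V_{i-1}$, or that for some $a\in V_i$ we have $c\in a$, or $c=\bigcup a$, or $c=P(a)$, or $c$ is a function from $a$ to $V_i$; and $\phi_2^i(d)$ says that $V_{i-1}\in d$, that $d$ is transitive, and that $d$ is closed under $\bigcup$, under $P$, and under functions from elements of $d$ to $d$. For a theory $T=\mathrm{IZF}_R+A$, where $A$ is a finite list of sentences of the language of $\mathrm{IZF}_R$,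 let $M(T)$ be the sentence of set theory "$T$ has a model": there is a structure for the (coded) language of $\mathrm{IZF}_R$, with a Tarskian satisfaction relation, that satisfies all axioms of $T$. Let $v\models T$ be the formula of set theory saying that $v$, with the membership and equality of the universe and some interpretation of the function symbols, satisfies all axioms of $T$. Put $$T_1=\mathrm{IZF}_R,\qquad T_{i+1}=T_i+M(T_i),$$ so that $T_i=\mathrm{IZF}_R+M(\mathrm{IZF}_R)+M(\mathrm{IZF}_R+M(\mathrm{IZF}_R))+\dots$ with $i$ summands. **Theorem.** For every $i>0$, $\mathrm{IZF}^-_{R\omega}$ proves, in intuitionistic first-order logic, the sentence $V_i\models T_i$. -/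

import Mathlib

/-!
# Intuitionistic set theory with Replacement and inaccessible sets

Syntax (well-scoped, de Bruijn levels), intuitionistic natural deduction, the axioms of `IZF_R` and
of its extension by the constants `V_1, V_2, ...`, and the set-theoretic sentences expressing
"`IZF_R + A` has a model" and "the set `v` is a model of `IZF_R + A`".
-/

namespace IZF

/-! ## Syntax -/

mutual
/-- Function symbols, indexed by their arity. `K` is a type of additional constant symbols.
`sep φ` is `S_φ` and `repl φ` is `R_φ`; their arguments are the parameters `f₀, ..., f_{m-1}` of `φ`,
followed by the set `a`. In `sep φ` the variables of `φ` are `f₀, ..., f_{m-1}, c`, in `repl φ` they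
are `f₀, ..., f_{m-1}, x, y`. -/
inductive Sym (K : Type) : ℕ → Type
  | const (k : K) : Sym K 0
  | empty : Sym K 0
  | omega : Sym K 0
  | pair : Sym K 2
  | union : Sym K 1
  | power : Sym K 1
  | sep {m : ℕ} (φ : Fm K (m + 1)) : Sym K (m + 1)
  | repl {m : ℕ} (φ : Fm K (m + 2)) : Sym K (m + 1)

/-- Terms whose variables are among `n` given ones. -/
inductive Tm (K : Type) : ℕ → Type
  | var {n : ℕ} (i : Fin n) : Tm K n
  | app {n m : ℕ} (f : Sym K m) (u : Fin m → Tm K n) : Tm K n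

/-- Formulas whose free variables are among `n` given ones; a quantifier binds the variable with
number `n`, the last one of its scope. -/
inductive Fm (K : Type) : ℕ → Type
  | mem {n : ℕ} (t s : Tm K n) : Fm K n
  | eq {n : ℕ} (t s : Tm K n) : Fm K n
  | bot {n : ℕ} : Fm K n
  | and {n : ℕ} (φ ψ : Fm K n) : Fm K n
  | or {n : ℕ} (φ ψ : Fm K n) : Fm K n
  | imp {n : ℕ} (φ ψ : Fm K n) : Fm K n
  | all {n : ℕ} (φ : Fm K (n + 1)) : Fm K n
  | ex {n : ℕ} (φ : Fm K (n + 1)) : Fm K n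
end

variable {K : Type} {n m : ℕ}

/-- Simultaneous substitution in a term. -/
def Tm.subst (σ : Fin n → Tm K m) : Tm K n → Tm K m
  | .var i => σ i
  | .app f u => .app f (fun j => (u j).subst σ)

/-- A term, seen in a scope with one more variable. -/
def Tm.lift (t : Tm K n) : Tm K (n + 1) := t.subst (fun i => .var i.castSucc)

/-- `f₀, ..., f_{m-1}` followed by `t`. -/
def snoc (f : Fin m → Tm K n) (t : Tm K n) : Fin (m + 1) → Tm K n :=
  Fin.snoc (α := fun _ => Tm K n) f t

/-- Simultaneous capture-avoiding substitution in a formula. -/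
def Fm.subst : {n m : ℕ} → (Fin n → Tm K m) → Fm K n → Fm K m
  | _, _, σ, .mem t s => .mem (t.subst σ) (s.subst σ)
  | _, _, σ, .eq t s => .eq (t.subst σ) (s.subst σ)
  | _, _, _, .bot => .bot
  | _, _, σ, .and φ ψ => .and (φ.subst σ) (ψ.subst σ)
  | _, _, σ, .or φ ψ => .or (φ.subst σ) (ψ.subst σ)
  | _, _, σ, .imp φ ψ => .imp (φ.subst σ) (ψ.subst σ)
  | _, m, σ, .all φ => .all (φ.subst (snoc (fun i => (σ i).lift) (.var (Fin.last m))))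
  | _, m, σ, .ex φ => .ex (φ.subst (snoc (fun i => (σ i).lift) (.var (Fin.last m))))

/-- A formula, seen in a scope with one more variable. -/
def Fm.lift (φ : Fm K n) : Fm K (n + 1) := φ.subst (fun i => .var i.castSucc)

/-- Substitution of a term for the last variable. -/
def Fm.inst (φ : Fm K (n + 1)) (t : Tm K n) : Fm K n := φ.subst (snoc .var t)

/-! ## Intuitionistic natural deduction, without equality -/

inductive Derives : {n : ℕ} → Set (Fm K n) → Fm K n → Prop
  | ax {n : ℕ} {Γ : Set (Fm K n)} {φ : Fm K n} : φ ∈ Γ → Derives Γ φ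
  | impE {n : ℕ} {Γ : Set (Fm K n)} {φ ψ : Fm K n} :
      Derives Γ (.imp φ ψ) → Derives Γ φ → Derives Γ ψ
  | impI {n : ℕ} {Γ : Set (Fm K n)} {φ ψ : Fm K n} :
      Derives (insert φ Γ) ψ → Derives Γ (.imp φ ψ)
  | andI {n : ℕ} {Γ : Set (Fm K n)} {φ ψ : Fm K n} :
      Derives Γ φ → Derives Γ ψ → Derives Γ (.and φ ψ)
  | andE₁ {n : ℕ} {Γ : Set (Fm K n)} {φ ψ : Fm K n} : Derives Γ (.and φ ψ) → Derives Γ φ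
  | andE₂ {n : ℕ} {Γ : Set (Fm K n)} {φ ψ : Fm K n} : Derives Γ (.and φ ψ) → Derives Γ ψ
  | orI₁ {n : ℕ} {Γ : Set (Fm K n)} {φ ψ : Fm K n} : Derives Γ φ → Derives Γ (.or φ ψ)
  | orI₂ {n : ℕ} {Γ : Set (Fm K n)} {φ ψ : Fm K n} : Derives Γ ψ → Derives Γ (.or φ ψ)
  | orE {n : ℕ} {Γ : Set (Fm K n)} {φ ψ θ : Fm K n} :
      Derives Γ (.or φ ψ) → Derives (insert φ Γ) θ → Derives (insert ψ Γ) θ → Derives Γ θ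
  | allI {n : ℕ} {Γ : Set (Fm K n)} {φ : Fm K (n + 1)} :
      Derives (Fm.lift '' Γ) φ → Derives Γ (.all φ)
  | allE {n : ℕ} {Γ : Set (Fm K n)} {φ : Fm K (n + 1)} (t : Tm K n) :
      Derives Γ (.all φ) → Derives Γ (φ.inst t)
  | botE {n : ℕ} {Γ : Set (Fm K n)} {φ : Fm K n} : Derives Γ .bot → Derives Γ φ
  | exI {n : ℕ} {Γ : Set (Fm K n)} {φ : Fm K (n + 1)} (t : Tm K n) :
      Derives Γ (φ.inst t) → Derives Γ (.ex φ)
  | exE {n : ℕ} {Γ : Set (Fm K n)} {φ : Fm K (n + 1)} {ψ : Fm K n} :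
      Derives Γ (.ex φ) → Derives (insert φ (Fm.lift '' Γ)) ψ.lift → Derives Γ ψ

/-! ## Abbreviations

Formulas with quantifiers are written by means of functions on terms: `allx fun x => φ x` is
`∀ x. φ(x)`. Terms of the surrounding scope are coerced into the larger scope by `Tm.lift`. -/

instance : Coe (Tm K n) (Tm K (n + 1)) := ⟨Tm.lift⟩

infix:50 "∈ₒ" => Fm.mem
infix:50 "=ₒ" => Fm.eq
infixr:35 "∧ₒ" => Fm.and
infixr:30 "∨ₒ" => Fm.or
infixr:25 "→ₒ" => Fm.imp

def Fm.iff (φ ψ : Fm K n) : Fm K n := (φ →ₒ ψ) ∧ₒ (ψ →ₒ φ)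

infix:20 "↔ₒ" => Fm.iff

def allx (φ : Tm K (n + 1) → Fm K (n + 1)) : Fm K n := .all (φ (.var (Fin.last n)))

def exx (φ : Tm K (n + 1) → Fm K (n + 1)) : Fm K n := .ex (φ (.var (Fin.last n)))

/-- `∀ x ∈ a. φ(x)` -/
def ball (a : Tm K n) (φ : Tm K (n + 1) → Fm K (n + 1)) : Fm K n := allx fun x => x ∈ₒ a →ₒ φ x

/-- `∃ x ∈ a. φ(x)` -/
def bex (a : Tm K n) (φ : Tm K (n + 1) → Fm K (n + 1)) : Fm K n := exx fun x => x ∈ₒ a ∧ₒ φ x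

def emptyT : Tm K n := .app .empty ![]

def omegaT : Tm K n := .app .omega ![]

def pairT (a b : Tm K n) : Tm K n := .app .pair ![a, b]

def unionT (a : Tm K n) : Tm K n := .app .union ![a]

def powerT (a : Tm K n) : Tm K n := .app .power ![a]

/-- The singleton `{a, a}`. -/
def singT (a : Tm K n) : Tm K n := pairT a a

/-- The binary union `⋃ {a, b}`. -/
def cupT (a b : Tm K n) : Tm K n := unionT (pairT a b)

/-- The successor `S(a) = ⋃ {a, {a, a}}`. -/
def sucT (a : Tm K n) : Tm K n := cupT a (singT a)

/-- The ordered pair `{{a, a}, {a, b}}`. -/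
def opT (a b : Tm K n) : Tm K n := pairT (singT a) (pairT a b)

/-- The numeral of `k`. -/
def num : ℕ → Tm K n
  | 0 => emptyT
  | k + 1 => sucT (num k)

/-- `c` is a function from `a` to `d`. -/
def isFun (c a d : Tm K n) : Fm K n :=
  (ball a fun x => exx fun y =>
    (y ∈ₒ d ∧ₒ opT x y ∈ₒ c) ∧ₒ allx fun z => (z ∈ₒ d ∧ₒ opT x z ∈ₒ c) →ₒ z =ₒ y) ∧ₒ
  (ball c fun z => bex a fun x => bex d fun y => z =ₒ opT x y)

/-- Universal closure. -/
def close : {n : ℕ} → Fm K n → Fm K 0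
  | 0, φ => φ
  | _ + 1, φ => close (.all φ)

/-! ## The axioms of `IZF_R` -/

def axExt : Fm K 0 :=
  allx fun a => allx fun b => a =ₒ b ↔ₒ allx fun c => c ∈ₒ a ↔ₒ c ∈ₒ b

def axEmpty : Fm K 0 := allx fun c => c ∈ₒ emptyT ↔ₒ .bot

def axPair : Fm K 0 :=
  allx fun a => allx fun b => allx fun c => c ∈ₒ pairT a b ↔ₒ c =ₒ a ∨ₒ c =ₒ b

def axInf : Fm K 0 :=
  allx fun c => c ∈ₒ omegaT ↔ₒ c =ₒ emptyT ∨ₒ bex omegaT fun b => c =ₒ sucT b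

def axUnion : Fm K 0 :=
  allx fun a => allx fun c => c ∈ₒ unionT a ↔ₒ bex a fun b => c ∈ₒ b

def axPower : Fm K 0 :=
  allx fun a => allx fun c => c ∈ₒ powerT a ↔ₒ allx fun b => b ∈ₒ c →ₒ b ∈ₒ a

/-- The variables `f₀, ..., f_{m-1}`, in a scope of `m + j` variables. -/
def par (m j : ℕ) (i : Fin m) : Tm K (m + j) := .var (i.castAdd j)

/-- `φ(c, f)` -/
def at₁ (φ : Fm K (m + 1)) (f : Fin m → Tm K n) (c : Tm K n) : Fm K n := φ.subst (snoc f c)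

/-- `φ(x, y, f)` -/
def at₂ (φ : Fm K (m + 2)) (f : Fin m → Tm K n) (x y : Tm K n) : Fm K n :=
  φ.subst (snoc (snoc f x) y)

def axLeibniz (φ : Fm K (m + 1)) : Fm K 0 :=
  close (n := m) (allx fun a => allx fun b =>
    a =ₒ b ∧ₒ at₁ φ (par m 2) a →ₒ at₁ φ (par m 2) b)

def axSep (φ : Fm K (m + 1)) : Fm K 0 :=
  close (n := m) (allx fun a => allx fun c =>
    c ∈ₒ .app (.sep φ) (snoc (par m 2) a) ↔ₒ c ∈ₒ a ∧ₒ at₁ φ (par m 2) c)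

def axRepl (φ : Fm K (m + 2)) : Fm K 0 :=
  close (n := m) (allx fun a => allx fun c =>
    c ∈ₒ .app (.repl φ) (snoc (par m 2) a) ↔ₒ
      (ball a fun x => exx fun y => at₂ φ (par m 4) x y ∧ₒ
        allx fun z => at₂ φ (par m 5) x z →ₒ z =ₒ y) ∧ₒ
      bex a fun x => at₂ φ (par m 3) x c)

def axInd (φ : Fm K (m + 1)) : Fm K 0 :=
  close (n := m)
    ((allx fun a => (ball a fun b => at₁ φ (par m 2) b) →ₒ at₁ φ (par m 1) a) →ₒ
      allx fun a => at₁ φ (par m 1) a)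

/-- The axioms of `IZF_R` that are not schemas. -/
def finAx : List (Fm K 0) := [axExt, axEmpty, axPair, axInf, axUnion, axPower]

/-- The axioms of `IZF_R`, in the language with the additional constants `K`. -/
inductive IZFR (K : Type) : Fm K 0 → Prop
  | fin {φ : Fm K 0} : φ ∈ finAx → IZFR K φ
  | leibniz {m : ℕ} (φ : Fm K (m + 1)) : IZFR K (axLeibniz φ)
  | sep {m : ℕ} (φ : Fm K (m + 1)) : IZFR K (axSep φ)
  | repl {m : ℕ} (φ : Fm K (m + 2)) : IZFR K (axRepl φ)
  | ind {m : ℕ} (φ : Fm K (m + 1)) : IZFR K (axInd φ)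

/-! ## Inaccessible sets -/

/-- The term `V_i`: `V_0` is `ω`, and `V_{k+1}` is the constant with number `k`. -/
def V : ℕ → Tm ℕ n
  | 0 => omegaT
  | k + 1 => .app (.const k) ![]

/-- `c` is `p`, or an element, the union or the power set of an element of `v`, or a function from
an element of `v` to `v`. -/
def inacIn (p c v : Tm K n) : Fm K n :=
  c =ₒ p ∨ₒ
  (bex v fun a => c ∈ₒ a) ∨ₒ
  (bex v fun a => c =ₒ unionT a) ∨ₒ
  (bex v fun a => c =ₒ powerT a) ∨ₒ
  (bex v fun a => isFun c a v)

/-- `d` contains `p`, is transitive, and is closed under unions, power sets and functions from its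
elements to itself. -/
def inacClosed (p d : Tm K n) : Fm K n :=
  p ∈ₒ d ∧ₒ
  (allx fun e => allx fun f => e ∈ₒ d ∧ₒ f ∈ₒ e →ₒ f ∈ₒ d) ∧ₒ
  (ball d fun e => unionT e ∈ₒ d) ∧ₒ
  (ball d fun e => powerT e ∈ₒ d) ∧ₒ
  (ball d fun e => allx fun f => isFun f e d →ₒ f ∈ₒ d)

/-- The axiom on `V_{k+1}`. -/
def axInac (k : ℕ) : Fm ℕ 0 :=
  allx fun c => c ∈ₒ V (k + 1) ↔ₒ
    inacIn (V k) c (V (k + 1)) ∧ₒ allx fun d => inacClosed (V k) d →ₒ c ∈ₒ d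

/-- `IZF_R` with the axioms on `V_1, V_2, ...`; the schemas range over the extended language. -/
def IZFRomega : Set (Fm ℕ 0) := {φ | IZFR ℕ φ} ∪ Set.range axInac

/-! ## The language of `IZF_R` inside set theory

Function symbols, terms and formulas are coded by sets. Scopes and arities are elements of `ω`,
finite sequences of length `m` are functions with domain `m`, and `⟨0, m, f⟩`, `⟨1, n, t⟩`,
`⟨2, n, φ⟩` stand for the judgements "`f` is a function symbol of arity `m`", "`t` is a term with `n`
variables", "`φ` is a formula with `n` variables". -/

/-- The ordered pair of the numeral of `k` and `t`. -/
def tag (k : ℕ) (t : Tm K n) : Tm K n := opT (num k) t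

/-- The sequence `e` of length `k`, followed by `x`: the set `e ∪ {⟨k, x⟩}`. -/
def extT (e k x : Tm K n) : Tm K n := cupT e (singT (opT k x))

/-- The finite sequence of the given terms. -/
def seqT : {m : ℕ} → (Fin m → Tm K n) → Tm K n
  | 0, _ => emptyT
  | m + 1, u => extT (seqT fun i : Fin m => u i.castSucc) (num m) (u (Fin.last m))

mutual
/-- The code of a function symbol of `IZF_R`. -/
def Sym.code {l : ℕ} : {m : ℕ} → Sym Empty m → Tm K l
  | _, .const k => k.elim
  | _, .empty => tag 0 emptyT
  | _, .omega => tag 1 emptyT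
  | _, .pair => tag 2 emptyT
  | _, .union => tag 3 emptyT
  | _, .power => tag 4 emptyT
  | _, .sep φ => tag 5 φ.code
  | _, .repl φ => tag 6 φ.code

/-- The code of a term of `IZF_R`. -/
def Tm.code {l : ℕ} : {n : ℕ} → Tm Empty n → Tm K l
  | _, .var i => tag 0 (num i)
  | _, .app f u => tag 1 (opT f.code (seqT fun j => (u j).code))

/-- The code of a formula of `IZF_R`. -/
def Fm.code {l : ℕ} : {n : ℕ} → Fm Empty n → Tm K l
  | _, .mem t s => tag 0 (opT t.code s.code)
  | _, .eq t s => tag 1 (opT t.code s.code)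
  | _, .bot => tag 2 emptyT
  | _, .and φ ψ => tag 3 (opT φ.code ψ.code)
  | _, .or φ ψ => tag 4 (opT φ.code ψ.code)
  | _, .imp φ ψ => tag 5 (opT φ.code ψ.code)
  | _, .all φ => tag 6 φ.code
  | _, .ex φ => tag 7 φ.code
end

/-- According to `C`, `f` is a function symbol of arity `m`. -/
def symIn (C m f : Tm K n) : Fm K n := tag 0 (opT m f) ∈ₒ C

/-- According to `C`, `t` is a term with variables `0, ..., k - 1`. -/
def tmIn (C k t : Tm K n) : Fm K n := tag 1 (opT k t) ∈ₒ C

/-- According to `C`, `p` is a formula with free variables `0, ..., k - 1`. -/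
def fmIn (C k p : Tm K n) : Fm K n := tag 2 (opT k p) ∈ₒ C

/-- `u` is a sequence of length `m` of terms with `k` variables. -/
def tmSeqIn (C k m u : Tm K n) : Fm K n :=
  exx fun d => isFun u m d ∧ₒ ball d fun t => tmIn C k t

/-- `C` is closed under the formation rules of function symbols, terms and formulas. -/
def synClosed (C : Tm K n) : Fm K n :=
  -- function symbols
  symIn C (num 0) (tag 0 emptyT) ∧ₒ
  symIn C (num 0) (tag 1 emptyT) ∧ₒ
  symIn C (num 2) (tag 2 emptyT) ∧ₒ
  symIn C (num 1) (tag 3 emptyT) ∧ₒ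
  symIn C (num 1) (tag 4 emptyT) ∧ₒ
  (ball omegaT fun m => allx fun p => fmIn C (sucT m) p →ₒ symIn C (sucT m) (tag 5 p)) ∧ₒ
  (ball omegaT fun m => allx fun p => fmIn C (sucT (sucT m)) p →ₒ symIn C (sucT m) (tag 6 p)) ∧ₒ
  -- terms
  (ball omegaT fun k => ball k fun i => tmIn C k (tag 0 i)) ∧ₒ
  (ball omegaT fun k => ball omegaT fun m => allx fun f => allx fun u =>
    symIn C m f ∧ₒ tmSeqIn C k m u →ₒ tmIn C k (tag 1 (opT f u))) ∧ₒ
  -- formulas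
  (ball omegaT fun k => allx fun t => allx fun s => tmIn C k t ∧ₒ tmIn C k s →ₒ
    fmIn C k (tag 0 (opT t s)) ∧ₒ fmIn C k (tag 1 (opT t s))) ∧ₒ
  (ball omegaT fun k => fmIn C k (tag 2 emptyT)) ∧ₒ
  (ball omegaT fun k => allx fun p => allx fun q => fmIn C k p ∧ₒ fmIn C k q →ₒ
    fmIn C k (tag 3 (opT p q)) ∧ₒ fmIn C k (tag 4 (opT p q)) ∧ₒ fmIn C k (tag 5 (opT p q))) ∧ₒ
  (ball omegaT fun k => allx fun p => fmIn C (sucT k) p →ₒ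
    fmIn C k (tag 6 p) ∧ₒ fmIn C k (tag 7 p))

/-- `C` is the syntax of `IZF_R`: the least set closed under the formation rules. -/
def isSyntax (C : Tm K n) : Fm K n :=
  synClosed C ∧ₒ allx fun D => synClosed D →ₒ ball C fun x => x ∈ₒ D

/-! ## Structures and satisfaction inside set theory

A structure consists of a set `M`, binary relations `E` and `Q` interpreting membership and equality,
and a set `G` of triples `⟨⟨f, w⟩, y⟩`: the function symbol `f` takes the value `y` at the sequence of
arguments `w`. -/

/-- `G` interprets every function symbol of arity `m` by a function from `M^m` to `M`. -/
def isStruct (C M G : Tm K n) : Fm K n :=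
  ball omegaT fun m => allx fun f => allx fun w => symIn C m f ∧ₒ isFun w m M →ₒ
    bex M fun y => allx fun z => opT (opT f w) z ∈ₒ G ↔ₒ z =ₒ y

/-- `H` is the evaluation of terms: `⟨⟨t, e⟩, v⟩ ∈ H` means that `t` has the value `v` in the
environment `e`, which is a sequence of elements of `M`. -/
def isEval (C M G H : Tm K n) : Fm K n :=
  ball omegaT fun k => allx fun e => isFun e k M →ₒ
    (ball k fun i => allx fun v => opT (opT (tag 0 i) e) v ∈ₒ H ↔ₒ opT i v ∈ₒ e) ∧ₒ
    (ball omegaT fun m => allx fun f => allx fun u => symIn C m f ∧ₒ tmSeqIn C k m u →ₒ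
      allx fun v => opT (opT (tag 1 (opT f u)) e) v ∈ₒ H ↔ₒ
        exx fun w => isFun w m M ∧ₒ
          (ball m fun j => allx fun t => allx fun y =>
            opT j t ∈ₒ u ∧ₒ opT j y ∈ₒ w →ₒ opT (opT t e) y ∈ₒ H) ∧ₒ
          opT (opT f w) v ∈ₒ G)

/-- `T` is the satisfaction relation: `⟨p, e⟩ ∈ T` means that `p` holds in the environment `e`. -/
def isSat (C M E Q H T : Tm K n) : Fm K n :=
  ball omegaT fun k => allx fun e => isFun e k M →ₒ
    (allx fun t => allx fun s => tmIn C k t ∧ₒ tmIn C k s →ₒ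
      (opT (tag 0 (opT t s)) e ∈ₒ T ↔ₒ exx fun x => exx fun y =>
        opT (opT t e) x ∈ₒ H ∧ₒ opT (opT s e) y ∈ₒ H ∧ₒ opT x y ∈ₒ E) ∧ₒ
      (opT (tag 1 (opT t s)) e ∈ₒ T ↔ₒ exx fun x => exx fun y =>
        opT (opT t e) x ∈ₒ H ∧ₒ opT (opT s e) y ∈ₒ H ∧ₒ opT x y ∈ₒ Q)) ∧ₒ
    (opT (tag 2 emptyT) e ∈ₒ T ↔ₒ .bot) ∧ₒ
    (allx fun p => allx fun q => fmIn C k p ∧ₒ fmIn C k q →ₒ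
      (opT (tag 3 (opT p q)) e ∈ₒ T ↔ₒ opT p e ∈ₒ T ∧ₒ opT q e ∈ₒ T) ∧ₒ
      (opT (tag 4 (opT p q)) e ∈ₒ T ↔ₒ opT p e ∈ₒ T ∨ₒ opT q e ∈ₒ T) ∧ₒ
      (opT (tag 5 (opT p q)) e ∈ₒ T ↔ₒ (opT p e ∈ₒ T →ₒ opT q e ∈ₒ T))) ∧ₒ
    (allx fun p => fmIn C (sucT k) p →ₒ
      (opT (tag 6 p) e ∈ₒ T ↔ₒ ball M fun x => opT p (extT e k x) ∈ₒ T) ∧ₒ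
      (opT (tag 7 p) e ∈ₒ T ↔ₒ bex M fun x => opT p (extT e k x) ∈ₒ T))

/-- The formula `p` holds at the parameters `f` (a sequence of length `k`) and `x`. -/
def holds₁ (T k f p x : Tm K n) : Fm K n := opT p (extT f k x) ∈ₒ T

/-- The formula `p` holds at the parameters `f` (a sequence of length `k`), `x` and `y`. -/
def holds₂ (T k f p x y : Tm K n) : Fm K n := opT p (extT (extT f k x) (sucT k) y) ∈ₒ T

/-- The Leibniz axiom of every formula is satisfied. -/
def satLeibniz (C M Q T : Tm K n) : Fm K n :=
  ball omegaT fun k => allx fun p => allx fun f => fmIn C (sucT k) p ∧ₒ isFun f k M →ₒ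
    ball M fun a => ball M fun b => opT a b ∈ₒ Q ∧ₒ holds₁ T k f p a →ₒ holds₁ T k f p b

/-- The Separation axiom of every formula is satisfied. -/
def satSep (C M E G T : Tm K n) : Fm K n :=
  ball omegaT fun k => allx fun p => allx fun f => fmIn C (sucT k) p ∧ₒ isFun f k M →ₒ
    ball M fun a => ball M fun c => allx fun s => opT (opT (tag 5 p) (extT f k a)) s ∈ₒ G →ₒ
      (opT c s ∈ₒ E ↔ₒ opT c a ∈ₒ E ∧ₒ holds₁ T k f p c)

/-- The Replacement axiom of every formula is satisfied. -/
def satRepl (C M E Q G T : Tm K n) : Fm K n :=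
  ball omegaT fun k => allx fun p => allx fun f => fmIn C (sucT (sucT k)) p ∧ₒ isFun f k M →ₒ
    ball M fun a => ball M fun c => allx fun r => opT (opT (tag 6 p) (extT f k a)) r ∈ₒ G →ₒ
      (opT c r ∈ₒ E ↔ₒ
        (ball M fun x => opT x a ∈ₒ E →ₒ bex M fun y => holds₂ T k f p x y ∧ₒ
          ball M fun z => holds₂ T k f p x z →ₒ opT z y ∈ₒ Q) ∧ₒ
        bex M fun x => opT x a ∈ₒ E ∧ₒ holds₂ T k f p x c)

/-- The Induction axiom of every formula is satisfied. -/
def satInd (C M E T : Tm K n) : Fm K n :=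
  ball omegaT fun k => allx fun p => allx fun f => fmIn C (sucT k) p ∧ₒ isFun f k M →ₒ
    (ball M fun a => (ball M fun b => opT b a ∈ₒ E →ₒ holds₁ T k f p b) →ₒ holds₁ T k f p a) →ₒ
      ball M fun a => holds₁ T k f p a

/-- All the sentences of the list `A` are satisfied. -/
def satAll (T : Tm K n) : List (Fm Empty 0) → Fm K n
  | [] => .bot →ₒ .bot
  | φ :: A => opT φ.code emptyT ∈ₒ T ∧ₒ satAll T A

/-- The structure `(M, E, Q, G)` is a model of `IZF_R` and of the sentences of the list `A`. -/
def isModel (A : List (Fm Empty 0)) (C M E Q G : Tm K n) : Fm K n :=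
  isStruct C M G ∧ₒ exx fun H => isEval C M G H ∧ₒ exx fun T => isSat C M E Q H T ∧ₒ
    satAll T finAx ∧ₒ satLeibniz C M Q T ∧ₒ satSep C M E G T ∧ₒ satRepl C M E Q G T ∧ₒ
    satInd C M E T ∧ₒ satAll T A

/-- The sentence `M(IZF_R + A)`: "`IZF_R + A` has a model". -/
def hasModel (A : List (Fm Empty 0)) : Fm K 0 :=
  exx fun C => isSyntax C ∧ₒ
    exx fun M => exx fun E => exx fun Q => exx fun G => isModel A C M E Q G

/-- `v ⊨ IZF_R + A`: the set `v`, with the membership and equality relations of the universe and with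
an interpretation of the function symbols, is a model of `IZF_R + A`. -/
def setModels (v : Tm K n) (A : List (Fm Empty 0)) : Fm K n :=
  exx fun C => isSyntax C ∧ₒ exx fun E => exx fun Q => exx fun G =>
    (ball v fun x => ball v fun y => opT x y ∈ₒ E ↔ₒ x ∈ₒ y) ∧ₒ
    (ball v fun x => ball v fun y => opT x y ∈ₒ Q ↔ₒ x =ₒ y) ∧ₒ
    isModel A C v E Q G

/-- The first `k` of the sentences `M(IZF_R)`, `M(IZF_R + M(IZF_R))`, ...: the next sentence says that
`IZF_R` together with all the preceding sentences has a model. -/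
def modelAxioms : ℕ → List (Fm Empty 0)
  | 0 => []
  | k + 1 => modelAxioms k ++ [hasModel (modelAxioms k)]

end IZF

set_option linter.unusedSectionVars false

namespace IZF

/-! ## Substitution -/

section Substitution

variable {K : Type} {n m l : ℕ}

@[simp] theorem snoc_castSucc (f : Fin m → Tm K n) (t : Tm K n) (i : Fin m) :
    snoc f t i.castSucc = f i := by simp [snoc]

@[simp] theorem snoc_last (f : Fin m → Tm K n) (t : Tm K n) : snoc f t (Fin.last m) = t := by
  simp [snoc]

/-- A substitution, extended to a scope with one more variable. -/
def liftS (σ : Fin n → Tm K m) : Fin (n + 1) → Tm K (m + 1) :=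
  snoc (fun i => (σ i).lift) (.var (Fin.last m))

theorem Tm.subst_subst (σ : Fin n → Tm K m) (τ : Fin m → Tm K l) (t : Tm K n) :
    (t.subst σ).subst τ = t.subst (fun i => (σ i).subst τ) := by
  match t with
  | .var i => rfl
  | .app f u =>
    simp only [Tm.subst]
    congr 1
    funext j
    exact Tm.subst_subst σ τ (u j)

theorem Tm.subst_var (t : Tm K n) : t.subst .var = t := by
  match t with
  | .var i => rfl
  | .app f u =>
    simp only [Tm.subst]
    congr 1
    funext j
    exact Tm.subst_var (u j)

theorem Tm.lift_subst_snoc (t : Tm K n) (f : Fin n → Tm K m) (s : Tm K m) :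
    t.lift.subst (snoc f s) = t.subst f := by
  simp [Tm.lift, Tm.subst_subst, Tm.subst]

theorem liftS_subst (σ : Fin n → Tm K m) (τ : Fin m → Tm K l) :
    (fun i => (liftS σ i).subst (liftS τ)) = liftS (fun i => (σ i).subst τ) := by
  funext i
  refine Fin.lastCases ?_ (fun i => ?_) i
  · simp [liftS, Tm.subst]
  · simp only [liftS, snoc_castSucc, Tm.lift_subst_snoc]
    simp [Tm.lift, Tm.subst_subst]

theorem liftS_var : liftS (.var : Fin n → Tm K n) = .var := by
  funext i
  refine Fin.lastCases ?_ (fun i => ?_) i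
  · simp [liftS]
  · simp [liftS, Tm.lift, Tm.subst]

theorem Fm.subst_subst {n m l : ℕ} (σ : Fin n → Tm K m) (τ : Fin m → Tm K l) (φ : Fm K n) :
    (φ.subst σ).subst τ = φ.subst (fun i => (σ i).subst τ) := by
  match φ with
  | .mem t s => simp [Fm.subst, Tm.subst_subst]
  | .eq t s => simp [Fm.subst, Tm.subst_subst]
  | .bot => simp [Fm.subst]
  | .and φ ψ => simp [Fm.subst, Fm.subst_subst σ τ φ, Fm.subst_subst σ τ ψ]
  | .or φ ψ => simp [Fm.subst, Fm.subst_subst σ τ φ, Fm.subst_subst σ τ ψ]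
  | .imp φ ψ => simp [Fm.subst, Fm.subst_subst σ τ φ, Fm.subst_subst σ τ ψ]
  | .all φ =>
    have := liftS_subst σ τ
    simp only [liftS] at this
    simp [Fm.subst, Fm.subst_subst _ _ φ, this]
  | .ex φ =>
    have := liftS_subst σ τ
    simp only [liftS] at this
    simp [Fm.subst, Fm.subst_subst _ _ φ, this]

theorem Fm.subst_var {n : ℕ} (φ : Fm K n) : φ.subst .var = φ := by
  match φ with
  | .mem t s => simp [Fm.subst, Tm.subst_var]
  | .eq t s => simp [Fm.subst, Tm.subst_var]
  | .bot => simp [Fm.subst]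
  | .and φ ψ => simp [Fm.subst, Fm.subst_var φ, Fm.subst_var ψ]
  | .or φ ψ => simp [Fm.subst, Fm.subst_var φ, Fm.subst_var ψ]
  | .imp φ ψ => simp [Fm.subst, Fm.subst_var φ, Fm.subst_var ψ]
  | .all φ =>
    have := liftS_var (K := K) (n := n)
    simp only [liftS] at this
    simp [Fm.subst, this, Fm.subst_var φ]
  | .ex φ =>
    have := liftS_var (K := K) (n := n)
    simp only [liftS] at this
    simp [Fm.subst, this, Fm.subst_var φ]

theorem Fm.lift_subst_liftS (σ : Fin n → Tm K m) (φ : Fm K n) :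
    φ.lift.subst (liftS σ) = (φ.subst σ).lift := by
  simp [Fm.lift, Fm.subst_subst, Tm.subst, liftS, Tm.lift]

theorem Fm.inst_subst (σ : Fin n → Tm K m) (φ : Fm K (n + 1)) (t : Tm K n) :
    (φ.inst t).subst σ = (φ.subst (liftS σ)).inst (t.subst σ) := by
  simp only [Fm.inst, Fm.subst_subst]
  congr 1
  funext i
  refine Fin.lastCases ?_ (fun i => ?_) i
  · simp [liftS, Tm.subst]
  · simp [liftS, Tm.lift_subst_snoc, Tm.subst_var, Tm.subst]

end Substitution

/-! ## Structural properties of derivations -/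

section Derivations

variable {K : Type} {n : ℕ}

theorem Derives.weaken {n : ℕ} {Γ Δ : Set (Fm K n)} {φ : Fm K n} (h : Derives Γ φ)
    (hs : Γ ⊆ Δ) : Derives Δ φ := by
  induction h with
  | ax h => exact .ax (hs h)
  | impE _ _ h1 h2 => exact .impE (h1 hs) (h2 hs)
  | impI _ h => exact .impI (h (Set.insert_subset_insert hs))
  | andI _ _ h1 h2 => exact .andI (h1 hs) (h2 hs)
  | andE₁ _ h => exact .andE₁ (h hs)
  | andE₂ _ h => exact .andE₂ (h hs)
  | orI₁ _ h => exact .orI₁ (h hs)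
  | orI₂ _ h => exact .orI₂ (h hs)
  | orE _ _ _ h h1 h2 =>
    exact .orE (h hs) (h1 (Set.insert_subset_insert hs)) (h2 (Set.insert_subset_insert hs))
  | allI _ h => exact .allI (h (Set.image_mono hs))
  | allE t _ h => exact .allE t (h hs)
  | botE _ h => exact .botE (h hs)
  | exI t _ h => exact .exI t (h hs)
  | exE _ _ h h1 => exact .exE (h hs) (h1 (Set.insert_subset_insert (Set.image_mono hs)))

theorem image_lift_image_subst {n m : ℕ} (σ : Fin n → Tm K m) (Γ : Set (Fm K n)) :
    Fm.subst (liftS σ) '' (Fm.lift '' Γ) = Fm.lift '' (Fm.subst σ '' Γ) := by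
  simp only [Set.image_image, Fm.lift_subst_liftS]

theorem Derives.subst {n : ℕ} {Γ : Set (Fm K n)} {φ : Fm K n} (h : Derives Γ φ) :
    ∀ {m : ℕ} (σ : Fin n → Tm K m), Derives (Fm.subst σ '' Γ) (φ.subst σ) := by
  induction h with
  | ax h => exact fun σ => .ax ⟨_, h, rfl⟩
  | impE _ _ h1 h2 => exact fun σ => .impE (h1 σ) (h2 σ)
  | impI _ h => exact fun σ => .impI (by simpa only [Set.image_insert_eq] using h σ)
  | andI _ _ h1 h2 => exact fun σ => .andI (h1 σ) (h2 σ)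
  | andE₁ _ h => exact fun σ => .andE₁ (h σ)
  | andE₂ _ h => exact fun σ => .andE₂ (h σ)
  | orI₁ _ h => exact fun σ => .orI₁ (h σ)
  | orI₂ _ h => exact fun σ => .orI₂ (h σ)
  | orE _ _ _ h h1 h2 =>
    exact fun σ => .orE (h σ) (by simpa only [Set.image_insert_eq] using h1 σ)
      (by simpa only [Set.image_insert_eq] using h2 σ)
  | allI _ h =>
    intro m σ
    have := h (liftS σ)
    rw [image_lift_image_subst] at this
    exact .allI this
  | allE t _ h =>
    intro m σ
    rw [Fm.inst_subst]
    exact .allE _ (h σ)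
  | botE _ h => exact fun σ => .botE (h σ)
  | exI t _ h =>
    intro m σ
    have := h σ
    rw [Fm.inst_subst] at this
    exact .exI _ this
  | exE _ _ h h1 =>
    intro m σ
    have := h1 (liftS σ)
    rw [Set.image_insert_eq, image_lift_image_subst, Fm.lift_subst_liftS] at this
    exact .exE (h σ) this

end Derivations

/-! ## Structures with truth values in a frame -/

/-- A structure for the language with additional constants `K`, with domain `D`, in which the
relations have values in `Ω`. -/
class Str (K : outParam Type) (Ω : outParam Type) (D : Type) where
  fn : {m : ℕ} → Sym K m → (Fin m → D) → D
  mem : D → D → Ω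
  eq : D → D → Ω

section Semantics

variable {K Ω D : Type} [Order.Frame Ω] [Str K Ω D] {n m : ℕ}

/-- The environment `e`, followed by `x`. -/
def esnoc (e : Fin n → D) (x : D) : Fin (n + 1) → D := Fin.snoc (α := fun _ => D) e x

@[simp] theorem esnoc_castSucc (e : Fin n → D) (x : D) (i : Fin n) :
    esnoc e x i.castSucc = e i := by simp [esnoc]

@[simp] theorem esnoc_last (e : Fin n → D) (x : D) : esnoc e x (Fin.last n) = x := by
  simp [esnoc]

/-- The value of a term. -/
def Tm.eval (e : Fin n → D) : Tm K n → D
  | .var i => e i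
  | .app f u => Str.fn f (fun j => (u j).eval e)

/-- The truth value of a formula. -/
def Fm.eval : {n : ℕ} → (Fin n → D) → Fm K n → Ω
  | _, e, .mem t s => Str.mem (t.eval e) (s.eval e)
  | _, e, .eq t s => Str.eq (t.eval e) (s.eval e)
  | _, _, .bot => ⊥
  | _, e, .and φ ψ => φ.eval e ⊓ ψ.eval e
  | _, e, .or φ ψ => φ.eval e ⊔ ψ.eval e
  | _, e, .imp φ ψ => φ.eval e ⇨ ψ.eval e
  | _, e, .all φ => ⨅ x : D, φ.eval (esnoc e x)
  | _, e, .ex φ => ⨆ x : D, φ.eval (esnoc e x)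

theorem Tm.eval_subst (e : Fin m → D) (σ : Fin n → Tm K m) (t : Tm K n) :
    (t.subst σ).eval e = t.eval (fun i => (σ i).eval e) := by
  match t with
  | .var i => rfl
  | .app f u =>
    simp only [Tm.subst, Tm.eval]
    congr 1
    funext j
    exact Tm.eval_subst e σ (u j)

@[simp] theorem Tm.eval_lift (e : Fin n → D) (x : D) (t : Tm K n) :
    t.lift.eval (esnoc e x) = t.eval e := by
  simp [Tm.lift, Tm.eval_subst, Tm.eval]

theorem eval_snoc (e : Fin m → D) (σ : Fin n → Tm K m) (t : Tm K m) :
    (fun i => (snoc σ t i).eval e) = esnoc (fun i => (σ i).eval e) (t.eval e) := by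
  funext i
  refine Fin.lastCases ?_ (fun i => ?_) i <;> simp

theorem eval_liftS (e : Fin m → D) (σ : Fin n → Tm K m) (x : D) :
    (fun i => (liftS σ i).eval (esnoc e x)) = esnoc (fun i => (σ i).eval e) x := by
  simp [liftS, eval_snoc, Tm.eval]

theorem Fm.eval_subst {n m : ℕ} (e : Fin m → D) (σ : Fin n → Tm K m) (φ : Fm K n) :
    (φ.subst σ).eval e = φ.eval (fun i => (σ i).eval e) := by
  match φ with
  | .mem t s => simp [Fm.subst, Fm.eval, Tm.eval_subst]
  | .eq t s => simp [Fm.subst, Fm.eval, Tm.eval_subst]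
  | .bot => simp [Fm.subst, Fm.eval]
  | .and φ ψ => simp [Fm.subst, Fm.eval, Fm.eval_subst e σ φ, Fm.eval_subst e σ ψ]
  | .or φ ψ => simp [Fm.subst, Fm.eval, Fm.eval_subst e σ φ, Fm.eval_subst e σ ψ]
  | .imp φ ψ => simp [Fm.subst, Fm.eval, Fm.eval_subst e σ φ, Fm.eval_subst e σ ψ]
  | .all φ =>
    have := eval_liftS e σ
    simp only [liftS] at this
    simp [Fm.subst, Fm.eval, Fm.eval_subst _ _ φ, this]
  | .ex φ =>
    have := eval_liftS e σ
    simp only [liftS] at this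
    simp [Fm.subst, Fm.eval, Fm.eval_subst _ _ φ, this]

end Semantics

/-! ## Completeness -/

section Completeness

variable {K : Type} {n m l : ℕ}

/-- The variables of a scope of `n` variables in a scope of `N` variables; the missing ones are
replaced by the empty set. -/
def raiseVar (n N : ℕ) (i : Fin n) : Tm K N := if h : i.1 < N then .var ⟨i, h⟩ else emptyT

/-- A term, moved to a scope of `N` variables. -/
def Tm.raise (N : ℕ) (t : Tm K n) : Tm K N := t.subst (raiseVar n N)

/-- A formula, moved to a scope of `N` variables. -/
def Fm.raise (N : ℕ) (φ : Fm K n) : Fm K N := φ.subst (raiseVar n N)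

theorem raiseVar_raise {N : ℕ} (h : n ≤ m) (i : Fin n) :
    (raiseVar (K := K) n m i).raise N = raiseVar n N i := by
  have h' : i.1 < m := i.2.trans_le h
  simp [raiseVar, Tm.raise, h', Tm.subst]

theorem Tm.raise_raise {N : ℕ} (h : n ≤ m) (t : Tm K n) : (t.raise m).raise N = t.raise N := by
  simp only [Tm.raise, Tm.subst_subst]
  congr 1
  funext i
  exact raiseVar_raise h i

theorem Fm.raise_raise {N : ℕ} (h : n ≤ m) (φ : Fm K n) : (φ.raise m).raise N = φ.raise N := by
  simp only [Fm.raise, Fm.subst_subst]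
  congr 1
  funext i
  exact raiseVar_raise h i

theorem raiseVar_self : raiseVar (K := K) n n = .var := by
  funext i
  simp [raiseVar]

@[simp] theorem Tm.raise_self (t : Tm K n) : t.raise n = t := by
  rw [Tm.raise, raiseVar_self, Tm.subst_var]

@[simp] theorem Fm.raise_self (φ : Fm K n) : φ.raise n = φ := by
  rw [Fm.raise, raiseVar_self, Fm.subst_var]

theorem Fm.raise_succ (φ : Fm K n) : φ.raise (n + 1) = φ.lift := by
  rw [Fm.raise, Fm.lift]
  congr 1
  funext i
  simp [raiseVar, i.2.trans (Nat.lt_succ_self n)]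
  rfl

/-- Provability in the theory `T` of a formula with free variables. -/
def Prov (T : Set (Fm K 0)) (φ : Fm K n) : Prop := Derives ((Fm.raise n) '' T) φ

variable {T : Set (Fm K 0)}

theorem raise_zero_subst (σ : Fin n → Tm K m) (φ : Fm K 0) : (φ.raise n).subst σ = φ.raise m := by
  simp only [Fm.raise, Fm.subst_subst]
  congr 1
  funext i
  exact i.elim0

theorem Prov.subst {φ : Fm K n} (h : Prov T φ) (σ : Fin n → Tm K m) : Prov T (φ.subst σ) := by
  have := Derives.subst h σ
  simp only [Set.image_image, raise_zero_subst] at this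
  exact this

theorem prov_raise_iff {N : ℕ} (h : n ≤ N) {φ : Fm K n} : Prov T (φ.raise N) ↔ Prov T φ := by
  refine ⟨fun H => ?_, fun H => H.subst _⟩
  have : Prov T ((φ.raise N).raise n) := H.subst _
  rwa [Fm.raise_raise h, Fm.raise_self] at this

theorem image_lift_raise : Fm.lift '' (Fm.raise n '' T) = Fm.raise (n + 1) '' T := by
  simp only [Set.image_image, Fm.lift, raise_zero_subst]

theorem Prov.mp {φ ψ : Fm K n} (h : Prov T (.imp φ ψ)) (hφ : Prov T φ) : Prov T ψ := .impE h hφ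

/-- Implications from one hypothesis, without quantifiers. -/
theorem Prov.imp_of {θ φ : Fm K n} (h : ∀ Γ : Set (Fm K n), Derives Γ θ → Derives Γ φ) :
    Prov T (.imp θ φ) := .impI (h _ (.ax (Set.mem_insert _ _)))

theorem Prov.imp_trans {φ ψ θ : Fm K n} (h : Prov T (.imp φ ψ)) (h' : Prov T (.imp ψ θ)) :
    Prov T (.imp φ θ) :=
  .impI (.impE (h'.weaken (Set.subset_insert _ _))
    (.impE (h.weaken (Set.subset_insert _ _)) (.ax (Set.mem_insert _ _))))

theorem Prov.imp_and {φ ψ θ : Fm K n} (h : Prov T (.imp θ φ)) (h' : Prov T (.imp θ ψ)) :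
    Prov T (.imp θ (.and φ ψ)) :=
  .impI (.andI (.impE (h.weaken (Set.subset_insert _ _)) (.ax (Set.mem_insert _ _)))
    (.impE (h'.weaken (Set.subset_insert _ _)) (.ax (Set.mem_insert _ _))))

theorem Prov.imp_imp {φ ψ θ : Fm K n} (h : Prov T (.imp (.and θ φ) ψ)) :
    Prov T (.imp θ (.imp φ ψ)) :=
  .impI (.impI (.impE (h.weaken ((Set.subset_insert _ _).trans (Set.subset_insert _ _)))
    (.andI (.ax (Set.mem_insert_of_mem _ (Set.mem_insert _ _))) (.ax (Set.mem_insert _ _)))))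

theorem Prov.or_imp {φ ψ θ : Fm K n} (h : Prov T (.imp φ θ)) (h' : Prov T (.imp ψ θ)) :
    Prov T (.imp (.or φ ψ) θ) :=
  .impI (.orE (.ax (Set.mem_insert _ _))
    (.impE (h.weaken ((Set.subset_insert _ _).trans (Set.subset_insert _ _)))
      (.ax (Set.mem_insert _ _)))
    (.impE (h'.weaken ((Set.subset_insert _ _).trans (Set.subset_insert _ _)))
      (.ax (Set.mem_insert _ _))))

theorem Prov.imp_all {θ : Fm K n} {φ : Fm K (n + 1)} (h : Prov T (.imp θ.lift φ)) :
    Prov T (.imp θ (.all φ)) := by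
  refine .impI (.allI ?_)
  rw [Set.image_insert_eq, image_lift_raise]
  exact .impE (h.weaken (Set.subset_insert _ _)) (.ax (Set.mem_insert _ _))

theorem Prov.ex_imp {θ : Fm K n} {φ : Fm K (n + 1)} (h : Prov T (.imp φ θ.lift)) :
    Prov T (.imp (.ex φ) θ) := by
  refine .impI (.exE (.ax (Set.mem_insert _ _)) ?_)
  rw [Set.image_insert_eq, image_lift_raise]
  exact .impE (h.weaken ((Set.subset_insert _ _).trans (Set.subset_insert _ _)))
    (.ax (Set.mem_insert _ _))

/-- Formulas with free variables, preordered by provable implication in `T`. -/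
structure Lind (T : Set (Fm K 0)) where
  scope : ℕ
  fm : Fm K scope

namespace Lind

/-- The formula in a common scope implies the other one. -/
def Le (a b : Lind T) : Prop :=
  Prov T (.imp (a.fm.raise (max a.scope b.scope)) (b.fm.raise (max a.scope b.scope)))

theorem le_iff_prov {a b : Lind T} {N : ℕ} (ha : a.scope ≤ N) (hb : b.scope ≤ N) :
    Le a b ↔ Prov T (.imp (a.fm.raise N) (b.fm.raise N)) := by
  rw [Le, ← prov_raise_iff (max_le ha hb)]
  have : ∀ {n M : ℕ} (φ ψ : Fm K n), (Fm.imp φ ψ).raise M = .imp (φ.raise M) (ψ.raise M) :=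
    fun φ ψ => rfl
  rw [this, Fm.raise_raise (le_max_left _ _), Fm.raise_raise (le_max_right _ _)]

instance : Preorder (Lind T) where
  le := Le
  le_refl a := Prov.imp_of fun _ h => h
  le_trans a b c h h' := by
    have ha : a.scope ≤ max a.scope (max b.scope c.scope) := le_max_left _ _
    have hb : b.scope ≤ max a.scope (max b.scope c.scope) := by simp
    have hc : c.scope ≤ max a.scope (max b.scope c.scope) := by simp
    exact (le_iff_prov ha hc).2 (((le_iff_prov ha hb).1 h).imp_trans ((le_iff_prov hb hc).1 h'))

theorem le_iff {a b : Lind T} {N : ℕ} (ha : a.scope ≤ N) (hb : b.scope ≤ N) :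
    a ≤ b ↔ Prov T (.imp (a.fm.raise N) (b.fm.raise N)) := le_iff_prov ha hb

theorem raise_equiv {n N : ℕ} (h : n ≤ N) (φ : Fm K n) :
    (⟨N, φ.raise N⟩ : Lind T) ≤ ⟨n, φ⟩ ∧ (⟨n, φ⟩ : Lind T) ≤ ⟨N, φ.raise N⟩ := by
  constructor <;>
  · rw [le_iff (N := N) (by simp [h]) (by simp [h])]
    simpa using Prov.imp_of fun _ h => h

/-- Implication, in a common scope. -/
def imp (a b : Lind T) : Lind T :=
  ⟨max a.scope b.scope, .imp (a.fm.raise _) (b.fm.raise _)⟩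

theorem le_imp_iff {v b c : Lind T} : v ≤ imp b c ↔ ∀ d, d ≤ v → d ≤ b → d ≤ c := by
  have e : ∀ {n M : ℕ} (φ ψ : Fm K n), (Fm.imp φ ψ).raise M = .imp (φ.raise M) (ψ.raise M) :=
    fun φ ψ => rfl
  constructor
  · intro h d hdv hdb
    let N := max d.scope (max b.scope c.scope)
    have hd : d.scope ≤ N := le_max_left _ _
    have hb : b.scope ≤ N := (le_max_left _ _).trans (le_max_right _ _)
    have hc : c.scope ≤ N := (le_max_right _ _).trans (le_max_right _ _)
    have h := hdv.trans h
    rw [le_iff (N := N) hd (le_max_right _ _)] at h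
    rw [le_iff (N := N) hd hb] at hdb
    rw [le_iff (N := N) hd hc]
    simp only [imp, e, Fm.raise_raise (le_max_left b.scope c.scope),
        Fm.raise_raise (le_max_right b.scope c.scope)] at h
    exact .impI (.impE (.impE (h.weaken (Set.subset_insert _ _)) (.ax (Set.mem_insert _ _)))
      (.impE (hdb.weaken (Set.subset_insert _ _)) (.ax (Set.mem_insert _ _))))
  · intro h
    let N := max v.scope (max b.scope c.scope)
    have hvN : v.scope ≤ N := le_max_left _ _
    have hbN : b.scope ≤ N := (le_max_left _ _).trans (le_max_right _ _)
    have hcN : c.scope ≤ N := (le_max_right _ _).trans (le_max_right _ _)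
    have := h ⟨N, .and (v.fm.raise N) (b.fm.raise N)⟩ (by
      rw [le_iff (N := N) le_rfl hvN]
      simpa using Prov.imp_of fun _ h => .andE₁ h) (by
      rw [le_iff (N := N) le_rfl hbN]
      simpa using Prov.imp_of fun _ h => .andE₂ h)
    rw [le_iff (N := N) le_rfl hcN] at this
    rw [le_iff (N := N) hvN (le_max_right _ _)]
    simp only [imp, e, Fm.raise_raise (le_max_left b.scope c.scope),
      Fm.raise_raise (le_max_right b.scope c.scope)]
    simp only [Fm.raise_self] at this
    exact this.imp_imp

/-- The nucleus of the MacNeille completion. -/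
def nucleus (T : Set (Fm K 0)) : Nucleus (LowerSet (Lind T)) where
  toFun S := ⟨{w | ∀ c, (∀ v ≤ w, v ∈ S → v ≤ c) → w ≤ c}, fun a b hba ha c hc =>
    le_imp_iff.1 (hba.trans (ha (imp b c) fun _ _ hS => le_imp_iff.2 fun d hdv hdb =>
      hc d hdb (S.lower hdv hS))) b le_rfl le_rfl⟩
  map_inf' S S' := by
    apply le_antisymm
    · intro w hw
      exact ⟨fun c hc => hw c fun v hv h => hc v hv h.1, fun c hc => hw c fun v hv h => hc v hv h.2⟩
    · rintro w ⟨h, h'⟩ c hc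
      refine h c fun v hv hS => ?_
      have hv' := (LowerSet.lower _ hv h')
      exact hv' c fun v' hv'v hS' => hc v' (hv'v.trans hv) ⟨S.lower hv'v hS, hS'⟩
  idempotent' S := by
    intro w hw c hc
    exact hw c fun v hv hS => hS c fun v' hv' hS' => hc v' (hv'.trans hv) hS'
  le_apply' S := fun w hw c hc => hc w le_rfl hw

/-- The frame of truth values of the canonical structure. -/
abbrev Val (T : Set (Fm K 0)) : Type := Set.range (nucleus T)

/-- The truth value of a formula of the canonical structure. -/
def val (a : Lind T) : Val T :=
  ⟨LowerSet.Iic a, Nucleus.mem_range.2 (le_antisymm (fun _ hw => hw a fun _ _ h => h)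
    Nucleus.le_apply)⟩

theorem val_le_iff_mem {a : Lind T} {x : Val T} : val a ≤ x ↔ a ∈ x.1 :=
  LowerSet.Iic_le

theorem val_le_val {a b : Lind T} : val a ≤ val b ↔ a ≤ b := val_le_iff_mem

theorem val_le_of {w : Lind T} {x : Val T}
    (h : ∀ c, (∀ v ≤ w, val v ≤ x → v ≤ c) → w ≤ c) : val w ≤ x := by
  rw [val_le_iff_mem, ← Nucleus.mem_range.1 x.2]
  exact fun c hc => h c fun v hv hx => hc v hv (val_le_iff_mem.1 hx)

theorem le_of_val {x y : Val T} (h : ∀ w, val w ≤ x → val w ≤ y) : x ≤ y :=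
  fun w hw => val_le_iff_mem.1 (h w (val_le_iff_mem.2 hw))

theorem val_congr {a b : Lind T} (h : a ≤ b ∧ b ≤ a) : val a = val b :=
  le_antisymm (val_le_val.2 h.1) (val_le_val.2 h.2)

theorem val_raise {n N : ℕ} (h : n ≤ N) (φ : Fm K n) :
    (val ⟨N, φ.raise N⟩ : Val T) = val ⟨n, φ⟩ := val_congr (raise_equiv h φ)

variable {N : ℕ}

theorem same_scope {φ ψ : Fm K N} : (⟨N, φ⟩ : Lind T) ≤ ⟨N, ψ⟩ ↔ Prov T (.imp φ ψ) := by
  rw [le_iff (N := N) le_rfl le_rfl]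
  simp

theorem val_and (φ ψ : Fm K N) : (val ⟨N, .and φ ψ⟩ : Val T) = val ⟨N, φ⟩ ⊓ val ⟨N, ψ⟩ := by
  apply le_antisymm
  · exact le_inf (val_le_val.2 (same_scope.2 (Prov.imp_of fun _ h => .andE₁ h)))
      (val_le_val.2 (same_scope.2 (Prov.imp_of fun _ h => .andE₂ h)))
  · refine le_of_val fun w hw => val_le_val.2 ?_
    obtain ⟨h1, h2⟩ := le_inf_iff.1 hw
    rw [val_le_val] at h1 h2
    have hw := le_max_left w.scope N
    have hN := le_max_right w.scope N
    rw [le_iff hw hN] at h1 h2 ⊢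
    exact h1.imp_and h2

theorem val_imp (φ ψ : Fm K N) : (val ⟨N, .imp φ ψ⟩ : Val T) = val ⟨N, φ⟩ ⇨ val ⟨N, ψ⟩ := by
  have key : (val ⟨N, .imp φ ψ⟩ : Val T) = val (imp ⟨N, φ⟩ ⟨N, ψ⟩) := by
    have := val_raise (T := T) (le_max_left N N) (.imp φ ψ)
    rw [← this]
    rfl
  rw [key]
  apply le_antisymm
  · rw [le_himp_iff]
    refine le_of_val fun w hw => ?_
    obtain ⟨h1, h2⟩ := le_inf_iff.1 hw
    rw [val_le_val] at h1 h2 ⊢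
    exact le_imp_iff.1 h1 w le_rfl h2
  · refine le_of_val fun w hw => val_le_val.2 (le_imp_iff.2 fun d hdw hd => val_le_val.1 ?_)
    exact (le_inf ((val_le_val.2 hdw).trans hw) (val_le_val.2 hd)).trans (le_himp_iff.1 le_rfl)

theorem val_or (φ ψ : Fm K N) : (val ⟨N, .or φ ψ⟩ : Val T) = val ⟨N, φ⟩ ⊔ val ⟨N, ψ⟩ := by
  have h1 : (⟨N, φ⟩ : Lind T) ≤ ⟨N, .or φ ψ⟩ := same_scope.2 (Prov.imp_of fun _ h => .orI₁ h)
  have h2 : (⟨N, ψ⟩ : Lind T) ≤ ⟨N, .or φ ψ⟩ := same_scope.2 (Prov.imp_of fun _ h => .orI₂ h)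
  apply le_antisymm
  · refine val_le_of fun c hc => ?_
    have e1 := hc _ h1 le_sup_left
    have e2 := hc _ h2 le_sup_right
    have hc := le_max_left c.scope N
    have hN := le_max_right c.scope N
    rw [le_iff hN hc] at e1 e2 ⊢
    exact e1.or_imp e2
  · exact sup_le (val_le_val.2 h1) (val_le_val.2 h2)

theorem val_bot : (val ⟨N, .bot⟩ : Val T) = ⊥ := by
  refine le_bot_iff.1 (val_le_of fun c _ => ?_)
  have hc := le_max_left c.scope N
  have hN := le_max_right c.scope N
  rw [le_iff hN hc]
  exact Prov.imp_of fun _ h => .botE h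

theorem val_eq_top {φ : Fm K N} : (val ⟨N, φ⟩ : Val T) = ⊤ ↔ Prov T φ := by
  constructor
  · intro h
    have : val (⟨N, .imp .bot .bot⟩ : Lind T) ≤ val ⟨N, φ⟩ := h ▸ le_top
    exact (same_scope.1 (val_le_val.1 this)).mp (Prov.imp_of fun _ h => h)
  · intro h
    refine top_le_iff.1 (le_of_val fun w _ => val_le_val.2 ?_)
    have hw := le_max_left w.scope N
    have hN := le_max_right w.scope N
    rw [le_iff hw hN]
    exact .impI (((prov_raise_iff hN).2 h).weaken (Set.subset_insert _ _))

end Lind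

/-- The domain of the canonical structure: terms with free variables. -/
structure CDom (T : Set (Fm K 0)) where
  scope : ℕ
  tm : Tm K scope

namespace CDom

open Lind

instance : Str K (Val T) (CDom T) where
  fn f u := ⟨Finset.univ.sup fun i => (u i).scope, .app f fun i => (u i).tm.raise _⟩
  mem a b := val ⟨max a.scope b.scope, .mem (a.tm.raise _) (b.tm.raise _)⟩
  eq a b := val ⟨max a.scope b.scope, .eq (a.tm.raise _) (b.tm.raise _)⟩

theorem eval_tm {e : Fin n → CDom T} {N : ℕ} (hN : ∀ i, (e i).scope ≤ N) (t : Tm K n) :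
    (t.eval e).scope ≤ N ∧ (t.eval e).tm.raise N = t.subst (fun i => (e i).tm.raise N) := by
  match t with
  | .var i => exact ⟨hN i, rfl⟩
  | .app f u =>
    have ih := fun j => eval_tm hN (u j)
    have hs : (Finset.univ.sup fun j => ((u j).eval e).scope) ≤ N :=
      Finset.sup_le fun j _ => (ih j).1
    refine ⟨hs, ?_⟩
    change Tm.app f (fun j => Tm.raise N (Tm.raise (Finset.univ.sup fun j => ((u j).eval e).scope)
      ((u j).eval e).tm)) = Tm.app f _
    congr 1
    funext j
    rw [Tm.raise_raise (Finset.le_sup (f := fun j => ((u j).eval e).scope) (Finset.mem_univ j)),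
      (ih j).2]

theorem subst_raise {e : Fin n → CDom T} {N M : ℕ} (hN : ∀ i, (e i).scope ≤ N) :
    (fun i => ((e i).tm.raise N).subst (raiseVar N M)) = fun i => (e i).tm.raise M := by
  funext i
  exact Tm.raise_raise (hN i) _

theorem inst_raise {e : Fin n → CDom T} {N M : ℕ} (hN : ∀ i, (e i).scope ≤ N) (d : CDom T)
    (φ : Fm K (n + 1)) :
    ((φ.subst (liftS fun i => (e i).tm.raise N)).subst (liftS (raiseVar N M))).inst (d.tm.raise M) =
      φ.subst (fun i => (esnoc e d i).tm.raise M) := by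
  simp only [Fm.inst, Fm.subst_subst]
  congr 1
  funext i
  refine Fin.lastCases ?_ (fun i => ?_) i
  · rw [esnoc_last]
    simp [liftS, Tm.subst]
  · rw [esnoc_castSucc]
    simp only [liftS, snoc_castSucc, Tm.lift_subst_snoc, Tm.subst_subst, Tm.subst_var]
    exact congrFun (subst_raise (M := M) hN) i

theorem esnoc_scope {e : Fin n → CDom T} {N : ℕ} (hN : ∀ i, (e i).scope ≤ N) (d : CDom T)
    {M : ℕ} (hM : N ≤ M) (hd : d.scope ≤ M) (i : Fin (n + 1)) : (esnoc e d i).scope ≤ M := by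
  refine Fin.lastCases ?_ (fun i => ?_) i
  · simpa
  · simpa using (hN i).trans hM

theorem subst_fresh {e : Fin n → CDom T} {N M : ℕ} (hN : ∀ i, (e i).scope ≤ N) (hM : N ≤ M)
    (φ : Fm K (n + 1)) :
    φ.subst (fun i => (esnoc e (⟨M + 1, .var (Fin.last M)⟩ : CDom T) i).tm.raise (M + 1)) =
      (φ.subst (liftS fun i => (e i).tm.raise N)).subst (liftS (raiseVar N M)) := by
  simp only [Fm.subst_subst]
  congr 1
  funext i
  refine Fin.lastCases ?_ (fun i => ?_) i
  · rw [esnoc_last]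
    simp [liftS, Tm.subst]
  · rw [esnoc_castSucc]
    simp only [liftS, snoc_castSucc, Tm.lift_subst_snoc]
    have : (fun i => (raiseVar (K := K) N M i).lift) = raiseVar N (M + 1) := by
      funext i
      have h : i.1 < M := i.2.trans_le hM
      simp [raiseVar, h, h.trans (Nat.lt_succ_self M), Tm.lift, Tm.subst]
    rw [this]
    exact (Tm.raise_raise (hN i) _).symm

/-- In the canonical structure, the truth value of a formula is its class. -/
theorem eval_fm {n : ℕ} (φ : Fm K n) {e : Fin n → CDom T} {N : ℕ} (hN : ∀ i, (e i).scope ≤ N) :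
    φ.eval e = val ⟨N, φ.subst (fun i => (e i).tm.raise N)⟩ := by
  match φ with
  | .mem t s =>
    obtain ⟨h1, h1'⟩ := eval_tm hN t
    obtain ⟨h2, h2'⟩ := eval_tm hN s
    simp only [Fm.eval, Fm.subst, ← h1', ← h2']
    refine (val_raise (max_le h1 h2) _).symm.trans ?_
    simp only [Fm.raise, Fm.subst]
    congr 3
    · exact Tm.raise_raise (le_max_left _ _) _
    · exact Tm.raise_raise (le_max_right _ _) _
  | .eq t s =>
    obtain ⟨h1, h1'⟩ := eval_tm hN t
    obtain ⟨h2, h2'⟩ := eval_tm hN s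
    simp only [Fm.eval, Fm.subst, ← h1', ← h2']
    refine (val_raise (max_le h1 h2) _).symm.trans ?_
    simp only [Fm.raise, Fm.subst]
    congr 3
    · exact Tm.raise_raise (le_max_left _ _) _
    · exact Tm.raise_raise (le_max_right _ _) _
  | .bot => exact val_bot.symm
  | .and φ ψ => simp only [Fm.eval, Fm.subst, val_and, eval_fm φ hN, eval_fm ψ hN]
  | .or φ ψ => simp only [Fm.eval, Fm.subst, val_or, eval_fm φ hN, eval_fm ψ hN]
  | .imp φ ψ => simp only [Fm.eval, Fm.subst, val_imp, eval_fm φ hN, eval_fm ψ hN]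
  | .all φ =>
    simp only [Fm.eval, Fm.subst]
    apply le_antisymm
    · refine le_of_val fun w hw => val_le_val.2 ?_
      have hwM := le_max_left w.scope N
      have hNM := le_max_right w.scope N
      rw [le_iff hwM hNM]
      have h1 := hw.trans (iInf_le _ ⟨max w.scope N + 1, .var (Fin.last _)⟩)
      rw [eval_fm φ (esnoc_scope hN _ (hNM.trans (Nat.le_succ _)) le_rfl), val_le_val,
        le_iff (N := max w.scope N + 1) (hwM.trans (Nat.le_succ _)) le_rfl, subst_fresh hN hNM,
        Fm.raise_self, ← Fm.raise_raise hwM, Fm.raise_succ] at h1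
      exact h1.imp_all
    · refine le_iInf fun d => ?_
      have hNM := le_max_left N d.scope
      have hdM := le_max_right N d.scope
      rw [eval_fm φ (esnoc_scope hN d hNM hdM), val_le_val, le_iff hNM le_rfl, Fm.raise_self,
        ← inst_raise hN]
      exact Prov.imp_of fun _ h => .allE _ h
  | .ex φ =>
    simp only [Fm.eval, Fm.subst]
    have hle : ∀ (d : CDom T) (M : ℕ), N ≤ M →
        (⟨M, φ.subst fun i => (esnoc e d i).tm.raise M⟩ : Lind T) ≤
          ⟨N, .ex (φ.subst (liftS fun i => (e i).tm.raise N))⟩ := fun d M hM => by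
      rw [le_iff le_rfl hM, Fm.raise_self, ← inst_raise hN]
      exact Prov.imp_of fun _ h => .exI _ h
    have he : ∀ (d : CDom T) (M : ℕ), N ≤ M → d.scope ≤ M → φ.eval (esnoc e d) =
        val ⟨M, φ.subst fun i => (esnoc e d i).tm.raise M⟩ := fun d M hM hd =>
      eval_fm φ (esnoc_scope hN d hM hd)
    apply le_antisymm
    · exact iSup_le fun d => (he d _ (le_max_left _ _) (le_max_right _ _)).trans_le
        (val_le_val.2 (hle d _ (le_max_left _ _)))
    · refine val_le_of fun c hc => ?_
      have hcM := le_max_left c.scope N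
      have hNM := le_max_right c.scope N
      have h1 := hc _ (hle ⟨max c.scope N + 1, .var (Fin.last _)⟩ _ (hNM.trans (Nat.le_succ _)))
        ((he _ _ (hNM.trans (Nat.le_succ _)) le_rfl).symm.trans_le
          (le_iSup (fun d => φ.eval (esnoc e d)) _))
      rw [le_iff (N := max c.scope N + 1) le_rfl (hcM.trans (Nat.le_succ _)), subst_fresh hN hNM,
        Fm.raise_self, ← Fm.raise_raise hcM, Fm.raise_succ] at h1
      rw [le_iff hNM hcM]
      exact h1.ex_imp

end CDom

/-- Completeness of intuitionistic logic with respect to structures with truth values in frames. -/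
theorem derives_of_forall_frame (T : Set (Fm K 0)) (ψ : Fm K 0)
    (h : ∀ (Ω D : Type) [Order.Frame Ω] [Str K Ω D], (∀ φ ∈ T, φ.eval (![] : Fin 0 → D) = ⊤) →
      ψ.eval (![] : Fin 0 → D) = ⊤) : Derives T ψ := by
  have key : ∀ φ : Fm K 0, φ.eval (![] : Fin 0 → CDom T) = Lind.val ⟨0, φ⟩ := fun φ => by
    rw [CDom.eval_fm (N := 0) φ fun i => i.elim0]
    congr 2
    refine Eq.trans ?_ (Fm.subst_var φ)
    congr 1
    funext i
    exact i.elim0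
  have hT : Fm.raise 0 '' T = T := by
    have : (Fm.raise 0 : Fm K 0 → Fm K 0) = id := funext Fm.raise_self
    rw [this, Set.image_id]
  have := h (Lind.Val T) (CDom T) fun φ hφ => by
    rw [key, Lind.val_eq_top, Prov, hT]
    exact .ax hφ
  rwa [key, Lind.val_eq_top, Prov, hT] at this

end Completeness

/-! ## Forcing -/

section Forcing

variable {Ω : Type} [Order.Frame Ω]

/-- `u` forces `p`. -/
def Forces (u p : Ω) : Prop := u ≤ p

infix:45 "⊩" => Forces

/-- Equivalence of truth values. -/
def biimp (p q : Ω) : Ω := (p ⇨ q) ⊓ (q ⇨ p)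

infix:60 "⇔ᵢ" => biimp

/-- The world `v` was introduced as an extension of the world `u`. -/
class Ext (v : Ω) (u : outParam Ω) : Prop where
  le : v ≤ u

/-- The world `v` extends the world `u`. -/
class Below (v u : Ω) : Prop where
  le : v ≤ u

instance Below.step {v u w : Ω} [h : Ext v u] [h' : Below u w] : Below v w := ⟨h.le.trans h'.le⟩

instance Below.rfl {u : Ω} : Below u u := ⟨le_rfl⟩

variable {u v w p q r : Ω} {ι : Type} {P Q : ι → Ω}

theorem Forces.up [Below v u] (h : u ⊩ p) : v ⊩ p := (Below.le (v := v) (u := u)).trans h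

theorem Forces.mono (h : u ⊩ p) (hv : v ≤ u) : v ⊩ p := hv.trans h

theorem Forces.self : u ⊩ u := le_rfl

theorem Forces.elim (h : u ⊩ ⊥) : u ⊩ p := le_trans h bot_le

theorem forces_and : u ⊩ p ⊓ q ↔ u ⊩ p ∧ u ⊩ q := le_inf_iff

theorem Forces.and (h : u ⊩ p) (h' : u ⊩ q) : u ⊩ p ⊓ q := le_inf h h'

theorem Forces.left (h : u ⊩ p ⊓ q) : u ⊩ p := le_trans h inf_le_left

theorem Forces.right (h : u ⊩ p ⊓ q) : u ⊩ q := le_trans h inf_le_right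

theorem Forces.inl (h : u ⊩ p) : u ⊩ p ⊔ q := le_trans h le_sup_left

theorem Forces.inr (h : u ⊩ q) : u ⊩ p ⊔ q := le_trans h le_sup_right

theorem Forces.all (h : ∀ x, u ⊩ P x) : u ⊩ ⨅ x, P x := le_iInf h

theorem Forces.at (h : u ⊩ ⨅ x, P x) (x : ι) : u ⊩ P x := le_trans h (iInf_le _ x)

theorem Forces.ex (x : ι) (h : u ⊩ P x) : u ⊩ ⨆ x, P x := le_trans h (le_iSup P x)

theorem impI (h : ∀ v, Ext v u → v ⊩ p → v ⊩ q) : u ⊩ p ⇨ q :=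
  le_himp_iff.2 (h (u ⊓ p) ⟨inf_le_left⟩ inf_le_right)

theorem Forces.mp [Below v u] (h : u ⊩ p ⇨ q) (hp : v ⊩ p) : v ⊩ q :=
  (le_inf (le_trans (Below.le (v := v) (u := u)) h) hp).trans (le_himp_iff.1 le_rfl)

theorem iffI (h : ∀ v, Ext v u → v ⊩ p → v ⊩ q) (h' : ∀ v, Ext v u → v ⊩ q → v ⊩ p) :
    u ⊩ p ⇔ᵢ q := (impI h).and (impI h')

theorem Forces.iff [Below v u] (h : u ⊩ p ⇔ᵢ q) : v ⊩ p ↔ v ⊩ q := ⟨h.left.mp, h.right.mp⟩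

theorem Forces.orE [Below w u] (h : u ⊩ p ⊔ q) (h₁ : ∀ v, Ext v w → v ⊩ p → v ⊩ r)
    (h₂ : ∀ v, Ext v w → v ⊩ q → v ⊩ r) : w ⊩ r := by
  have : w ≤ w ⊓ (p ⊔ q) := le_inf le_rfl (h.up (v := w))
  rw [inf_sup_left] at this
  exact this.trans (sup_le (h₁ _ ⟨inf_le_left⟩ inf_le_right) (h₂ _ ⟨inf_le_left⟩ inf_le_right))

theorem Forces.exE [Below w u] (h : u ⊩ ⨆ x, P x) (h₁ : ∀ v, Ext v w → ∀ x, v ⊩ P x → v ⊩ r) :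
    w ⊩ r := by
  have : w ≤ w ⊓ (⨆ x, P x) := le_inf le_rfl (h.up (v := w))
  rw [inf_iSup_eq] at this
  exact this.trans (iSup_le fun x => h₁ _ ⟨inf_le_left⟩ x inf_le_right)

theorem ballI (h : ∀ v, Ext v u → ∀ x, v ⊩ P x → v ⊩ Q x) : u ⊩ ⨅ x, P x ⇨ Q x :=
  Forces.all fun x => impI fun v e hp => h v e x hp

theorem Forces.ball [Below v u] (h : u ⊩ ⨅ x, P x ⇨ Q x) {x : ι} (hx : v ⊩ P x) : v ⊩ Q x :=
  (h.at x).mp hx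

theorem Forces.bex {x : ι} (h : u ⊩ P x) (h' : u ⊩ Q x) : u ⊩ ⨆ x, P x ⊓ Q x := .ex x (h.and h')

theorem Forces.bexE [Below w u] (h : u ⊩ ⨆ x, P x ⊓ Q x)
    (h₁ : ∀ v, Ext v w → ∀ x, v ⊩ P x → v ⊩ Q x → v ⊩ r) : w ⊩ r :=
  h.exE fun v e x hx => h₁ v e x hx.left hx.right

theorem forces_ext (h : ∀ u, u ⊩ p ↔ u ⊩ q) : p = q :=
  le_antisymm ((h p).1 le_rfl) ((h q).2 le_rfl)

theorem eq_of_forces (h : ∀ u, u ⊩ p → u ⊩ q) (h' : ∀ u, u ⊩ q → u ⊩ p) : p = q :=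
  forces_ext fun u => ⟨h u, h' u⟩

theorem eq_top_iff_forces : p = ⊤ ↔ ∀ u, u ⊩ p :=
  ⟨fun h _ => h ▸ le_top, fun h => top_le_iff.1 (h ⊤)⟩

theorem biimp_eq_top_iff : (p ⇔ᵢ q) = ⊤ ↔ p = q := by
  rw [biimp, inf_eq_top_iff, himp_eq_top_iff, himp_eq_top_iff, le_antisymm_iff]

end Forcing

/-! ## Definable predicates -/

section Definability

/-- Types of environments, with the parameters and the variables among the functions to `D`. -/
class Env (D : outParam Type) (X : Type) where
  atom : (X → D) → Prop
  const : ∀ c : D, atom fun _ => c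

instance {D : Type} : Env D D where
  atom s := (∃ c, s = fun _ => c) ∨ s = id
  const c := .inl ⟨c, rfl⟩

instance {D X : Type} [Env D X] : Env D (X × D) where
  atom s := (∃ s', Env.atom s' ∧ s = fun p : X × D => s' p.1) ∨ s = fun p => p.2
  const c := .inl ⟨fun _ => c, Env.const c, rfl⟩

variable {K Ω D X : Type} [Order.Frame Ω] [Str K Ω D] [Env D X]

/-- `t` is given by a term with parameters. -/
class TDef (t : X → D) : Prop where
  out : ∃ (N : ℕ) (τ : Tm K N) (s : Fin N → X → D), (∀ i, Env.atom (s i)) ∧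
    ∀ x, t x = τ.eval fun i => s i x

/-- `P` is given by a formula with parameters. -/
class Def (P : X → Ω) : Prop where
  out : ∃ (N : ℕ) (φ : Fm K N) (s : Fin N → X → D), (∀ i, Env.atom (s i)) ∧
    ∀ x, P x = φ.eval fun i => s i x

theorem TDef.of_atom {t : X → D} (h : Env.atom t) : TDef t :=
  ⟨1, .var 0, fun _ => t, fun _ => h, fun _ => rfl⟩

instance TDef.const (c : D) : TDef (fun _ : X => c) := .of_atom (Env.const c)

section Variables

theorem Env.atom_fst {s : X → D} (h : Env.atom s) : Env.atom fun p : X × D => s p.1 :=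
  .inl ⟨s, h, rfl⟩

theorem Env.atom_snd : Env.atom fun p : X × D => p.2 := .inr rfl

theorem Env.atom_id : Env.atom fun x : D => x := .inr rfl

instance TDef.id : TDef (fun x : D => x) := .of_atom Env.atom_id
instance TDef.snd : TDef (fun p : X × D => p.2) := .of_atom Env.atom_snd
instance : TDef (fun p : D × D => p.1) := .of_atom (Env.atom_fst Env.atom_id)
instance : TDef (fun p : (X × D) × D => p.1.2) := .of_atom (Env.atom_fst Env.atom_snd)
instance : TDef (fun p : (D × D) × D => p.1.1) :=
  .of_atom (Env.atom_fst (Env.atom_fst Env.atom_id))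
instance : TDef (fun p : ((X × D) × D) × D => p.1.1.2) :=
  .of_atom (Env.atom_fst (Env.atom_fst Env.atom_snd))
instance : TDef (fun p : ((D × D) × D) × D => p.1.1.1) :=
  .of_atom (Env.atom_fst (Env.atom_fst (Env.atom_fst Env.atom_id)))
instance : TDef (fun p : (((X × D) × D) × D) × D => p.1.1.1.2) :=
  .of_atom (Env.atom_fst (Env.atom_fst (Env.atom_fst Env.atom_snd)))
instance : TDef (fun p : (((D × D) × D) × D) × D => p.1.1.1.1) :=
  .of_atom (Env.atom_fst (Env.atom_fst (Env.atom_fst (Env.atom_fst Env.atom_id))))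
instance : TDef (fun p : ((((X × D) × D) × D) × D) × D => p.1.1.1.1.2) :=
  .of_atom (Env.atom_fst (Env.atom_fst (Env.atom_fst (Env.atom_fst Env.atom_snd))))
instance : TDef (fun p : (((((X × D) × D) × D) × D) × D) × D => p.1.1.1.1.1.2) :=
  .of_atom (Env.atom_fst (Env.atom_fst (Env.atom_fst (Env.atom_fst (Env.atom_fst Env.atom_snd)))))
instance : TDef (fun p : ((((((X × D) × D) × D) × D) × D) × D) × D => p.1.1.1.1.1.1.2) :=
  .of_atom (Env.atom_fst (Env.atom_fst (Env.atom_fst (Env.atom_fst (Env.atom_fst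
    (Env.atom_fst Env.atom_snd))))))
instance : TDef (fun p : (((((((X × D) × D) × D) × D) × D) × D) × D) × D => p.1.1.1.1.1.1.1.2) :=
  .of_atom (Env.atom_fst (Env.atom_fst (Env.atom_fst (Env.atom_fst (Env.atom_fst
    (Env.atom_fst (Env.atom_fst Env.atom_snd)))))))

end Variables

theorem append_atom {N N' : ℕ} {s : Fin N → X → D} {s' : Fin N' → X → D}
    (h : ∀ i, Env.atom (s i)) (h' : ∀ i, Env.atom (s' i)) (i : Fin (N + N')) :
    Env.atom (Fin.append s s' i) := by
  refine Fin.addCases (fun i => ?_) (fun i => ?_) i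
  · simpa using h i
  · simpa using h' i

theorem Tm.eval_append_left {N N' : ℕ} (τ : Tm K N) (s : Fin N → X → D) (s' : Fin N' → X → D)
    (x : X) : (τ.subst fun i => .var (i.castAdd N')).eval (fun i => Fin.append s s' i x) =
      τ.eval fun i => s i x := by
  simp [Tm.eval_subst, Tm.eval]

theorem Tm.eval_append_right {N N' : ℕ} (τ : Tm K N') (s : Fin N → X → D) (s' : Fin N' → X → D)
    (x : X) : (τ.subst fun i => .var (i.natAdd N)).eval (fun i => Fin.append s s' i x) =
      τ.eval fun i => s' i x := by
  simp [Tm.eval_subst, Tm.eval]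

theorem Fm.eval_append_left {N N' : ℕ} (φ : Fm K N) (s : Fin N → X → D) (s' : Fin N' → X → D)
    (x : X) : (φ.subst fun i => .var (i.castAdd N')).eval (fun i => Fin.append s s' i x) =
      φ.eval fun i => s i x := by
  simp [Fm.eval_subst, Tm.eval]

theorem Fm.eval_append_right {N N' : ℕ} (φ : Fm K N') (s : Fin N → X → D) (s' : Fin N' → X → D)
    (x : X) : (φ.subst fun i => .var (i.natAdd N)).eval (fun i => Fin.append s s' i x) =
      φ.eval fun i => s' i x := by
  simp [Fm.eval_subst, Tm.eval]

theorem TDef.map₂ {t s : X → D} (ht : TDef t) (hs : TDef s) (f : Sym K 2) :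
    TDef fun x => Str.fn f ![t x, s x] := by
  obtain ⟨N, τ, a, ha, e⟩ := ht
  obtain ⟨N', τ', a', ha', e'⟩ := hs
  refine ⟨N + N', .app f ![τ.subst fun i => .var (i.castAdd N'), τ'.subst fun i => .var (i.natAdd N)],
    Fin.append a a', append_atom ha ha', fun x => ?_⟩
  rw [Tm.eval]
  congr 1
  funext j
  refine Fin.cases ?_ (fun j => ?_) j
  · simp [e, Tm.eval_append_left]
  · simp [e', Tm.eval_append_right]

theorem TDef.map₁ {t : X → D} (ht : TDef t) (f : Sym K 1) : TDef fun x => Str.fn f ![t x] := by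
  obtain ⟨N, τ, a, ha, e⟩ := ht
  refine ⟨N, .app f ![τ], a, ha, fun x => ?_⟩
  rw [Tm.eval]
  congr 1
  funext j
  simp [e]

theorem Def.atomic {t s : X → D} (ht : TDef t) (hs : TDef s) (r : D → D → Ω)
    (c : ∀ {n : ℕ}, Tm K n → Tm K n → Fm K n)
    (hc : ∀ {n : ℕ} (t s : Tm K n) (e : Fin n → D), (c t s).eval e = r (t.eval e) (s.eval e)) :
    Def fun x => r (t x) (s x) := by
  obtain ⟨N, τ, a, ha, e⟩ := ht
  obtain ⟨N', τ', a', ha', e'⟩ := hs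
  refine ⟨N + N', c (τ.subst fun i => .var (i.castAdd N')) (τ'.subst fun i => .var (i.natAdd N)),
    Fin.append a a', append_atom ha ha', fun x => ?_⟩
  rw [hc, Tm.eval_append_left, Tm.eval_append_right, e, e']

instance Def.mem {t s : X → D} [ht : TDef t] [hs : TDef s] : Def fun x => Str.mem (t x) (s x) :=
  .atomic ht hs Str.mem .mem fun _ _ _ => rfl

instance Def.eq {t s : X → D} [ht : TDef t] [hs : TDef s] : Def fun x => Str.eq (t x) (s x) :=
  .atomic ht hs Str.eq .eq fun _ _ _ => rfl

instance {a : D} : Def (Str.mem a) := .mem (t := fun _ => a) (s := fun x => x)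

instance {a : D} : Def (Str.eq a) := .eq (t := fun _ => a) (s := fun x => x)

theorem Def.binary {P Q : X → Ω} (hP : Def P) (hQ : Def Q) (r : Ω → Ω → Ω)
    (c : ∀ {n : ℕ}, Fm K n → Fm K n → Fm K n)
    (hc : ∀ {n : ℕ} (t s : Fm K n) (e : Fin n → D), (c t s).eval e = r (t.eval e) (s.eval e)) :
    Def fun x => r (P x) (Q x) := by
  obtain ⟨N, τ, a, ha, e⟩ := hP
  obtain ⟨N', τ', a', ha', e'⟩ := hQ
  refine ⟨N + N', c (τ.subst fun i => .var (i.castAdd N')) (τ'.subst fun i => .var (i.natAdd N)),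
    Fin.append a a', append_atom ha ha', fun x => ?_⟩
  rw [hc, Fm.eval_append_left, Fm.eval_append_right, e, e']

variable {P Q : X → Ω}

instance Def.inf [hP : Def P] [hQ : Def Q] : Def fun x => P x ⊓ Q x :=
  .binary hP hQ (· ⊓ ·) .and fun _ _ _ => rfl

instance Def.sup [hP : Def P] [hQ : Def Q] : Def fun x => P x ⊔ Q x :=
  .binary hP hQ (· ⊔ ·) .or fun _ _ _ => rfl

instance Def.himp [hP : Def P] [hQ : Def Q] : Def fun x => P x ⇨ Q x :=
  .binary hP hQ (· ⇨ ·) .imp fun _ _ _ => rfl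

instance Def.biimp [hP : Def P] [hQ : Def Q] : Def fun x => P x ⇔ᵢ Q x :=
  .binary hP hQ (· ⇔ᵢ ·) .iff fun _ _ _ => rfl

instance Def.bot : Def fun _ : X => (⊥ : Ω) :=
  ⟨0, .bot, Fin.elim0, fun i => i.elim0, fun _ => rfl⟩

/-- In a predicate with one more variable, this variable can be made the last one. -/
theorem Def.last_variable {Q : X → D → Ω} (h : Def fun p : X × D => Q p.1 p.2) :
    ∃ (N : ℕ) (φ : Fm K (N + 1)) (s : Fin N → X → D), (∀ i, Env.atom (s i)) ∧
      ∀ x d, Q x d = φ.eval (esnoc (fun i => s i x) d) := by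
  obtain ⟨N, φ, a, ha, e⟩ := h
  have : ∀ i, ∃ (t : Tm K (N + 1)) (s : X → D), Env.atom s ∧ ∀ (s' : Fin N → X → D) (x : X) (d : D),
      s' i = s → t.eval (esnoc (fun i => s' i x) d) = a i (x, d) := by
    intro i
    rcases ha i with ⟨s, hs, h⟩ | h
    · exact ⟨.var i.castSucc, s, hs, fun s' x d h' => by simp [Tm.eval, h, h']⟩
    · exact ⟨.var (Fin.last N), fun _ => (emptyT : Tm K 0).eval ![], Env.const _,
        fun s' x d h' => by simp [Tm.eval, h]⟩
  choose t s hs h using this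
  refine ⟨N, φ.subst t, s, hs, fun x d => ?_⟩
  rw [Fm.eval_subst, e (x, d)]
  congr 1
  funext i
  exact (h i s x d rfl).symm

theorem TDef.weaken {t : X → D} (h : TDef t) : TDef fun p : X × D => t p.1 := by
  obtain ⟨N, τ, s, hs, e⟩ := h
  exact ⟨N, τ, fun i p => s i p.1, fun i => Env.atom_fst (hs i), fun p => e p.1⟩

/-- Substitution of a term in a definable predicate. -/
theorem Def.comp {Q : X → D → Ω} {t : X → D} (h : Def fun p : X × D => Q p.1 p.2) (ht : TDef t) :
    Def fun x => Q x (t x) := by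
  obtain ⟨N, φ, s, hs, e⟩ := h.last_variable
  obtain ⟨N', τ, s', hs', e'⟩ := ht
  refine ⟨N + N', φ.subst (snoc (fun i => .var (i.castAdd N')) (τ.subst fun i => .var (i.natAdd N))),
    Fin.append s s', append_atom hs hs', fun x => ?_⟩
  rw [Fm.eval_subst, eval_snoc, Tm.eval_append_right, e, e']
  simp [Tm.eval]

theorem Def.comp₂ {Q : D → D → Ω} {a b : X → D} [ha : TDef a] [hb : TDef b]
    (h : Def fun p : (X × D) × D => Q p.1.2 p.2) : Def fun x => Q (a x) (b x) :=
  (h.comp (Q := fun p y => Q p.2 y) hb.weaken).comp (Q := fun x y => Q y (b x)) ha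

theorem Def.comp₃ {Q : D → D → D → Ω} {a b c : X → D} [ha : TDef a] [hb : TDef b] [hc : TDef c]
    (h : Def fun p : ((X × D) × D) × D => Q p.1.1.2 p.1.2 p.2) :
    Def fun x => Q (a x) (b x) (c x) :=
  ((h.comp (Q := fun p y => Q p.1.2 p.2 y) hc.weaken.weaken).comp
    (Q := fun p y => Q p.2 y (c p.1)) hb.weaken).comp (Q := fun x y => Q y (b x) (c x)) ha

theorem Def.comp₄ {Q : D → D → D → D → Ω} {a b c d : X → D} [ha : TDef a] [hb : TDef b]
    [hc : TDef c] [hd : TDef d]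
    (h : Def fun p : (((X × D) × D) × D) × D => Q p.1.1.1.2 p.1.1.2 p.1.2 p.2) :
    Def fun x => Q (a x) (b x) (c x) (d x) :=
  (((h.comp (Q := fun p y => Q p.1.1.2 p.1.2 p.2 y) hd.weaken.weaken.weaken).comp
    (Q := fun p y => Q p.1.2 p.2 y (d p.1.1)) hc.weaken.weaken).comp
    (Q := fun p y => Q p.2 y (c p.1) (d p.1)) hb.weaken).comp
    (Q := fun x y => Q y (b x) (c x) (d x)) ha

theorem Def.comp₅ {Q : D → D → D → D → D → Ω} {a b c d e : X → D} [ha : TDef a] [hb : TDef b]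
    [hc : TDef c] [hd : TDef d] [he : TDef e]
    (h : Def fun p : ((((X × D) × D) × D) × D) × D =>
      Q p.1.1.1.1.2 p.1.1.1.2 p.1.1.2 p.1.2 p.2) :
    Def fun x => Q (a x) (b x) (c x) (d x) (e x) :=
  ((((h.comp (Q := fun p y => Q p.1.1.1.2 p.1.1.2 p.1.2 p.2 y)
    he.weaken.weaken.weaken.weaken).comp
    (Q := fun p y => Q p.1.1.2 p.1.2 p.2 y (e p.1.1.1)) hd.weaken.weaken.weaken).comp
    (Q := fun p y => Q p.1.2 p.2 y (d p.1.1) (e p.1.1)) hc.weaken.weaken).comp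
    (Q := fun p y => Q p.2 y (c p.1) (d p.1) (e p.1)) hb.weaken).comp
    (Q := fun x y => Q y (b x) (c x) (d x) (e x)) ha

instance Def.iInf {Q : X → D → Ω} [h : Def fun p : X × D => Q p.1 p.2] : Def fun x => ⨅ d, Q x d := by
  obtain ⟨N, φ, s, hs, e⟩ := h.last_variable
  exact ⟨N, .all φ, s, hs, fun x => by simp only [Fm.eval, e]⟩

instance Def.iSup {Q : X → D → Ω} [h : Def fun p : X × D => Q p.1 p.2] : Def fun x => ⨆ d, Q x d := by
  obtain ⟨N, φ, s, hs, e⟩ := h.last_variable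
  exact ⟨N, .ex φ, s, hs, fun x => by simp only [Fm.eval, e]⟩

/-- A definable predicate is given by a formula at some parameters. -/
theorem Def.exists_formula {P : D → Ω} (h : Def P) :
    ∃ (N : ℕ) (φ : Fm K (N + 1)) (f : Fin N → D), ∀ d, P d = φ.eval (esnoc f d) := by
  obtain ⟨N, φ, a, ha, e⟩ := h
  have : ∀ i, ∃ (t : Tm K (N + 1)) (c : D), ∀ (f : Fin N → D) (d : D),
      f i = c → t.eval (esnoc f d) = a i d := by
    intro i
    rcases ha i with ⟨c, h⟩ | h
    · exact ⟨.var i.castSucc, c, fun f d h' => by simp [Tm.eval, h, h']⟩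
    · exact ⟨.var (Fin.last N), (emptyT : Tm K 0).eval ![], fun f d h' => by simp [Tm.eval, h]⟩
  choose t f h using this
  refine ⟨N, φ.subst t, f, fun d => ?_⟩
  rw [Fm.eval_subst, e d]
  congr 1
  funext i
  exact (h i f d rfl).symm

/-- Change of the environments along a map that turns variables into variables or parameters. -/
theorem Def.reindex {Y : Type} [Env D Y] {P : X → Ω} (h : Def P) {g : Y → X}
    (hg : ∀ s : X → D, Env.atom s → Env.atom fun y => s (g y)) : Def fun y => P (g y) := by
  obtain ⟨N, φ, s, hs, e⟩ := h
  exact ⟨N, φ, fun i y => s i (g y), fun i => hg _ (hs i), fun y => e _⟩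

theorem Env.atom_comp {s : D → D} (h : Env.atom s) {g : X → D} (hg : Env.atom g) :
    Env.atom fun x => s (g x) := by
  rcases h with ⟨c, rfl⟩ | rfl
  · exact Env.const c
  · exact hg

theorem Env.atom_comp_pair {Y : Type} [Env D Y] {s : X × D → D} (h : Env.atom s) {g : Y → X}
    {g' : Y → D} (hg : ∀ s : X → D, Env.atom s → Env.atom fun y => s (g y)) (hg' : Env.atom g') :
    Env.atom fun y => s (g y, g' y) := by
  rcases h with ⟨s, hs, rfl⟩ | rfl
  · exact hg s hs
  · exact hg'

theorem Def.app₁ {P : D → Ω} (h : Def P) {a : X → D} (ha : TDef a) : Def fun x => P (a x) :=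
  .comp (Q := fun _ => P) (h.reindex (g := fun p : X × D => p.2) fun _ hs =>
    Env.atom_comp hs Env.atom_snd) ha

theorem Def.app₂ {P : D → D → Ω} (h : Def fun p : D × D => P p.1 p.2) {a b : X → D} (ha : TDef a)
    (hb : TDef b) : Def fun x => P (a x) (b x) :=
  .comp₂ (h.reindex (g := fun p : (X × D) × D => (p.1.2, p.2)) fun _ hs =>
    Env.atom_comp_pair (g := fun p : (X × D) × D => p.1.2) hs
      (fun _ hs => Env.atom_comp hs (Env.atom_fst Env.atom_snd)) Env.atom_snd)

theorem Def.app₃ {P : D → D → D → Ω} (h : Def fun p : (D × D) × D => P p.1.1 p.1.2 p.2)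
    {a b c : X → D} (ha : TDef a) (hb : TDef b) (hc : TDef c) : Def fun x => P (a x) (b x) (c x) :=
  .comp₃ (h.reindex (g := fun p : ((X × D) × D) × D => ((p.1.1.2, p.1.2), p.2)) fun _ hs =>
    Env.atom_comp_pair (g := fun p : ((X × D) × D) × D => (p.1.1.2, p.1.2)) hs
      (fun _ hs => Env.atom_comp_pair (g := fun p : ((X × D) × D) × D => p.1.1.2) hs
        (fun _ hs => Env.atom_comp hs (Env.atom_fst (Env.atom_fst Env.atom_snd)))
        (Env.atom_fst Env.atom_snd)) Env.atom_snd)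

end Definability

/-! ## Models of `IZF_R` -/

infix:75 "∈ᵢ" => Str.mem
infix:75 "=ᵢ" => Str.eq

section Operations

variable {K Ω D : Type} [Str K Ω D]

/-- The empty set. -/
def emp : D := Str.fn .empty ![]

/-- The set `ω`. -/
def om : D := Str.fn .omega ![]

/-- The unordered pair. -/
def pr (a b : D) : D := Str.fn .pair ![a, b]

/-- The union. -/
def un (a : D) : D := Str.fn .union ![a]

/-- The power set. -/
def pw (a : D) : D := Str.fn .power ![a]

/-- The singleton. -/
def sg (a : D) : D := pr a a

/-- The binary union. -/
def cup (a b : D) : D := un (pr a b)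

/-- The successor. -/
def sc (a : D) : D := cup a (sg a)

/-- The ordered pair. -/
def op (a b : D) : D := pr (sg a) (pr a b)

/-- The numerals. -/
def nm : ℕ → D
  | 0 => emp
  | k + 1 => sc (nm k)

/-- The pair of a numeral and a set. -/
def tg (k : ℕ) (a : D) : D := op (nm k) a

/-- The sequence `e` of length `k`, followed by `x`. -/
def ext (e k x : D) : D := cup e (sg (op k x))

/-- Finite sequences. -/
def seq : {m : ℕ} → (Fin m → D) → D
  | 0, _ => emp
  | m + 1, u => ext (seq fun i : Fin m => u i.castSucc) (nm m) (u (Fin.last m))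

variable {n : ℕ} (e : Fin n → D)

@[simp] theorem eval_emptyT : (emptyT : Tm K n).eval e = emp := by
  simp only [emptyT, Tm.eval, emp]
  congr 1
  funext j
  exact j.elim0

@[simp] theorem eval_omegaT : (omegaT : Tm K n).eval e = om := by
  simp only [omegaT, Tm.eval, om]
  congr 1
  funext j
  exact j.elim0

@[simp] theorem eval_pairT (a b : Tm K n) : (pairT a b).eval e = pr (a.eval e) (b.eval e) := by
  simp only [pairT, Tm.eval, pr]
  congr 1
  funext j
  refine Fin.cases rfl (fun j => ?_) j
  simp

@[simp] theorem eval_unionT (a : Tm K n) : (unionT a).eval e = un (a.eval e) := by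
  simp only [unionT, Tm.eval, un]
  congr 1
  funext j
  simp

@[simp] theorem eval_powerT (a : Tm K n) : (powerT a).eval e = pw (a.eval e) := by
  simp only [powerT, Tm.eval, pw]
  congr 1
  funext j
  simp

@[simp] theorem eval_singT (a : Tm K n) : (singT a).eval e = sg (a.eval e) := by simp [singT, sg]

@[simp] theorem eval_cupT (a b : Tm K n) : (cupT a b).eval e = cup (a.eval e) (b.eval e) := by
  simp [cupT, cup]

@[simp] theorem eval_sucT (a : Tm K n) : (sucT a).eval e = sc (a.eval e) := by simp [sucT, sc]

@[simp] theorem eval_opT (a b : Tm K n) : (opT a b).eval e = op (a.eval e) (b.eval e) := by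
  simp [opT, op]

@[simp] theorem eval_num (k : ℕ) : (num k : Tm K n).eval e = nm k := by
  induction k with
  | zero => simp [num, nm]
  | succ k ih => simp [num, nm, ih]

@[simp] theorem eval_tag (k : ℕ) (a : Tm K n) : (tag k a).eval e = tg k (a.eval e) := by
  simp [tag, tg]

@[simp] theorem eval_extT (f k x : Tm K n) :
    (extT f k x).eval e = ext (f.eval e) (k.eval e) (x.eval e) := by simp [extT, ext]

@[simp] theorem eval_seqT {m : ℕ} (u : Fin m → Tm K n) :
    (seqT u).eval e = seq fun i => (u i).eval e := by
  induction m with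
  | zero => simp [seqT, seq]
  | succ m ih => simp [seqT, seq, ih]

end Operations

section Formulas

variable {K Ω D : Type} [Order.Frame Ω] [Str K Ω D] {n m : ℕ} (e : Fin n → D)

@[simp] theorem eval_var_last (x : D) : (Tm.var (Fin.last n) : Tm K (n + 1)).eval (esnoc e x) = x := by
  simp [Tm.eval]

@[simp] theorem eval_var_zero (e : Fin 0 → D) (x : D) :
    (Tm.var 0 : Tm K (0 + 1)).eval (esnoc e x) = x := eval_var_last e x

@[simp] theorem eval_mem (t s : Tm K n) : (t ∈ₒ s).eval e = (t.eval e) ∈ᵢ (s.eval e) := rfl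
@[simp] theorem eval_eq (t s : Tm K n) : (t =ₒ s).eval e = (t.eval e) =ᵢ (s.eval e) := rfl
@[simp] theorem eval_bot : (Fm.bot : Fm K n).eval e = ⊥ := rfl
@[simp] theorem eval_and (φ ψ : Fm K n) : (φ ∧ₒ ψ).eval e = φ.eval e ⊓ ψ.eval e := rfl
@[simp] theorem eval_or (φ ψ : Fm K n) : (φ ∨ₒ ψ).eval e = φ.eval e ⊔ ψ.eval e := rfl
@[simp] theorem eval_imp (φ ψ : Fm K n) : (φ →ₒ ψ).eval e = φ.eval e ⇨ ψ.eval e := rfl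
@[simp] theorem eval_iff (φ ψ : Fm K n) : (φ ↔ₒ ψ).eval e = (φ.eval e ⇔ᵢ ψ.eval e) := rfl

@[simp] theorem eval_allx (φ : Tm K (n + 1) → Fm K (n + 1)) :
    (allx φ).eval e = ⨅ x, (φ (.var (Fin.last n))).eval (esnoc e x) := rfl

@[simp] theorem eval_exx (φ : Tm K (n + 1) → Fm K (n + 1)) :
    (exx φ).eval e = ⨆ x, (φ (.var (Fin.last n))).eval (esnoc e x) := rfl

@[simp] theorem eval_ball (a : Tm K n) (φ : Tm K (n + 1) → Fm K (n + 1)) :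
    (ball a φ).eval e = ⨅ x, x ∈ᵢ a.eval e ⇨ (φ (.var (Fin.last n))).eval (esnoc e x) := by
  simp [ball]

@[simp] theorem eval_bex (a : Tm K n) (φ : Tm K (n + 1) → Fm K (n + 1)) :
    (bex a φ).eval e = ⨆ x, x ∈ᵢ a.eval e ⊓ (φ (.var (Fin.last n))).eval (esnoc e x) := by
  simp [bex]

theorem esnoc_surjective (e : Fin (n + 1) → D) : ∃ f x, e = esnoc f x :=
  ⟨fun i => e i.castSucc, e (Fin.last n), by
    funext i
    refine Fin.lastCases ?_ (fun i => ?_) i <;> simp⟩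

theorem eval_close (φ : Fm K n) :
    (close φ).eval (![] : Fin 0 → D) = ⊤ ↔ ∀ e : Fin n → D, φ.eval e = ⊤ := by
  induction n with
  | zero => exact ⟨fun h e => by rwa [Subsingleton.elim e ![]], fun h => h _⟩
  | succ n ih =>
    rw [close, ih]
    simp only [Fm.eval, iInf_eq_top]
    refine ⟨fun h e => ?_, fun h e x => h _⟩
    obtain ⟨f, x, rfl⟩ := esnoc_surjective e
    exact h f x

@[simp] theorem eval_par_one (i : Fin n) (x : D) :
    (par n 1 i : Tm K (n + 1)).eval (esnoc e x) = e i :=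
  esnoc_castSucc e x i

@[simp] theorem eval_par_two (i : Fin n) (x y : D) :
    (par n 2 i : Tm K (n + 2)).eval (esnoc (esnoc e x) y) = e i :=
  (esnoc_castSucc _ y (i.castAdd 1)).trans (eval_par_one e i x)

@[simp] theorem eval_par_three (i : Fin n) (x y z : D) :
    (par n 3 i : Tm K (n + 3)).eval (esnoc (esnoc (esnoc e x) y) z) = e i :=
  (esnoc_castSucc _ z (i.castAdd 2)).trans (eval_par_two e i x y)

@[simp] theorem eval_par_four (i : Fin n) (x y z w : D) :
    (par n 4 i : Tm K (n + 4)).eval (esnoc (esnoc (esnoc (esnoc e x) y) z) w) = e i :=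
  (esnoc_castSucc _ w (i.castAdd 3)).trans (eval_par_three e i x y z)

@[simp] theorem eval_par_five (i : Fin n) (x y z w t : D) :
    (par n 5 i : Tm K (n + 5)).eval (esnoc (esnoc (esnoc (esnoc (esnoc e x) y) z) w) t) = e i :=
  (esnoc_castSucc _ t (i.castAdd 4)).trans (eval_par_four e i x y z w)

theorem eval_at₁ (φ : Fm K (m + 1)) (f : Fin m → Tm K n) (c : Tm K n) :
    (at₁ φ f c).eval e = φ.eval (esnoc (fun i => (f i).eval e) (c.eval e)) := by
  rw [at₁, Fm.eval_subst, eval_snoc]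

theorem eval_at₂ (φ : Fm K (m + 2)) (f : Fin m → Tm K n) (x y : Tm K n) :
    (at₂ φ f x y).eval e =
      φ.eval (esnoc (esnoc (fun i => (f i).eval e) (x.eval e)) (y.eval e)) := by
  rw [at₂, Fm.eval_subst, eval_snoc, eval_snoc]

theorem eval_axLeibniz (φ : Fm K (m + 1)) : (axLeibniz φ).eval (![] : Fin 0 → D) = ⊤ ↔
    ∀ (f : Fin m → D) (a b : D), a =ᵢ b ⊓ φ.eval (esnoc f a) ≤ φ.eval (esnoc f b) := by
  simp [axLeibniz, eval_close, eval_at₁, iInf_eq_top, himp_eq_top_iff]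

theorem eval_axSep (φ : Fm K (m + 1)) : (axSep φ).eval (![] : Fin 0 → D) = ⊤ ↔
    ∀ (f : Fin m → D) (a c : D),
      c ∈ᵢ (Str.fn (.sep φ) (esnoc f a)) = (c ∈ᵢ a ⊓ φ.eval (esnoc f c)) := by
  simp [axSep, eval_close, eval_at₁, iInf_eq_top, biimp_eq_top_iff, Tm.eval, eval_snoc]

theorem eval_axRepl (φ : Fm K (m + 2)) : (axRepl φ).eval (![] : Fin 0 → D) = ⊤ ↔
    ∀ (f : Fin m → D) (a c : D), c ∈ᵢ (Str.fn (.repl φ) (esnoc f a)) =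
      (⨅ x, x ∈ᵢ a ⇨ ⨆ y, φ.eval (esnoc (esnoc f x) y) ⊓
        ⨅ z, φ.eval (esnoc (esnoc f x) z) ⇨ z =ᵢ y) ⊓
      ⨆ x, x ∈ᵢ a ⊓ φ.eval (esnoc (esnoc f x) c) := by
  simp [axRepl, eval_close, eval_at₂, iInf_eq_top, biimp_eq_top_iff, Tm.eval, eval_snoc]

theorem eval_axInd (φ : Fm K (m + 1)) : (axInd φ).eval (![] : Fin 0 → D) = ⊤ ↔
    ∀ (f : Fin m → D), (⨅ a, (⨅ b, b ∈ᵢ a ⇨ φ.eval (esnoc f b)) ⇨ φ.eval (esnoc f a)) ≤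
      ⨅ a, φ.eval (esnoc f a) := by
  simp [axInd, eval_close, eval_at₁, himp_eq_top_iff]

variable (D) in
theorem eval_axExt : (axExt : Fm K 0).eval (![] : Fin 0 → D) = ⊤ ↔
    ∀ a b : D, a =ᵢ b = ⨅ c, c ∈ᵢ a ⇔ᵢ c ∈ᵢ b := by
  simp [axExt, iInf_eq_top, biimp_eq_top_iff, -Fin.reduceLast]

variable (D) in
theorem eval_axEmpty : (axEmpty : Fm K 0).eval (![] : Fin 0 → D) = ⊤ ↔
    ∀ c : D, c ∈ᵢ emp = ⊥ := by
  simp [axEmpty, iInf_eq_top, biimp_eq_top_iff, -Fin.reduceLast]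

variable (D) in
theorem eval_axPair : (axPair : Fm K 0).eval (![] : Fin 0 → D) = ⊤ ↔
    ∀ a b c : D, c ∈ᵢ pr a b = c =ᵢ a ⊔ c =ᵢ b := by
  simp [axPair, iInf_eq_top, biimp_eq_top_iff, -Fin.reduceLast]

variable (D) in
theorem eval_axInf : (axInf : Fm K 0).eval (![] : Fin 0 → D) = ⊤ ↔
    ∀ c : D, c ∈ᵢ om = c =ᵢ emp ⊔ ⨆ b, b ∈ᵢ om ⊓ c =ᵢ sc b := by
  simp [axInf, iInf_eq_top, biimp_eq_top_iff, -Fin.reduceLast]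

variable (D) in
theorem eval_axUnion : (axUnion : Fm K 0).eval (![] : Fin 0 → D) = ⊤ ↔
    ∀ a c : D, c ∈ᵢ un a = ⨆ b, b ∈ᵢ a ⊓ c ∈ᵢ b := by
  simp [axUnion, iInf_eq_top, biimp_eq_top_iff, -Fin.reduceLast]

variable (D) in
theorem eval_axPower : (axPower : Fm K 0).eval (![] : Fin 0 → D) = ⊤ ↔
    ∀ a c : D, c ∈ᵢ pw a = ⨅ b, b ∈ᵢ c ⇨ b ∈ᵢ a := by
  simp [axPower, iInf_eq_top, biimp_eq_top_iff, -Fin.reduceLast]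

end Formulas

/-- A structure in which the axioms of `IZF_R` are true. -/
class IsModelIZF {K Ω : Type} [Order.Frame Ω] (D : Type) [Str K Ω D] : Prop where
  out : ∀ φ : Fm K 0, IZFR K φ → φ.eval (![] : Fin 0 → D) = ⊤

section Model

variable {K Ω D : Type} [Order.Frame Ω] [Str K Ω D] [M : IsModelIZF D]

theorem eq_def (a b : D) : a =ᵢ b = ⨅ c, c ∈ᵢ a ⇔ᵢ c ∈ᵢ b :=
  (eval_axExt D).1 (M.out _ (.fin (by simp [finAx]))) a b

theorem mem_emp (c : D) : c ∈ᵢ emp = ⊥ := (eval_axEmpty D).1 (M.out _ (.fin (by simp [finAx]))) c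

theorem mem_pr (a b c : D) : c ∈ᵢ pr a b = c =ᵢ a ⊔ c =ᵢ b :=
  (eval_axPair D).1 (M.out _ (.fin (by simp [finAx]))) a b c

theorem mem_om (c : D) : c ∈ᵢ om = c =ᵢ emp ⊔ ⨆ b, b ∈ᵢ om ⊓ c =ᵢ sc b :=
  (eval_axInf D).1 (M.out _ (.fin (by simp [finAx]))) c

theorem mem_un (a c : D) : c ∈ᵢ un a = ⨆ b, b ∈ᵢ a ⊓ c ∈ᵢ b :=
  (eval_axUnion D).1 (M.out _ (.fin (by simp [finAx]))) a c

theorem mem_pw (a c : D) : c ∈ᵢ pw a = ⨅ b, b ∈ᵢ c ⇨ b ∈ᵢ a :=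
  (eval_axPower D).1 (M.out _ (.fin (by simp [finAx]))) a c

theorem exists_sep (P : D → Ω) [h : Def P] (a : D) : ∃ s : D, ∀ c, c ∈ᵢ s = c ∈ᵢ a ⊓ P c := by
  obtain ⟨N, φ, f, e⟩ := h.exists_formula
  refine ⟨_, fun c => ((eval_axSep φ).1 (M.out _ (.sep φ)) f a c).trans ?_⟩
  rw [e]

/-- The set of the elements of `a` with the property `P`. -/
noncomputable def sep (P : D → Ω) [Def P] (a : D) : D := (exists_sep P a).choose

theorem mem_sep (P : D → Ω) [Def P] (a c : D) : c ∈ᵢ sep P a = c ∈ᵢ a ⊓ P c :=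
  (exists_sep P a).choose_spec c

variable {u : Ω}

theorem Forces.leib (P : D → Ω) [h : Def P] {a b : D} (hab : u ⊩ a =ᵢ b) (ha : u ⊩ P a) :
    u ⊩ P b := by
  obtain ⟨N, φ, f, e⟩ := h.exists_formula
  have := (eval_axLeibniz φ).1 (M.out _ (.leibniz φ)) f a b
  rw [← e, ← e] at this
  exact le_trans (le_inf hab ha) this

theorem induction (P : D → Ω) [h : Def P]
    (H : ∀ v, Ext v u → ∀ a, v ⊩ (⨅ b, b ∈ᵢ a ⇨ P b) → v ⊩ P a) (a : D) : u ⊩ P a := by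
  obtain ⟨N, φ, f, e⟩ := h.exists_formula
  have := (eval_axInd φ).1 (M.out _ (.ind φ)) f
  simp only [← e] at this
  exact Forces.at (P := P) (le_trans (ballI (u := u) H) this) a

end Model

section SetTheory

variable {K Ω D X : Type} [Order.Frame Ω] [Str K Ω D] [Env D X]

/-! ## Definability of the basic operations -/

instance {t s : X → D} [ht : TDef t] [hs : TDef s] : TDef fun x => pr (t x) (s x) := .map₂ ht hs _
instance {t : X → D} [ht : TDef t] : TDef fun x => un (t x) := .map₁ ht _
instance {t : X → D} [ht : TDef t] : TDef fun x => sg (t x) := by unfold sg; infer_instance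
instance {t s : X → D} [ht : TDef t] [hs : TDef s] : TDef fun x => cup (t x) (s x) := by
  unfold cup; infer_instance
instance {t : X → D} [ht : TDef t] : TDef fun x => sc (t x) := by unfold sc; infer_instance
instance {t s : X → D} [ht : TDef t] [hs : TDef s] : TDef fun x => op (t x) (s x) := by
  unfold op; infer_instance
instance {k : ℕ} {t : X → D} [ht : TDef t] : TDef fun x => tg k (t x) := by
  unfold tg; infer_instance
instance {t s r : X → D} [ht : TDef t] [hs : TDef s] [hr : TDef r] :
    TDef fun x => ext (t x) (s x) (r x) := by
  unfold ext; infer_instance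

instance : TDef (sg : D → D) := inferInstanceAs (TDef fun x : D => pr x x)
instance : TDef (sc : D → D) := inferInstanceAs (TDef fun x : D => cup x (sg x))
instance {a : D} : TDef (pr a) := .map₂ (.const a) .id _
instance {a : D} : TDef (op a) := inferInstanceAs (TDef fun x : D => pr (sg a) (pr a x))
instance {a b : D} : TDef (ext a b) := inferInstanceAs (TDef fun x : D => cup a (sg (op b x)))

variable [IsModelIZF D] {u : Ω}

/-! ## Equality -/

theorem eqI {a b : D} (h : ∀ v, Ext v u → ∀ c, v ⊩ c ∈ᵢ a → v ⊩ c ∈ᵢ b)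
    (h' : ∀ v, Ext v u → ∀ c, v ⊩ c ∈ᵢ b → v ⊩ c ∈ᵢ a) : u ⊩ a =ᵢ b := by
  rw [eq_def]
  exact Forces.all fun c => iffI (fun v e => h v e c) fun v e => h' v e c

theorem eq_rfl {a : D} : u ⊩ a =ᵢ a := eqI (fun _ _ _ h => h) fun _ _ _ h => h

theorem Forces.symm {a b : D} (h : u ⊩ a =ᵢ b) : u ⊩ b =ᵢ a := h.leib (fun x => x =ᵢ a) eq_rfl

theorem Forces.trans {a b c : D} (h : u ⊩ a =ᵢ b) (h' : u ⊩ b =ᵢ c) : u ⊩ a =ᵢ c :=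
  h'.leib (fun x => a =ᵢ x) h

theorem Forces.mem_right {a b c : D} (h : u ⊩ c ∈ᵢ a) (e : u ⊩ a =ᵢ b) : u ⊩ c ∈ᵢ b :=
  e.leib (fun x => c ∈ᵢ x) h

theorem Forces.mem_left {a c d : D} (h : u ⊩ c ∈ᵢ a) (e : u ⊩ c =ᵢ d) : u ⊩ d ∈ᵢ a :=
  e.leib (fun x => x ∈ᵢ a) h

@[simp] theorem eq_self (a : D) : a =ᵢ a = ⊤ := eq_top_iff_forces.2 fun _ => eq_rfl

theorem iSup_eq_inf (P : D → Ω) [Def P] (a : D) : (⨆ x, x =ᵢ a ⊓ P x) = P a := by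
  refine eq_of_forces (fun u h => h.bexE fun v _ x hx h' => hx.leib P h') fun u h => ?_
  exact Forces.bex (x := a) eq_rfl h

/-! ## Congruence -/

theorem pr_congr {a a' b b' : D} (h : u ⊩ a =ᵢ a') (h' : u ⊩ b =ᵢ b') : u ⊩ pr a b =ᵢ pr a' b' :=
  h'.leib (fun x => pr a b =ᵢ pr a' x) (h.leib (fun x => pr a b =ᵢ pr x b) eq_rfl)

theorem sg_congr {a a' : D} (h : u ⊩ a =ᵢ a') : u ⊩ sg a =ᵢ sg a' := pr_congr h h

theorem op_congr {a a' b b' : D} (h : u ⊩ a =ᵢ a') (hb : u ⊩ b =ᵢ b') : u ⊩ op a b =ᵢ op a' b' :=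
  pr_congr (sg_congr h) (pr_congr h hb)

/-! ## Elementary sets -/

theorem mem_sg (a c : D) : c ∈ᵢ sg a = c =ᵢ a := by rw [sg, mem_pr, sup_idem]

theorem mem_cup (a b c : D) : c ∈ᵢ cup a b = c ∈ᵢ a ⊔ c ∈ᵢ b := by
  rw [cup, mem_un]
  refine eq_of_forces (fun u h => h.bexE fun v _ x hx h' => ?_) fun u h => ?_
  · rw [mem_pr] at hx
    exact hx.orE (fun w _ e => .inl (h'.up.mem_right e)) fun w _ e => .inr (h'.up.mem_right e)
  · refine h.orE (fun v _ h => .bex (x := a) ?_ h) fun v _ h => .bex (x := b) ?_ h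
    · rw [mem_pr]; exact .inl eq_rfl
    · rw [mem_pr]; exact .inr eq_rfl

theorem mem_sc (a c : D) : c ∈ᵢ sc a = c ∈ᵢ a ⊔ c =ᵢ a := by rw [sc, mem_cup, mem_sg]

theorem mem_ext (f k x z : D) : z ∈ᵢ ext f k x = z ∈ᵢ f ⊔ z =ᵢ op k x := by
  rw [ext, mem_cup, mem_sg]

theorem mem_pr_left {a b : D} : u ⊩ a ∈ᵢ pr a b := by rw [mem_pr]; exact .inl eq_rfl

theorem mem_pr_right {a b : D} : u ⊩ b ∈ᵢ pr a b := by rw [mem_pr]; exact .inr eq_rfl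

theorem mem_sc_self {a : D} : u ⊩ a ∈ᵢ sc a := by rw [mem_sc]; exact .inr eq_rfl

theorem op_eq (a b c d : D) : op a b =ᵢ op c d = a =ᵢ c ⊓ b =ᵢ d := by
  refine eq_of_forces (fun u h => ?_) fun u h => op_congr h.left h.right
  have hca : u ⊩ c =ᵢ a := by
    have h1 : u ⊩ sg a ∈ᵢ op c d := Forces.mem_right (mem_pr_left) h
    rw [op, mem_pr] at h1
    refine h1.orE (fun v _ e => ?_) fun v _ e => ?_
    · rw [← mem_sg]; exact Forces.mem_right mem_pr_left e.symm
    · rw [← mem_sg]; exact Forces.mem_right mem_pr_left e.symm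
  have hd : u ⊩ d =ᵢ a ⊔ d =ᵢ b := by
    have h1 : u ⊩ pr c d ∈ᵢ op a b := Forces.mem_right (mem_pr_right) h.symm
    rw [op, mem_pr] at h1
    refine h1.orE (fun v _ e => .inl ?_) fun v _ e => ?_
    · rw [← mem_sg]; exact Forces.mem_right mem_pr_right e
    · rw [← mem_pr]; exact Forces.mem_right mem_pr_right e
  have hb : u ⊩ b =ᵢ c ⊔ b =ᵢ d := by
    have h1 : u ⊩ pr a b ∈ᵢ op c d := Forces.mem_right (mem_pr_right) h
    rw [op, mem_pr] at h1
    refine h1.orE (fun v _ e => .inl ?_) fun v _ e => ?_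
    · rw [← mem_sg]; exact Forces.mem_right mem_pr_right e
    · rw [← mem_pr]; exact Forces.mem_right mem_pr_right e
  refine hca.symm.and (hd.orE (fun v _ e => ?_) fun v _ e => e.symm)
  exact hb.orE (fun w _ e' => e'.trans (hca.up.trans e.up.symm)) fun w _ e' => e'

theorem Forces.op_fst {a b c d : D} (h : u ⊩ op a b =ᵢ op c d) : u ⊩ a =ᵢ c := by
  rw [op_eq] at h; exact h.left

theorem Forces.op_snd {a b c d : D} (h : u ⊩ op a b =ᵢ op c d) : u ⊩ b =ᵢ d := by
  rw [op_eq] at h; exact h.right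

/-! ## Regularity -/

theorem not_mem_cycle {a b : D} (h : u ⊩ a ∈ᵢ b) (h' : u ⊩ b ∈ᵢ a) : u ⊩ ⊥ := by
  have := induction (u := u) (fun a : D => ⨅ b, b ∈ᵢ a ⊓ a ∈ᵢ b ⇨ ⊥) (fun v _ a ih =>
    ballI fun w _ b hb => (ih.ball hb.left).ball (hb.right.and hb.left)) a
  exact this.ball (h'.and h)

theorem not_mem_self {a : D} (h : u ⊩ a ∈ᵢ a) : u ⊩ ⊥ := not_mem_cycle h h

theorem Forces.sc_inj {a b : D} (h : u ⊩ sc a =ᵢ sc b) : u ⊩ a =ᵢ b := by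
  have h1 := Forces.mem_right (mem_sc_self (a := a)) h
  have h2 := Forces.mem_right (mem_sc_self (a := b)) h.symm
  rw [mem_sc] at h1 h2
  refine h1.orE (fun v _ e => ?_) fun v _ e => e
  exact h2.orE (fun w _ he => (not_mem_cycle e.up he).elim) fun w _ he => he.symm

/-! ## Numerals -/

theorem mem_nm (m : ℕ) (c : D) : c ∈ᵢ nm m = ⨆ j : Fin m, c =ᵢ nm j := by
  induction m with
  | zero => simp [nm, mem_emp, iSup_of_empty]
  | succ m ih =>
    rw [nm, mem_sc, ih]
    apply le_antisymm
    · refine sup_le (iSup_le fun j => le_iSup (fun j : Fin (m + 1) => c =ᵢ nm j) j.castSucc) ?_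
      exact le_iSup (fun j : Fin (m + 1) => c =ᵢ nm j) (Fin.last m)
    · refine iSup_le fun j => ?_
      refine Fin.lastCases ?_ (fun j => ?_) j
      · exact le_sup_right
      · exact le_sup_of_le_left (le_iSup (fun j : Fin m => c =ᵢ nm j) j)

theorem nm_mem_nm {i j : ℕ} (h : i < j) : u ⊩ (nm i : D) ∈ᵢ nm j := by
  rw [mem_nm]
  exact .ex (⟨i, h⟩ : Fin j) eq_rfl

theorem nm_ne {i j : ℕ} (h : i ≠ j) : (nm i : D) =ᵢ nm j = ⊥ := by
  refine eq_of_forces (fun u e => ?_) fun u h => h.elim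
  rcases Nat.lt_or_gt_of_ne h with h | h
  · exact not_mem_self ((nm_mem_nm h).mem_right e.symm)
  · exact not_mem_self ((nm_mem_nm h).mem_right e)

@[simp] theorem tg_eq (k : ℕ) (a b : D) : tg k a =ᵢ tg k b = a =ᵢ b := by simp [tg, op_eq]

theorem tg_ne {i j : ℕ} (h : i ≠ j) (a b : D) : tg i a =ᵢ tg j b = ⊥ := by simp [tg, op_eq, nm_ne h]

theorem emp_mem_om : u ⊩ (emp : D) ∈ᵢ om := by rw [mem_om]; exact .inl eq_rfl

theorem sc_mem_om {a : D} (h : u ⊩ a ∈ᵢ om) : u ⊩ sc a ∈ᵢ om := by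
  rw [mem_om]; exact .inr (.bex h eq_rfl)

theorem nm_mem_om (k : ℕ) : u ⊩ (nm k : D) ∈ᵢ om := by
  induction k with
  | zero => exact emp_mem_om
  | succ k ih => exact sc_mem_om ih

/-! ## Functions -/

/-- `c` is a function from `a` to `d`. -/
def IsFun (c a d : D) : Ω :=
  (⨅ x, x ∈ᵢ a ⇨ ⨆ y, (y ∈ᵢ d ⊓ op x y ∈ᵢ c) ⊓ ⨅ z, (z ∈ᵢ d ⊓ op x z ∈ᵢ c) ⇨ z =ᵢ y) ⊓
  ⨅ z, z ∈ᵢ c ⇨ ⨆ x, x ∈ᵢ a ⊓ ⨆ y, y ∈ᵢ d ⊓ z =ᵢ op x y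

instance Def.isFun {c a d : X → D} [TDef c] [TDef a] [TDef d] :
    Def fun x => IsFun (c x) (a x) (d x) := by
  refine Def.comp₃ ?_
  unfold IsFun
  infer_instance

theorem eval_isFun {n : ℕ} (e : Fin n → D) (c a d : Tm K n) :
    (isFun c a d).eval e = IsFun (c.eval e) (a.eval e) (d.eval e) := by
  simp [isFun, IsFun]

variable {a b c d d' f k m x y z : D}

theorem Forces.fun_value (h : u ⊩ IsFun c a d) (hx : u ⊩ x ∈ᵢ a) :
    u ⊩ ⨆ y, y ∈ᵢ d ⊓ op x y ∈ᵢ c :=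
  (h.left.ball hx).exE fun _ _ y hy => .ex y hy.left

theorem Forces.fun_mem (h : u ⊩ IsFun c a d) (hx : u ⊩ op x y ∈ᵢ c) : u ⊩ x ∈ᵢ a ⊓ y ∈ᵢ d :=
  (h.right.ball hx).bexE fun _ _ _ hx' hy => hy.bexE fun _ _ _ hy' e =>
    (hx'.up.mem_left e.op_fst.symm).and (hy'.mem_left e.op_snd.symm)

theorem Forces.fun_dom (h : u ⊩ IsFun c a d) (hx : u ⊩ op x y ∈ᵢ c) : u ⊩ x ∈ᵢ a :=
  (h.fun_mem hx).left

theorem Forces.fun_cod (h : u ⊩ IsFun c a d) (hx : u ⊩ op x y ∈ᵢ c) : u ⊩ y ∈ᵢ d :=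
  (h.fun_mem hx).right

theorem Forces.fun_unique (h : u ⊩ IsFun c a d) (hy : u ⊩ op x y ∈ᵢ c) (hz : u ⊩ op x z ∈ᵢ c) :
    u ⊩ y =ᵢ z :=
  (h.left.ball (h.fun_dom hy)).exE fun _ _ _ hw =>
    (hw.right.ball ((h.fun_cod hy).up.and hy.up)).trans
      (hw.right.ball ((h.fun_cod hz).up.and hz.up)).symm

theorem Forces.fun_rel (h : u ⊩ IsFun c a d) (hz : u ⊩ z ∈ᵢ c) :
    u ⊩ ⨆ x, x ∈ᵢ a ⊓ ⨆ y, y ∈ᵢ d ⊓ z =ᵢ op x y := h.right.ball hz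

theorem isFunI (h₁ : ∀ v, Ext v u → ∀ x, v ⊩ x ∈ᵢ a → v ⊩ ⨆ y, y ∈ᵢ d ⊓ op x y ∈ᵢ c)
    (h₂ : ∀ v, Ext v u → ∀ x y z, v ⊩ op x y ∈ᵢ c → v ⊩ op x z ∈ᵢ c → v ⊩ z =ᵢ y)
    (h₃ : ∀ v, Ext v u → ∀ z, v ⊩ z ∈ᵢ c → v ⊩ ⨆ x, x ∈ᵢ a ⊓ ⨆ y, y ∈ᵢ d ⊓ z =ᵢ op x y) :
    u ⊩ IsFun c a d := by
  refine Forces.and (ballI fun v e x hx => ?_) (ballI h₃)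
  refine (h₁ v e x hx).exE fun w e' y hy => .ex y (hy.and (ballI fun t e'' z hz => ?_))
  have : Ext t u := ⟨e''.le.trans (e'.le.trans e.le)⟩
  exact h₂ t this x y z hy.right.up hz.right

theorem Forces.fun_cod_change (h : u ⊩ IsFun c a d)
    (h' : ∀ v, Ext v u → ∀ x y, v ⊩ op x y ∈ᵢ c → v ⊩ y ∈ᵢ d → v ⊩ y ∈ᵢ d') : u ⊩ IsFun c a d' := by
  refine isFunI (fun v e x hx => ?_) (fun v e x y z hy hz => h.up.fun_unique hz hy)
    fun v e z hz => ?_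
  · refine (h.up.fun_value hx).bexE fun w e' y hy hxy => .bex ?_ hxy
    exact h' w ⟨e'.le.trans e.le⟩ x y hxy hy
  · refine (h.up.fun_rel hz).bexE fun w e' x hx hy => hy.bexE fun t e'' y hy ez =>
      .bex hx.up (.bex ?_ ez)
    exact h' t ⟨e''.le.trans (e'.le.trans e.le)⟩ x y (hz.up.mem_left ez) hy

theorem dom_subset (h : u ⊩ IsFun c a d) (h' : u ⊩ IsFun c b d') (hx : u ⊩ x ∈ᵢ a) : u ⊩ x ∈ᵢ b :=
  (h.fun_value hx).bexE fun _ _ _ _ hxy => h'.up.fun_dom hxy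

theorem dom_unique (h : u ⊩ IsFun c a d) (hb : u ⊩ IsFun c b d') : u ⊩ a =ᵢ b :=
  eqI (fun _ _ _ hx => dom_subset h.up hb.up hx) fun _ _ _ hx => dom_subset hb.up h.up hx

/-! ## Finite sequences -/

theorem isFun_emp : u ⊩ IsFun emp emp d := by
  refine isFunI (fun v e x hx => ?_) (fun v e x y z hx _ => ?_) fun v e x hx => ?_ <;>
  · rw [mem_emp] at hx
    exact hx.elim

theorem isFun_ext (hf : u ⊩ IsFun f k d) (hx : u ⊩ x ∈ᵢ d) : u ⊩ IsFun (ext f k x) (sc k) d := by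
  refine isFunI (fun v e i hi => ?_) (fun v e i y z hy hz => ?_) fun v e z hz => ?_
  · rw [mem_sc] at hi
    refine hi.orE (fun w _ h => ?_) fun w _ h => ?_
    · refine (hf.up.fun_value h).bexE fun t _ y hy hi => .bex hy ?_
      rw [mem_ext]
      exact .inl hi
    · refine .bex hx.up ?_
      rw [mem_ext]
      exact .inr (op_congr h eq_rfl)
  · rw [mem_ext] at hy hz
    refine hy.orE (fun w _ hy => hz.orE (fun t _ hz => hf.up.fun_unique hz hy.up) fun t _ hz => ?_)
      fun w _ hy => hz.orE (fun t _ hz => ?_) fun t _ hz => hz.op_snd.trans hy.up.op_snd.symm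
    · exact (not_mem_self ((hf.up.fun_dom hy.up).mem_left hz.op_fst)).elim
    · exact (not_mem_self ((hf.up.fun_dom hz).mem_left hy.up.op_fst)).elim
  · rw [mem_ext] at hz
    refine hz.orE (fun w _ hz => (hf.up.fun_rel hz).bexE fun t _ i hi h => .bex ?_ h) fun w _ hz =>
      .bex mem_sc_self (.bex hx.up hz)
    rw [mem_sc]
    exact .inl hi

variable {f' k' x' : D}

theorem ext_subset (hf : u ⊩ IsFun f k d) (hk : u ⊩ k =ᵢ k')
    (h : u ⊩ ext f k x =ᵢ ext f' k' x') (hz : u ⊩ z ∈ᵢ f) : u ⊩ z ∈ᵢ f' := by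
  have hz' : u ⊩ z ∈ᵢ ext f' k' x' := Forces.mem_right (by rw [mem_ext]; exact .inl hz) h
  rw [mem_ext] at hz'
  refine hz'.orE (fun v _ h => h) fun v _ h => ?_
  exact (not_mem_self ((hf.up.fun_dom (hz.up.mem_left h)).mem_right hk.up)).elim

/-- The components of an extended sequence are determined. -/
theorem ext_inj (hf : u ⊩ IsFun f k d) (hx : u ⊩ x ∈ᵢ d) (hf' : u ⊩ IsFun f' k' d')
    (hx' : u ⊩ x' ∈ᵢ d') (h : u ⊩ ext f k x =ᵢ ext f' k' x') :
    u ⊩ f =ᵢ f' ∧ u ⊩ k =ᵢ k' ∧ u ⊩ x =ᵢ x' := by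
  have hk : u ⊩ k =ᵢ k' := by
    have h1 := isFun_ext hf' hx'
    exact (dom_unique (isFun_ext hf hx) (h.symm.leib (fun w => IsFun w (sc k') d') h1)).sc_inj
  refine ⟨eqI (fun v _ z hz => ext_subset hf.up hk.up h.up hz)
    (fun v _ z hz => ext_subset hf'.up hk.up.symm h.up.symm hz), hk, ?_⟩
  have : u ⊩ op k x ∈ᵢ ext f' k' x' := Forces.mem_right (by rw [mem_ext]; exact .inr eq_rfl) h
  rw [mem_ext] at this
  refine this.orE (fun v _ h => ?_) fun v _ h => h.op_snd
  exact (not_mem_self ((hf'.up.fun_dom h).mem_right hk.up.symm)).elim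

/-- A function on a successor is an extended sequence. -/
theorem exists_ext {w : D} (hw : u ⊩ IsFun w (sc k) d) :
    u ⊩ ⨆ f, IsFun f k d ⊓ ⨆ x, x ∈ᵢ d ⊓ w =ᵢ ext f k x := by
  refine (hw.fun_value mem_sc_self).bexE fun v _ x hx hkx => ?_
  let f := sep (fun z => ⨆ i, i ∈ᵢ k ⊓ ⨆ y, z =ᵢ op i y) w
  have hf : ∀ z, z ∈ᵢ f = z ∈ᵢ w ⊓ ⨆ i, i ∈ᵢ k ⊓ ⨆ y, z =ᵢ op i y := mem_sep _ _
  refine .bex (x := f) (isFunI (fun v e i hi => ?_) (fun v e i y z hy hz => ?_) fun v e z hz => ?_)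
    (.bex (x := x) hx (eqI (fun v _ z hz => ?_) fun v _ z hz => ?_))
  · have : v ⊩ i ∈ᵢ sc k := by rw [mem_sc]; exact .inl hi
    refine (hw.up.fun_value this).bexE fun v _ y hy hiy => .bex hy ?_
    rw [hf]
    exact hiy.and (.bex hi.up (.ex y eq_rfl))
  · rw [hf] at hy hz
    exact hw.up.fun_unique hz.left hy.left
  · rw [hf] at hz
    refine hz.right.bexE fun v _ i hi h => h.exE fun v _ y e => .bex hi.up (.bex ?_ e)
    exact hw.up.fun_cod (hz.left.up.mem_left e)
  · rw [mem_ext]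
    refine (hw.up.fun_rel hz).bexE fun v _ i hi h => h.bexE fun v _ y hy e => ?_
    rw [mem_sc] at hi
    refine hi.orE (fun v _ hi => .inl ?_) fun v _ hi => .inr ?_
    · rw [hf]
      exact hz.up.and (.bex hi (.ex y e.up))
    · refine e.up.trans (op_congr hi ?_)
      exact hw.up.fun_unique ((hz.up.mem_left e.up).mem_left (op_congr hi eq_rfl)) hkx.up
  · rw [mem_ext] at hz
    refine hz.orE (fun v _ hz => ?_) fun v _ hz => hkx.up.mem_left hz.symm
    rw [hf] at hz
    exact hz.left

theorem isFun_seq {n : ℕ} {e : Fin n → D} (h : ∀ j, u ⊩ e j ∈ᵢ d) : u ⊩ IsFun (seq e) (nm n) d := by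
  induction n with
  | zero => exact isFun_emp
  | succ n ih => exact isFun_ext (ih fun j => h _) (h _)

theorem mem_seq {n : ℕ} (e : Fin n → D) (z : D) : z ∈ᵢ seq e = ⨆ j : Fin n, z =ᵢ op (nm j) (e j) := by
  induction n with
  | zero => simp [seq, mem_emp, iSup_of_empty]
  | succ m ih =>
    rw [seq, mem_ext, ih]
    apply le_antisymm
    · refine sup_le (iSup_le fun j =>
        le_iSup (fun j : Fin (m + 1) => z =ᵢ op (nm j) (e j)) j.castSucc) ?_
      exact le_iSup (fun j : Fin (m + 1) => z =ᵢ op (nm j) (e j)) (Fin.last m)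
    · refine iSup_le fun j => ?_
      refine Fin.lastCases ?_ (fun j => ?_) j
      · exact le_sup_right
      · exact le_sup_of_le_left (le_iSup (fun j : Fin m => z =ᵢ op (nm j) (e j.castSucc)) j)

theorem op_mem_seq {n : ℕ} (e : Fin n → D) (i : Fin n) (v : D) :
    op (nm i) v ∈ᵢ seq e = v =ᵢ e i := by
  rw [mem_seq]
  refine eq_of_forces (fun u h => h.exE fun w _ j hj => ?_) fun u h => .ex i (op_congr eq_rfl h)
  by_cases hij : i = j
  · subst hij
    exact hj.op_snd
  · rw [op_eq, nm_ne (fun h => hij (Fin.ext h))] at hj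
    exact hj.left.elim

theorem eq_seq {n : ℕ} {e : Fin n → D} {w : D} (hw : u ⊩ IsFun w (nm n) d)
    (h : ∀ j : Fin n, u ⊩ op (nm j) (e j) ∈ᵢ w) : u ⊩ w =ᵢ seq e := by
  refine eqI (fun v _ z hz => ?_) fun v _ z hz => ?_
  · rw [mem_seq]
    refine (hw.up.fun_rel hz).bexE fun v _ i hi h' => h'.bexE fun v _ y hy ez => ?_
    rw [mem_nm] at hi
    refine hi.exE fun v _ j hj => .ex j ?_
    have ez' : v ⊩ z =ᵢ op (nm j) y := ez.up.trans (op_congr hj eq_rfl)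
    exact ez'.trans (op_congr eq_rfl (hw.up.fun_unique (hz.up.mem_left ez') (h j).up))
  · rw [mem_seq] at hz
    exact hz.exE fun v _ j hj => (h j).up.mem_left hj.symm

end SetTheory

section Inaccessible

variable {K Ω D : Type} [Order.Frame Ω] [Str K Ω D]

/-! ## Inaccessible sets -/

/-- `M` contains `ω`, is transitive, and is closed under unions, power sets and functions from its
elements to itself. -/
structure Inac (M : D) : Prop where
  om_mem : ∀ {u : Ω}, u ⊩ om ∈ᵢ M
  trans : ∀ {u : Ω} {x y : D}, u ⊩ x ∈ᵢ y → u ⊩ y ∈ᵢ M → u ⊩ x ∈ᵢ M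
  un_mem : ∀ {u : Ω} {x : D}, u ⊩ x ∈ᵢ M → u ⊩ un x ∈ᵢ M
  pw_mem : ∀ {u : Ω} {x : D}, u ⊩ x ∈ᵢ M → u ⊩ pw x ∈ᵢ M
  fun_mem : ∀ {u : Ω} {f a : D}, u ⊩ a ∈ᵢ M → u ⊩ IsFun f a M → u ⊩ f ∈ᵢ M

namespace Inac

variable [IsModelIZF D] {u : Ω} {M a b c k x y z : D} (hM : Inac M)

include hM

theorem sub_mem (ha : u ⊩ a ∈ᵢ M) (h : ∀ v, Ext v u → ∀ c, v ⊩ c ∈ᵢ b → v ⊩ c ∈ᵢ a) :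
    u ⊩ b ∈ᵢ M := by
  refine hM.trans ?_ (hM.pw_mem ha)
  rw [mem_pw]
  exact ballI h

/-- The range of a definable function on an element of `M` with values in `M`. -/
theorem range_mem (P : D → D → Ω) [hP : Def fun p : D × D => P p.1 p.2] (ha : u ⊩ a ∈ᵢ M)
    (h₁ : ∀ v, Ext v u → ∀ x, v ⊩ x ∈ᵢ a → v ⊩ ⨆ y, y ∈ᵢ M ⊓ P x y)
    (h₂ : ∀ v, Ext v u → ∀ x y z, v ⊩ x ∈ᵢ a → v ⊩ y ∈ᵢ M → v ⊩ z ∈ᵢ M → v ⊩ P x y → v ⊩ P x z →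
      v ⊩ z =ᵢ y)
    (hb : ∀ v, Ext v u → ∀ c, v ⊩ c ∈ᵢ b → v ⊩ c ∈ᵢ M ⊓ ⨆ x, x ∈ᵢ a ⊓ P x c) : u ⊩ b ∈ᵢ M := by
  have : ∀ {X : Type} [Env D X] {a b : X → D} [TDef a] [TDef b], Def fun x => P (a x) (b x) :=
    fun {_ _ _ _ ha hb} => hP.app₂ ha hb
  let f := sep (fun t => ⨆ x, x ∈ᵢ a ⊓ ⨆ y, y ∈ᵢ M ⊓ (t =ᵢ op x y ⊓ P x y)) (pw (pw M))
  have hf : ∀ x y, op x y ∈ᵢ f ⊓ u = (x ∈ᵢ a ⊓ (y ∈ᵢ M ⊓ P x y)) ⊓ u := fun x y => by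
    rw [mem_sep]
    refine eq_of_forces (fun v h => Forces.and ?_ h.right) fun v h => Forces.and (.and ?_ ?_) h.right
    · refine h.left.right.bexE fun v _ x' hx h => h.bexE fun v _ y' hy h => ?_
      have e1 := h.left.op_fst.symm
      have e2 := h.left.op_snd.symm
      exact (hx.up.mem_left e1).and ((hy.up.mem_left e2).and
        (e2.leib (fun y => P x y) (e1.leib (fun x => P x y') h.right)))
    · have hx : v ⊩ x ∈ᵢ M := hM.trans h.left.left (le_trans h.right ha)
      have hy := h.left.right.left
      rw [mem_pw]
      refine ballI fun w _ s hs => ?_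
      rw [op, mem_pr] at hs
      rw [mem_pw]
      refine ballI fun w _ t ht => hs.orE (fun w _ e => ?_) fun w _ e => ?_
      · have := ht.up.mem_right e
        rw [mem_sg] at this
        exact hx.up.mem_left this.symm
      · have := ht.up.mem_right e
        rw [mem_pr] at this
        exact this.orE (fun w _ e => hx.up.mem_left e.symm) fun w _ e => hy.up.mem_left e.symm
    · exact .bex h.left.left (.bex h.left.right.left (eq_rfl.and h.left.right.right))
  have hf' : ∀ {v : Ω} {x y : D}, v ≤ u → (v ⊩ op x y ∈ᵢ f ↔ v ⊩ x ∈ᵢ a ⊓ (y ∈ᵢ M ⊓ P x y)) := by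
    intro v x y hv
    exact ⟨fun h => ((hf x y).symm ▸ Forces.and h hv : v ⊩ _ ⊓ u).left,
      fun h => ((hf x y) ▸ Forces.and h hv : v ⊩ _ ⊓ u).left⟩
  have hfun : u ⊩ IsFun f a M := by
    refine isFunI (fun v e x hx => ?_) (fun v e x y z hy hz => ?_) fun v e t ht => ?_
    · refine (h₁ v e x hx).bexE fun w e' y hy hP => .bex hy ?_
      exact (hf' (e'.le.trans e.le)).2 (hx.up.and (hy.and hP))
    · rw [hf' e.le] at hy hz
      exact h₂ v e x y z hy.left hy.right.left hz.right.left hy.right.right hz.right.right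
    · rw [mem_sep] at ht
      exact ht.right.bexE fun w _ x hx h => h.bexE fun w _ y hy h => .bex hx.up (.bex hy h.left)
  refine hM.sub_mem (a := un (un f)) (hM.un_mem (hM.un_mem (hM.fun_mem ha hfun))) fun v e c hc => ?_
  refine (hb v e c hc).right.bexE fun w e' x hx hP => ?_
  rw [mem_un]
  refine .bex (x := pr x c) ?_ mem_pr_right
  rw [mem_un]
  refine .bex (x := op x c) ?_ mem_pr_right
  exact (hf' (e'.le.trans e.le)).2 (hx.and ((hb v e c hc).left.up.and hP))

theorem om_sub (h : u ⊩ a ∈ᵢ om) : u ⊩ a ∈ᵢ M := hM.trans h hM.om_mem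

theorem nm_mem (k : ℕ) : u ⊩ nm k ∈ᵢ M := hM.om_sub (nm_mem_om k)

theorem emp_mem : u ⊩ emp ∈ᵢ M := hM.nm_mem 0

theorem pr_mem (ha : u ⊩ a ∈ᵢ M) (hb : u ⊩ b ∈ᵢ M) : u ⊩ pr a b ∈ᵢ M := by
  refine hM.range_mem (fun i y => (i =ᵢ nm 0 ⊓ y =ᵢ a) ⊔ (i =ᵢ nm 1 ⊓ y =ᵢ b)) (hM.nm_mem 2)
    (fun v _ x hx => ?_) (fun v _ i y z _ _ _ hy hz => ?_) (fun v _ c hc => ?_)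
  · rw [nm, mem_sc] at hx
    refine hx.orE (fun v _ h => ?_) fun v _ h => .bex hb.up (.inr (h.and eq_rfl))
    rw [nm, mem_sc, nm, mem_emp] at h
    exact h.orE (fun v _ h => h.elim) fun v _ h => .bex ha.up (.inl (h.and eq_rfl))
  · have hne : ∀ {w : Ω}, w ⊩ i =ᵢ nm 0 → w ⊩ i =ᵢ nm 1 → w ⊩ z =ᵢ y := fun h h' => by
      have := h.symm.trans h'
      rw [nm_ne (by decide)] at this
      exact this.elim
    refine hy.orE (fun v _ hy => hz.orE (fun v _ hz => ?_) fun v _ hz => ?_)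
      fun v _ hy => hz.orE (fun v _ hz => ?_) fun v _ hz => ?_
    · exact hz.right.trans hy.up.right.symm
    · exact hne hy.left.up hz.left
    · exact hne hz.left hy.left.up
    · exact hz.right.trans hy.up.right.symm
  · rw [mem_pr] at hc
    refine hc.orE (fun v _ e => .and (ha.up.mem_left e.symm) (.bex (nm_mem_nm (i := 0) (by decide)) ?_))
      fun v _ e => .and (hb.up.mem_left e.symm) (.bex (nm_mem_nm (i := 1) (by decide)) ?_)
    · exact .inl (eq_rfl.and e)
    · exact .inr (eq_rfl.and e)

theorem sg_mem (ha : u ⊩ a ∈ᵢ M) : u ⊩ sg a ∈ᵢ M := hM.pr_mem ha ha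

theorem op_mem (ha : u ⊩ a ∈ᵢ M) (hb : u ⊩ b ∈ᵢ M) : u ⊩ op a b ∈ᵢ M :=
  hM.pr_mem (hM.sg_mem ha) (hM.pr_mem ha hb)

theorem cup_mem (ha : u ⊩ a ∈ᵢ M) (hb : u ⊩ b ∈ᵢ M) : u ⊩ cup a b ∈ᵢ M :=
  hM.un_mem (hM.pr_mem ha hb)

theorem sc_mem (ha : u ⊩ a ∈ᵢ M) : u ⊩ sc a ∈ᵢ M := hM.cup_mem ha (hM.sg_mem ha)

theorem tg_mem {k : ℕ} (ha : u ⊩ a ∈ᵢ M) : u ⊩ tg k a ∈ᵢ M := hM.op_mem (hM.nm_mem k) ha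

theorem seq_mem {n : ℕ} {e : Fin n → D} (h : ∀ j, u ⊩ e j ∈ᵢ M) : u ⊩ seq e ∈ᵢ M :=
  hM.fun_mem (hM.nm_mem n) (isFun_seq h)

theorem fst_mem (h : u ⊩ op x y ∈ᵢ M) : u ⊩ x ∈ᵢ M :=
  hM.trans (mem_pr_left (b := x)) (hM.trans (mem_pr_left) h)

theorem snd_mem (h : u ⊩ op x y ∈ᵢ M) : u ⊩ y ∈ᵢ M :=
  hM.trans (mem_pr_right (a := x)) (hM.trans (mem_pr_right) h)

/-- A global element of `M` that is equal to `x` as far as `x` belongs to `M`. -/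
theorem exists_retract (x : D) : ∃ r : D, (∀ u : Ω, u ⊩ r ∈ᵢ M) ∧ ∀ u : Ω, u ⊩ x ∈ᵢ M → u ⊩ x =ᵢ r := by
  let s := sep (fun y => y ∈ᵢ M) (sg x)
  have hs : ∀ y, y ∈ᵢ s = y =ᵢ x ⊓ y ∈ᵢ M := fun y => by rw [mem_sep, mem_sg]
  refine ⟨un s, fun u => hM.un_mem ?_, fun u hx => eqI (fun v _ c hc => ?_) fun v _ c hc => ?_⟩
  · let a := sep (fun y : D => x ∈ᵢ M) (nm 1)
    have ha : ∀ y, y ∈ᵢ a = y ∈ᵢ nm 1 ⊓ x ∈ᵢ M := fun y => mem_sep _ _ _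
    have ha' : u ⊩ a ∈ᵢ M := hM.sub_mem (hM.nm_mem 1) fun v _ c hc => by
      rw [ha] at hc
      exact hc.left
    refine hM.range_mem (fun _ y => y =ᵢ x) ha' (fun v _ i hi => ?_)
      (fun v _ _ y z _ _ _ hy hz => hz.trans hy.symm) fun v _ c hc => ?_
    · rw [ha] at hi
      exact .bex hi.right eq_rfl
    · rw [hs] at hc
      refine hc.right.and (.bex (x := nm 0) ?_ hc.left)
      rw [ha]
      exact (nm_mem_nm (by decide)).and (hc.right.mem_left hc.left)
  · rw [mem_un]
    refine .bex (x := x) ?_ hc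
    rw [hs]
    exact eq_rfl.and hx.up
  · rw [mem_un] at hc
    refine hc.bexE fun v _ y hy hc => ?_
    rw [hs] at hy
    exact hc.mem_right hy.left

end Inac

end Inaccessible

/-! ## Recursion -/

section Recursion

variable {K Ω D X : Type} [Order.Frame Ω] [Str K Ω D] [Env D X]

/-- `a ⊆ b` -/
def Sub (a b : D) : Ω := ⨅ x, x ∈ᵢ a ⇨ x ∈ᵢ b

/-- `d` is transitive. -/
def Trn (d : D) : Ω := ⨅ y, y ∈ᵢ d ⇨ ⨅ x, x ∈ᵢ y ⇨ x ∈ᵢ d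

/-- `y` belongs to the transitive closure of `x`. -/
def TrC (y x : D) : Ω := ⨅ d, Trn d ⊓ Sub x d ⇨ y ∈ᵢ d

/-- The set `S` consists of the pairs in `R` with first component in the transitive closure of `x`. -/
def Restr (S R x : D) : Ω := ⨅ t, t ∈ᵢ S ⇔ᵢ t ∈ᵢ R ⊓ ⨆ y, TrC y x ⊓ ⨆ z, t =ᵢ op y z

instance {a b : X → D} [TDef a] [TDef b] : Def fun x => Sub (a x) (b x) := by
  refine Def.comp₂ ?_
  unfold Sub
  infer_instance

instance Def.trn {d : X → D} [hd : TDef d] : Def fun x => Trn (d x) := by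
  refine Def.comp (Q := fun _ => Trn) ?_ hd
  unfold Trn
  infer_instance

instance {a b : X → D} [TDef a] [TDef b] : Def fun x => TrC (a x) (b x) := by
  refine Def.comp₂ ?_
  unfold TrC
  infer_instance

instance {a b c : X → D} [TDef a] [TDef b] [TDef c] : Def fun x => Restr (a x) (b x) (c x) := by
  refine Def.comp₃ ?_
  unfold Restr
  infer_instance

variable [IsModelIZF D] {u : Ω} {M d d' x y z R R' S : D}

theorem Forces.trn (h : u ⊩ Trn d) (hx : u ⊩ x ∈ᵢ y) (hy : u ⊩ y ∈ᵢ d) : u ⊩ x ∈ᵢ d :=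
  (h.ball hy).ball hx

theorem trC_of_mem (h : u ⊩ y ∈ᵢ x) : u ⊩ TrC y x := ballI fun _ _ _ hd => hd.right.ball h.up

theorem Forces.trC_of_mem (h : u ⊩ TrC y x) (hz : u ⊩ z ∈ᵢ y) : u ⊩ TrC z x :=
  ballI fun _ _ _ hd => hd.left.trn hz.up (h.ball hd)

theorem Forces.trC_fst (h : u ⊩ TrC (op y z) x) : u ⊩ TrC y x :=
  (h.trC_of_mem (mem_pr_left (b := pr y z))).trC_of_mem mem_pr_left

theorem Forces.trC_snd (h : u ⊩ TrC (op y z) x) : u ⊩ TrC z x :=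
  (h.trC_of_mem (mem_pr_right (a := sg y))).trC_of_mem mem_pr_right

theorem trC_op_right : u ⊩ TrC z (op y z) :=
  (trC_of_mem (mem_pr_right (a := sg y))).trC_of_mem mem_pr_right

theorem exists_restr (R x : D) : ∃ S : D, (∀ u : Ω, u ⊩ Restr S R x) := by
  refine ⟨sep (fun t => ⨆ y, TrC y x ⊓ ⨆ z, t =ᵢ op y z) R, fun u => Forces.all fun t => ?_⟩
  rw [mem_sep]
  exact iffI (fun _ _ h => h) fun _ _ h => h

theorem Forces.op_mem_restr (h : u ⊩ Restr S R x) (hy : u ⊩ TrC y x) (z : D) :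
    u ⊩ op y z ∈ᵢ S ↔ u ⊩ op y z ∈ᵢ R := by
  rw [(h.at (op y z)).iff]
  exact ⟨fun h => h.left, fun h => h.and (.bex hy (.ex z eq_rfl))⟩

variable (Φ : D → D → D → Ω)
  [hdef : Def fun p : (D × D) × D => Φ p.1.1 p.1.2 p.2]

/-- `Φ x z` at the restriction of `R` to the transitive closure of `x`. -/
def RecClause (x z R : D) : Ω := ⨆ S, Restr S R x ⊓ Φ x z S

instance {a b c : X → D} [TDef a] [TDef b] [TDef c] : Def fun x => RecClause Φ (a x) (b x) (c x) := by
  have : ∀ {X : Type} [Env D X] {a b c : X → D} [TDef a] [TDef b] [TDef c],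
      Def fun x => Φ (a x) (b x) (c x) := fun {_ _ _ _ _ ha hb hc} => hdef.app₃ ha hb hc
  refine Def.comp₃ ?_
  unfold RecClause
  infer_instance

theorem below_local (hd : u ⊩ Trn d) (hx : u ⊩ Sub x d)
    (h : ∀ v, Ext v u → ∀ y z, v ⊩ y ∈ᵢ d → v ⊩ op y z ∈ᵢ R → v ⊩ op y z ∈ᵢ R')
    (h' : ∀ v, Ext v u → ∀ y z, v ⊩ y ∈ᵢ d → v ⊩ op y z ∈ᵢ R' → v ⊩ op y z ∈ᵢ R)
    (hΦ : u ⊩ RecClause Φ x z R) : u ⊩ RecClause Φ x z R' := by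
  refine hΦ.bexE fun v e S hS hΦ => .bex (x := S) (Forces.all fun t => iffI (fun w e' ht => ?_)
    fun w e' ht => ?_) hΦ
  · rw [(hS.at t).iff] at ht
    refine Forces.and (ht.right.bexE fun w' e'' y hy h' => h'.exE fun w'' e''' z et => ?_) ht.right
    have := h w'' ⟨e'''.le.trans (e''.le.trans (e'.le.trans e.le))⟩ y z
      (hy.ball (x := d) (hd.up.and hx.up))
    exact (this (ht.left.up.mem_left et)).mem_left et.symm
  · rw [(hS.at t).iff]
    refine Forces.and (ht.right.bexE fun w' e'' y hy h => h.exE fun w'' e''' z et => ?_) ht.right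
    have := h' w'' ⟨e'''.le.trans (e''.le.trans (e'.le.trans e.le))⟩ y z
      (hy.ball (x := d) (hd.up.and hx.up))
    exact (this (ht.left.up.mem_left et)).mem_left et.symm

variable (M)

/-- `R` satisfies the recursion equation on the transitive set `d`. -/
def Attempt (d R : D) : Ω := Trn d ⊓ ⨅ x, x ∈ᵢ d ⇨ ⨅ z, op x z ∈ᵢ R ⇔ᵢ z ∈ᵢ M ⊓ RecClause Φ x z R

instance {a b : X → D} [TDef a] [TDef b] : Def fun x => Attempt M Φ (a x) (b x) := by
  refine Def.comp₂ ?_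
  unfold Attempt
  infer_instance

/-- There is an attempt at `x`, and any two attempts agree at `x`. -/
def Determined (x : D) : Ω :=
  (⨆ d, x ∈ᵢ d ⊓ ⨆ R, Attempt M Φ d R) ⊓
  ⨅ d, ⨅ R, ⨅ d', ⨅ R', (Attempt M Φ d R ⊓ x ∈ᵢ d) ⊓ (Attempt M Φ d' R' ⊓ x ∈ᵢ d') ⇨
    ⨅ z, op x z ∈ᵢ R ⇨ op x z ∈ᵢ R'

instance Def.determined {a : X → D} [ha : TDef a] : Def fun x => Determined M Φ (a x) := by
  refine Def.comp (Q := fun _ => Determined M Φ) ?_ ha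
  unfold Determined
  infer_instance

instance : Def (Determined M Φ) := .determined M Φ (a := fun x => x)

/-- The union of all attempts. -/
noncomputable def recSet : D :=
  sep (fun t => ⨆ y, ⨆ z, t =ᵢ op y z ⊓ ⨆ d, y ∈ᵢ d ⊓ ⨆ R, Attempt M Φ d R ⊓ op y z ∈ᵢ R) M

variable {M} (hM : Inac M)

include hM

/-- Induction over the elements of `M`, with hypotheses on a transitive set. -/
theorem Inac.strong_induction (P : D → Ω) [hP : Def P]
    (H : ∀ v, Ext v u → ∀ x d, v ⊩ x ∈ᵢ M → v ⊩ Trn d → v ⊩ Sub d M → v ⊩ Sub x d →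
      v ⊩ (⨅ y, y ∈ᵢ d ⇨ P y) → v ⊩ P x) (hx : u ⊩ x ∈ᵢ M) : u ⊩ P x := by
  have : ∀ {X : Type} [Env D X] {a : X → D} [TDef a], Def fun x => P (a x) :=
    fun {_ _ _ ha} => hP.app₁ ha
  let A := sep (fun y => ⨆ d, (Trn d ⊓ y ∈ᵢ d) ⊓ (Sub d M ⊓ ⨅ z, z ∈ᵢ d ⇨ P z)) M
  have hA : ∀ y, y ∈ᵢ A = y ∈ᵢ M ⊓ ⨆ d, (Trn d ⊓ y ∈ᵢ d) ⊓ (Sub d M ⊓ ⨅ z, z ∈ᵢ d ⇨ P z) :=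
    fun y => mem_sep _ _ _
  have hAt : ∀ v : Ω, v ⊩ Trn A := fun v => ballI fun w _ y hy => ballI fun w _ z hz => by
    rw [hA] at hy ⊢
    refine (hM.trans hz hy.up.left).and (hy.right.exE fun w _ d hd => .ex d ?_)
    exact (hd.left.left.and (hd.left.left.trn hz.up hd.left.right)).and hd.right
  have hAM : ∀ v : Ω, v ⊩ Sub A M := fun v => ballI fun w _ y hy => by
    rw [hA] at hy
    exact hy.left
  have hAP : ∀ v : Ω, v ⊩ (⨅ y, y ∈ᵢ A ⇨ P y) := fun v => ballI fun w _ y hy => by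
    rw [hA] at hy
    exact hy.right.exE fun w _ d hd => hd.right.right.ball hd.left.right
  have key : u ⊩ x ∈ᵢ M ⇨ x ∈ᵢ A := by
    refine induction (fun x => x ∈ᵢ M ⇨ x ∈ᵢ A) (fun v e x ih => impI fun w e' hx => ?_) x
    have hxA : w ⊩ Sub x A := ballI fun t _ y hy => (ih.ball hy).mp (hM.trans hy hx.up)
    have hPx := H w ⟨e'.le.trans e.le⟩ x A hx (hAt w) (hAM w) hxA (hAP w)
    rw [hA]
    refine hx.and (.ex (cup A (sg x)) (Forces.and (.and ?_ ?_) (.and ?_ ?_)))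
    · refine ballI fun t _ y hy => ballI fun t _ z hz => ?_
      rw [mem_cup] at hy ⊢
      refine .inl (hy.orE (fun t _ hy => (hAt t).trn hz.up hy) fun t _ hy => ?_)
      rw [mem_sg] at hy
      exact hxA.ball (hz.up.mem_right hy)
    · rw [mem_cup, mem_sg]
      exact .inr eq_rfl
    · refine ballI fun t _ y hy => ?_
      rw [mem_cup, mem_sg] at hy
      exact hy.orE (fun t _ hy => (hAM t).ball hy) fun t _ hy => hx.up.mem_left hy.symm
    · refine ballI fun t _ y hy => ?_
      rw [mem_cup, mem_sg] at hy
      exact hy.orE (fun t _ hy => (hAP t).ball hy) fun t _ hy => hy.symm.leib (fun x => P x) hPx.up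
  exact (hAP u).ball (key.mp hx)

theorem recSet_agrees (hy : u ⊩ Determined M Φ y) (hyM : u ⊩ y ∈ᵢ M) (hR : u ⊩ Attempt M Φ d R)
    (hyd : u ⊩ y ∈ᵢ d) : u ⊩ op y z ∈ᵢ recSet M Φ ↔ u ⊩ op y z ∈ᵢ R := by
  rw [recSet, mem_sep]
  constructor
  · intro h
    refine h.right.exE fun v _ y' h => h.exE fun v _ z' h => h.right.bexE fun v _ d' hd' h' =>
      h'.bexE fun v _ R' hR' hyR' => ?_
    have e1 := h.left.op_fst.symm
    have e := h.left.symm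
    refine Forces.ball (Forces.mp (Forces.at (Forces.at (Forces.at (Forces.at hy.right d') R') d) R)
      (.and (hR'.and (hd'.up.mem_left e1.up)) (hR.up.and hyd.up))) (x := z) ?_
    exact hyR'.mem_left e.up
  · intro h
    refine Forces.and (hM.op_mem hyM ?_) (.ex y (.ex z (eq_rfl.and (.bex hyd (.bex hR h)))))
    exact (((hR.right.ball hyd).at z).iff.1 h).left

theorem recSet_attempt (hd : u ⊩ Trn d) (hdM : u ⊩ Sub d M)
    (h : u ⊩ ⨅ y, y ∈ᵢ d ⇨ Determined M Φ y) : u ⊩ Attempt M Φ d (recSet M Φ) := by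
  refine hd.and (ballI fun v _ y hy => Forces.all fun z => ?_)
  refine (h.ball hy).left.bexE fun v _ d' hyd' hR => hR.exE fun v _ R hR => ?_
  replace hyd' := hyd'.up (v := v)
  replace hy := hy.up (v := v)
  have hyM : v ⊩ y ∈ᵢ M := hdM.ball hy
  let e := sep (fun y => y ∈ᵢ d') d
  have he : ∀ y, y ∈ᵢ e = y ∈ᵢ d ⊓ y ∈ᵢ d' := fun y => mem_sep _ _ _
  have het : v ⊩ Trn e := ballI fun w _ y hy => ballI fun w _ z hz => by
    rw [he] at hy ⊢
    exact (hd.up.trn hz hy.left.up).and (hR.left.up.trn hz hy.right.up)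
  have hye : v ⊩ Sub y e := ballI fun w _ z hz => by
    rw [he]
    exact (hd.up.trn hz hy.up).and (hR.left.up.trn hz hyd'.up)
  have hag : ∀ w, Ext w v → ∀ y z, w ⊩ y ∈ᵢ e → (w ⊩ op y z ∈ᵢ recSet M Φ ↔ w ⊩ op y z ∈ᵢ R) :=
    fun w _ y z hy => by
      rw [he] at hy
      exact recSet_agrees Φ hM (h.ball hy.left) (hdM.ball hy.left) hR.up hy.right
  have hiff : ∀ w, Ext w v → (w ⊩ op y z ∈ᵢ recSet M Φ ↔ w ⊩ z ∈ᵢ M ⊓ RecClause Φ y z R) := fun w _ => by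
    rw [recSet_agrees Φ hM (h.ball hy.up) hyM.up hR.up hyd'.up]
    exact ((hR.right.ball hyd').at z).iff
  refine iffI (fun w e hw => ?_) fun w e hw => (hiff w e).2 (hw.left.and ?_)
  · have := (hiff w e).1 hw
    refine this.left.and (below_local Φ het.up hye.up (fun t e' y z hy => ?_)
      (fun t e' y z hy => ?_) this.right)
    · exact (hag t ⟨e'.le.trans e.le⟩ y z hy).2
    · exact (hag t ⟨e'.le.trans e.le⟩ y z hy).1
  · refine (below_local Φ het.up hye.up (fun t e' y z hy => ?_) (fun t e' y z hy => ?_) hw.right)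
    · exact (hag t ⟨e'.le.trans e.le⟩ y z hy).1
    · exact (hag t ⟨e'.le.trans e.le⟩ y z hy).2

theorem determined (hx : u ⊩ x ∈ᵢ M) : u ⊩ Determined M Φ x := by
  refine hM.strong_induction (Determined M Φ) (fun v _ x d hx hd hdM hxd ih => Forces.and ?_ ?_) hx
  · have hatt := recSet_attempt Φ hM hd hdM ih
    let R := sep (fun t => ⨆ y, y ∈ᵢ cup d (sg x) ⊓ ⨆ z, t =ᵢ op y z ⊓ RecClause Φ y z (recSet M Φ)) M
    have hsub : ∀ w, Ext w v → ∀ y, w ⊩ y ∈ᵢ cup d (sg x) → w ⊩ Sub y d ⊓ y ∈ᵢ M := fun w _ y hy => by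
      rw [mem_cup, mem_sg] at hy
      refine hy.orE (fun t _ hy => .and (ballI fun t _ z hz => ?_) (hdM.ball hy)) fun t _ hy => ?_
      · exact hd.up.trn hz hy.up
      · exact hy.symm.leib (fun y => Sub y d ⊓ y ∈ᵢ M) (hxd.up.and hx.up)
    have hR : ∀ w, Ext w v → ∀ y z, w ⊩ y ∈ᵢ cup d (sg x) →
        (w ⊩ op y z ∈ᵢ R ↔ w ⊩ z ∈ᵢ M ⊓ RecClause Φ y z (recSet M Φ)) := fun w e y z hy => by
      rw [mem_sep]
      constructor
      · intro h
        refine (hM.snd_mem h.left).and (h.right.bexE fun t _ y' _ h' => h'.bexE fun t _ z' ez h' => ?_)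
        exact ez.op_snd.symm.leib (fun z => RecClause Φ y z _)
          (ez.op_fst.symm.leib (fun y => RecClause Φ y z' _) h')
      · intro h
        exact (hM.op_mem (hsub w e y hy).right h.left).and (.bex hy (.bex (x := z) eq_rfl h.right))
    have hagree : ∀ w, Ext w v → ∀ y z, w ⊩ y ∈ᵢ d →
        (w ⊩ op y z ∈ᵢ recSet M Φ ↔ w ⊩ op y z ∈ᵢ R) := fun w e y z hy => by
      rw [hR w e y z (by rw [mem_cup]; exact .inl hy)]
      exact ((hatt.right.ball hy).at z).iff
    refine .bex (x := cup d (sg x)) (by rw [mem_cup, mem_sg]; exact .inr eq_rfl)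
      (.ex R (Forces.and ?_ (ballI fun w e y hy => Forces.all fun z => iffI (fun t e' h => ?_)
        fun t e' h => ?_)))
    · refine ballI fun t e y hy => ballI fun t _ z hz => ?_
      rw [mem_cup]
      exact .inl ((hsub _ e y hy).left.ball hz)
    · have e'' : Ext t v := ⟨e'.le.trans e.le⟩
      rw [hR t e'' y z hy.up] at h
      refine h.left.and (below_local Φ hd.up (hsub t e'' y hy.up).left (fun r e3 y z hy => ?_)
        (fun r e3 y z hy => ?_) h.right)
      · exact (hagree r ⟨e3.le.trans e''.le⟩ y z hy).1
      · exact (hagree r ⟨e3.le.trans e''.le⟩ y z hy).2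
    · have e'' : Ext t v := ⟨e'.le.trans e.le⟩
      rw [hR t e'' y z hy.up]
      refine h.left.and (below_local Φ hd.up (hsub t e'' y hy.up).left (fun r e3 y z hy => ?_)
        (fun r e3 y z hy => ?_) h.right)
      · exact (hagree r ⟨e3.le.trans e''.le⟩ y z hy).2
      · exact (hagree r ⟨e3.le.trans e''.le⟩ y z hy).1
  · refine Forces.all fun d₁ => Forces.all fun R₁ => Forces.all fun d₂ => Forces.all fun R₂ =>
      impI fun w _ h => ballI fun w _ z hz => ?_
    let e := sep (fun y => y ∈ᵢ d₁ ⊓ y ∈ᵢ d₂) d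
    have he : ∀ y, y ∈ᵢ e = y ∈ᵢ d ⊓ (y ∈ᵢ d₁ ⊓ y ∈ᵢ d₂) := fun y => mem_sep _ _ _
    have h1 := h.left
    have h2 := h.right
    have het : w ⊩ Trn e := ballI fun w _ y hy => ballI fun w _ z hz => by
      rw [he] at hy ⊢
      exact (hd.up.trn hz hy.left.up).and ((h1.left.left.up.trn hz hy.right.left.up).and
        (h2.left.left.up.trn hz hy.right.right.up))
    have hxe : w ⊩ Sub x e := ballI fun w _ z hz => by
      rw [he]
      exact (hxd.ball hz).and ((h1.left.left.up.trn hz h1.right.up).and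
        (h2.left.left.up.trn hz h2.right.up))
    have hag : ∀ {t : Ω} {y z : D}, t ≤ w → t ⊩ y ∈ᵢ e →
        (t ⊩ op y z ∈ᵢ R₁ ↔ t ⊩ op y z ∈ᵢ R₂) := fun {t y z} ht hy => by
      rw [he] at hy
      have : Below t w := ⟨ht⟩
      have : Below t v := ⟨ht.trans (Below.le (v := w) (u := v))⟩
      have hdet := (ih.ball hy.left).right
      exact ⟨fun hz => ((((hdet.at d₁).at R₁).at d₂).at R₂).mp
          ((h1.left.mono (ht.trans (Below.le))).and hy.right.left |>.and
            ((h2.left.mono (ht.trans (Below.le))).and hy.right.right)) |>.ball hz,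
        fun hz => ((((hdet.at d₂).at R₂).at d₁).at R₁).mp
          ((h2.left.mono (ht.trans (Below.le))).and hy.right.right |>.and
            ((h1.left.mono (ht.trans (Below.le))).and hy.right.left)) |>.ball hz⟩
    have hz1 := ((h1.left.right.ball h1.right).at z).iff.1 hz
    refine ((h2.left.right.ball h2.right).at z).iff.2 (hz1.left.and ?_)
    exact below_local Φ het hxe (fun t e y z hy => (hag e.le hy).1) (fun t e y z hy => (hag e.le hy).2)
      hz1.right

/-- Definition by recursion on the transitive closure. -/
theorem op_mem_recSet (x z : D) :
    op x z ∈ᵢ recSet M Φ = (x ∈ᵢ M ⊓ z ∈ᵢ M) ⊓ RecClause Φ x z (recSet M Φ) := by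
  have hatt : ∀ v : Ω, v ⊩ Attempt M Φ M (recSet M Φ) := fun v =>
    recSet_attempt Φ hM (ballI fun w _ y hy => ballI fun w _ z hz => hM.trans hz hy.up)
      (ballI fun w _ y hy => hy) (ballI fun w _ y hy => determined Φ hM hy)
  refine eq_of_forces (fun u h => ?_) fun u h => ?_
  · have hx : u ⊩ x ∈ᵢ M := by
      rw [recSet, mem_sep] at h
      exact hM.fst_mem h.left
    have := (((hatt u).right.ball hx).at z).iff.1 h
    exact (hx.and this.left).and this.right
  · exact (((hatt u).right.ball h.left.left).at z).iff.2 (h.left.right.and h.right)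

end Recursion

/-! ## The syntax as a set -/

section CodedSyntax

variable {K Ω D X : Type} [Order.Frame Ω] [Str K Ω D] [Env D X]

/-- According to `C`, `f` is a function symbol of arity `m`. -/
abbrev SymIn (C m f : D) : Ω := tg 0 (op m f) ∈ᵢ C

/-- According to `C`, `t` is a term with `k` variables. -/
abbrev TmIn (C k t : D) : Ω := tg 1 (op k t) ∈ᵢ C

/-- According to `C`, `p` is a formula with `k` free variables. -/
abbrev FmIn (C k p : D) : Ω := tg 2 (op k p) ∈ᵢ C

/-- `w` is a sequence of length `m` of terms with `k` variables. -/
def TmSeqIn (C k m w : D) : Ω := ⨆ d, IsFun w m d ⊓ ⨅ t, t ∈ᵢ d ⇨ TmIn C k t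

instance Def.tmSeqIn {C k m w : X → D} [TDef C] [TDef k] [TDef m] [TDef w] :
    Def fun x => TmSeqIn (C x) (k x) (m x) (w x) := by
  refine Def.comp₄ ?_
  unfold TmSeqIn
  infer_instance

/-- `C` is closed under the formation rules. -/
def SynClosed (C : D) : Ω :=
  SymIn C (nm 0) (tg 0 emp) ⊓
  (SymIn C (nm 0) (tg 1 emp) ⊓
  (SymIn C (nm 2) (tg 2 emp) ⊓
  (SymIn C (nm 1) (tg 3 emp) ⊓
  (SymIn C (nm 1) (tg 4 emp) ⊓
  ((⨅ m, m ∈ᵢ om ⇨ ⨅ p, FmIn C (sc m) p ⇨ SymIn C (sc m) (tg 5 p)) ⊓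
  ((⨅ m, m ∈ᵢ om ⇨ ⨅ p, FmIn C (sc (sc m)) p ⇨ SymIn C (sc m) (tg 6 p)) ⊓
  ((⨅ k, k ∈ᵢ om ⇨ ⨅ i, i ∈ᵢ k ⇨ TmIn C k (tg 0 i)) ⊓
  ((⨅ k, k ∈ᵢ om ⇨ ⨅ m, m ∈ᵢ om ⇨ ⨅ f, ⨅ w,
    SymIn C m f ⊓ TmSeqIn C k m w ⇨ TmIn C k (tg 1 (op f w))) ⊓
  ((⨅ k, k ∈ᵢ om ⇨ ⨅ t, ⨅ s, TmIn C k t ⊓ TmIn C k s ⇨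
    FmIn C k (tg 0 (op t s)) ⊓ FmIn C k (tg 1 (op t s))) ⊓
  ((⨅ k, k ∈ᵢ om ⇨ FmIn C k (tg 2 emp)) ⊓
  ((⨅ k, k ∈ᵢ om ⇨ ⨅ p, ⨅ q, FmIn C k p ⊓ FmIn C k q ⇨
    FmIn C k (tg 3 (op p q)) ⊓ (FmIn C k (tg 4 (op p q)) ⊓ FmIn C k (tg 5 (op p q)))) ⊓
  (⨅ k, k ∈ᵢ om ⇨ ⨅ p, FmIn C (sc k) p ⇨ FmIn C k (tg 6 p) ⊓ FmIn C k (tg 7 p)))))))))))))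

set_option synthInstance.maxSize 1000 in
instance Def.synClosed {C : X → D} [hC : TDef C] : Def fun x => SynClosed (C x) := by
  refine Def.comp (Q := fun _ => SynClosed) ?_ hC
  unfold SynClosed
  infer_instance

/-- `C` is the least set closed under the formation rules. -/
def IsSyntax (C : D) : Ω := SynClosed C ⊓ ⨅ A, SynClosed A ⇨ ⨅ x, x ∈ᵢ C ⇨ x ∈ᵢ A

section Eval

variable {n : ℕ} (e : Fin n → D)

@[simp] theorem eval_symIn (C m f : Tm K n) :
    (symIn C m f).eval e = SymIn (C.eval e) (m.eval e) (f.eval e) := by simp [symIn]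

@[simp] theorem eval_tmIn (C m f : Tm K n) :
    (tmIn C m f).eval e = TmIn (C.eval e) (m.eval e) (f.eval e) := by simp [tmIn]

@[simp] theorem eval_fmIn (C m f : Tm K n) :
    (fmIn C m f).eval e = FmIn (C.eval e) (m.eval e) (f.eval e) := by simp [fmIn]

@[simp] theorem eval_tmSeqIn [IsModelIZF D] (C k m w : Tm K n) : (tmSeqIn C k m w).eval e =
    TmSeqIn (C.eval e) (k.eval e) (m.eval e) (w.eval e) := by
  simp [tmSeqIn, TmSeqIn, eval_isFun]

theorem eval_synClosed [IsModelIZF D] (C : Tm K n) :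
    (synClosed C).eval e = SynClosed (C.eval e) := by
  simp only [synClosed, SynClosed, eval_and, eval_imp, eval_ball, eval_allx, eval_symIn, eval_tmIn,
    eval_fmIn, eval_tmSeqIn, eval_tag, eval_opT, eval_emptyT, eval_sucT, eval_num, eval_omegaT,
    Tm.eval_lift, eval_var_last]

theorem eval_isSyntax [IsModelIZF D] (C : Tm K n) : (isSyntax C).eval e = IsSyntax (C.eval e) := by
  simp [isSyntax, IsSyntax, eval_synClosed]

end Eval

variable [IsModelIZF D] {u v : Ω} {M C A k m f g w p t : D}

/-- At the world `u`, the set `C` is closed under the formation rules. -/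
structure SynAt (u : Ω) (C : D) : Prop where
  empty : u ⊩ SymIn C (nm 0) (tg 0 emp)
  omega : u ⊩ SymIn C (nm 0) (tg 1 emp)
  pair : u ⊩ SymIn C (nm 2) (tg 2 emp)
  union : u ⊩ SymIn C (nm 1) (tg 3 emp)
  power : u ⊩ SymIn C (nm 1) (tg 4 emp)
  sep : ∀ v ≤ u, ∀ m p, v ⊩ m ∈ᵢ om → v ⊩ FmIn C (sc m) p → v ⊩ SymIn C (sc m) (tg 5 p)
  repl : ∀ v ≤ u, ∀ m p, v ⊩ m ∈ᵢ om → v ⊩ FmIn C (sc (sc m)) p → v ⊩ SymIn C (sc m) (tg 6 p)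
  var : ∀ v ≤ u, ∀ k i, v ⊩ k ∈ᵢ om → v ⊩ i ∈ᵢ k → v ⊩ TmIn C k (tg 0 i)
  app : ∀ v ≤ u, ∀ k m f w, v ⊩ k ∈ᵢ om → v ⊩ m ∈ᵢ om → v ⊩ SymIn C m f → v ⊩ TmSeqIn C k m w →
    v ⊩ TmIn C k (tg 1 (op f w))
  atom : ∀ v ≤ u, ∀ k t s, v ⊩ k ∈ᵢ om → v ⊩ TmIn C k t → v ⊩ TmIn C k s →
    v ⊩ FmIn C k (tg 0 (op t s)) ⊓ FmIn C k (tg 1 (op t s))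
  bot : ∀ v ≤ u, ∀ k, v ⊩ k ∈ᵢ om → v ⊩ FmIn C k (tg 2 emp)
  conn : ∀ v ≤ u, ∀ k p q, v ⊩ k ∈ᵢ om → v ⊩ FmIn C k p → v ⊩ FmIn C k q →
    v ⊩ FmIn C k (tg 3 (op p q)) ⊓ (FmIn C k (tg 4 (op p q)) ⊓ FmIn C k (tg 5 (op p q)))
  quant : ∀ v ≤ u, ∀ k p, v ⊩ k ∈ᵢ om → v ⊩ FmIn C (sc k) p →
    v ⊩ FmIn C k (tg 6 p) ⊓ FmIn C k (tg 7 p)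

theorem Forces.synAt (h : u ⊩ SynClosed C) : SynAt u C := by
  simp only [SynClosed, forces_and] at h
  obtain ⟨h1, h2, h3, h4, h5, h6, h7, h8, h9, h10, h11, h12, h13⟩ := h
  refine ⟨h1, h2, h3, h4, h5, ?_, ?_, ?_, ?_, ?_, ?_, ?_, ?_⟩
  · exact fun v hv m p hm hp => have : Below v u := ⟨hv⟩; (h6.ball hm).ball hp
  · exact fun v hv m p hm hp => have : Below v u := ⟨hv⟩; (h7.ball hm).ball hp
  · exact fun v hv m p hm hp => have : Below v u := ⟨hv⟩; (h8.ball hm).ball hp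
  · exact fun v hv k m f w hk hm hf hw => have : Below v u := ⟨hv⟩
      ((((h9.ball hk).ball hm).at f).ball (hf.and hw))
  · exact fun v hv k t s hk ht hs => have : Below v u := ⟨hv⟩
      ((h10.ball hk).at t).ball (ht.and hs)
  · exact fun v hv k hk => have : Below v u := ⟨hv⟩; h11.ball hk
  · exact fun v hv k p q hk hp hq => have : Below v u := ⟨hv⟩
      ((h12.ball hk).at p).ball (hp.and hq)
  · exact fun v hv m p hm hp => have : Below v u := ⟨hv⟩; (h13.ball hm).ball hp

theorem SynAt.forces (h : SynAt u C) : u ⊩ SynClosed C := by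
  simp only [SynClosed, forces_and]
  refine ⟨h.empty, h.omega, h.pair, h.union, h.power, ?_, ?_, ?_, ?_, ?_, ?_, ?_, ?_⟩
  · exact ballI fun v _ m hm => ballI fun v _ p hp => h.sep v Below.le m p hm.up hp
  · exact ballI fun v _ m hm => ballI fun v _ p hp => h.repl v Below.le m p hm.up hp
  · exact ballI fun v _ m hm => ballI fun v _ p hp => h.var v Below.le m p hm.up hp
  · exact ballI fun v _ k hk => ballI fun v _ m hm => Forces.all fun f => ballI fun v _ w hw =>
      h.app v Below.le k m f w hk.up hm.up hw.left hw.right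
  · exact ballI fun v _ k hk => Forces.all fun t => ballI fun v _ s hs =>
      h.atom v Below.le k t s hk.up hs.left hs.right
  · exact ballI fun v _ k hk => h.bot v Below.le k hk
  · exact ballI fun v _ k hk => Forces.all fun t => ballI fun v _ s hs =>
      h.conn v Below.le k t s hk.up hs.left hs.right
  · exact ballI fun v _ m hm => ballI fun v _ p hp => h.quant v Below.le m p hm.up hp

theorem Forces.tmSeqIn_mono (h : u ⊩ TmSeqIn C k m w) (hC : u ⊩ Sub C A) : u ⊩ TmSeqIn A k m w :=
  h.bexE fun _ _ _ hw hd => .bex hw (ballI fun _ _ _ ht => hC.ball (hd.ball ht))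

variable (M) in
/-- The least subset of `M` closed under the formation rules. -/
noncomputable def synSet : D := sep (fun x => ⨅ A, SynClosed A ⇨ x ∈ᵢ A) M

theorem mem_synSet (x : D) : x ∈ᵢ synSet M = x ∈ᵢ M ⊓ ⨅ A, SynClosed A ⇨ x ∈ᵢ A := mem_sep _ _ _

theorem synSet_sub : u ⊩ Sub (synSet M) M := ballI fun v _ x hx => by
  rw [mem_synSet] at hx
  exact hx.left

theorem synSet_least (h : u ⊩ SynClosed A) : u ⊩ Sub (synSet M) A := ballI fun v _ x hx => by
  rw [mem_synSet] at hx
  exact hx.right.ball h.up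

theorem mem_synSetI {x : D} (hx : u ⊩ x ∈ᵢ M)
    (h : ∀ v ≤ u, ∀ A, SynAt v A → v ⊩ Sub (synSet M) A → v ⊩ x ∈ᵢ A) : u ⊩ x ∈ᵢ synSet M := by
  rw [mem_synSet]
  exact hx.and (ballI fun v e A hA => h v e.le A hA.synAt (synSet_least hA))

variable (hM : Inac M)

include hM

theorem Inac.tg_op_mem {i : ℕ} {x y : D} (hx : u ⊩ x ∈ᵢ M) (hy : u ⊩ y ∈ᵢ M) :
    u ⊩ tg i (op x y) ∈ᵢ M := hM.tg_mem (hM.op_mem hx hy)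

theorem Inac.of_tg_op {i : ℕ} {x y : D} (h : u ⊩ tg i (op x y) ∈ᵢ synSet M) : u ⊩ y ∈ᵢ M :=
  hM.snd_mem (hM.snd_mem ((synSet_sub (u := u)).ball h))

theorem Inac.tmSeq_isFun (hw : u ⊩ TmSeqIn (synSet M) k m w) : u ⊩ IsFun w m M :=
  hw.bexE fun _ _ _ hw hd => hw.fun_cod_change fun _ _ _ _ _ hy => hM.of_tg_op (hd.ball hy)

theorem Inac.tmSeq_mem (hm : u ⊩ m ∈ᵢ om) (hw : u ⊩ TmSeqIn (synSet M) k m w) : u ⊩ w ∈ᵢ M :=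
  hM.fun_mem (hM.om_sub hm) (hM.tmSeq_isFun hw)

theorem Inac.synAt : SynAt u (synSet M) where
  empty := mem_synSetI (hM.tg_op_mem (hM.nm_mem _) (hM.tg_mem hM.emp_mem)) fun _ _ _ hA _ => hA.empty
  omega := mem_synSetI (hM.tg_op_mem (hM.nm_mem _) (hM.tg_mem hM.emp_mem)) fun _ _ _ hA _ => hA.omega
  pair := mem_synSetI (hM.tg_op_mem (hM.nm_mem _) (hM.tg_mem hM.emp_mem)) fun _ _ _ hA _ => hA.pair
  union := mem_synSetI (hM.tg_op_mem (hM.nm_mem _) (hM.tg_mem hM.emp_mem)) fun _ _ _ hA _ => hA.union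
  power := mem_synSetI (hM.tg_op_mem (hM.nm_mem _) (hM.tg_mem hM.emp_mem)) fun _ _ _ hA _ => hA.power
  sep v _ m p hm hp := mem_synSetI
    (hM.tg_op_mem (hM.sc_mem (hM.om_sub hm)) (hM.tg_mem (hM.of_tg_op hp)))
    fun _ e _ hA hs => hA.sep _ le_rfl _ _ (hm.mono e) (hs.ball (hp.mono e))
  repl v _ m p hm hp := mem_synSetI
    (hM.tg_op_mem (hM.sc_mem (hM.om_sub hm)) (hM.tg_mem (hM.of_tg_op hp)))
    fun _ e _ hA hs => hA.repl _ le_rfl _ _ (hm.mono e) (hs.ball (hp.mono e))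
  var v _ k i hk hi := mem_synSetI
    (hM.tg_op_mem (hM.om_sub hk) (hM.tg_mem (hM.trans hi (hM.om_sub hk))))
    fun _ e _ hA hs => hA.var _ le_rfl _ _ (hk.mono e) (hi.mono e)
  app v _ k m f w hk hm hf hw := mem_synSetI
    (hM.tg_op_mem (hM.om_sub hk) (hM.tg_op_mem (hM.of_tg_op hf) (hM.tmSeq_mem hm hw)))
    fun _ e _ hA hs => hA.app _ le_rfl _ _ _ _ (hk.mono e) (hm.mono e) (hs.ball (hf.mono e))
      ((hw.mono e).tmSeqIn_mono hs)
  atom v _ k t s hk ht hs := by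
    have h : ∀ i : ℕ, v ⊩ tg 2 (op k (tg i (op t s))) ∈ᵢ M := fun i =>
      hM.tg_op_mem (hM.om_sub hk) (hM.tg_op_mem (hM.of_tg_op ht) (hM.of_tg_op hs))
    have h' := fun w (e : w ≤ v) A (hA : SynAt w A) (h : w ⊩ Sub (synSet M) A) =>
      hA.atom _ le_rfl _ _ _ (hk.mono e) (h.ball (ht.mono e)) (h.ball (hs.mono e))
    exact .and (mem_synSetI (h _) fun w e A hA hs => (h' w e A hA hs).left)
      (mem_synSetI (h _) fun w e A hA hs => (h' w e A hA hs).right)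
  bot v _ k hk := mem_synSetI (hM.tg_op_mem (hM.om_sub hk) (hM.tg_mem hM.emp_mem))
    fun _ e _ hA _ => hA.bot _ le_rfl _ (hk.mono e)
  conn v _ k t s hk ht hs := by
    have h : ∀ i : ℕ, v ⊩ tg 2 (op k (tg i (op t s))) ∈ᵢ M := fun i =>
      hM.tg_op_mem (hM.om_sub hk) (hM.tg_op_mem (hM.of_tg_op ht) (hM.of_tg_op hs))
    have h' := fun w (e : w ≤ v) A (hA : SynAt w A) (h : w ⊩ Sub (synSet M) A) =>
      hA.conn _ le_rfl _ _ _ (hk.mono e) (h.ball (ht.mono e)) (h.ball (hs.mono e))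
    exact .and (mem_synSetI (h _) fun w e A hA hs => (h' w e A hA hs).left)
      (.and (mem_synSetI (h _) fun w e A hA hs => (h' w e A hA hs).right.left)
        (mem_synSetI (h _) fun w e A hA hs => (h' w e A hA hs).right.right))
  quant v _ k p hk hp := by
    have h : ∀ i : ℕ, v ⊩ tg 2 (op k (tg i p)) ∈ᵢ M := fun i =>
      hM.tg_op_mem (hM.om_sub hk) (hM.tg_mem (hM.of_tg_op hp))
    have h' := fun w (e : w ≤ v) A (hA : SynAt w A) (h : w ⊩ Sub (synSet M) A) =>
      hA.quant _ le_rfl _ _ (hk.mono e) (h.ball (hp.mono e))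
    exact .and (mem_synSetI (h _) fun w e A hA hs => (h' w e A hA hs).left)
      (mem_synSetI (h _) fun w e A hA hs => (h' w e A hA hs).right)

theorem Inac.isSyntax : u ⊩ IsSyntax (synSet M) :=
  hM.synAt.forces.and (ballI fun _ _ _ hA => synSet_least hA)

omit hM

/-- The possible forms of a function symbol of arity `m`. -/
def SymForm (C m f : D) : Ω :=
  (m =ᵢ nm 0 ⊓ f =ᵢ tg 0 emp) ⊔
  ((m =ᵢ nm 0 ⊓ f =ᵢ tg 1 emp) ⊔
  ((m =ᵢ nm 2 ⊓ f =ᵢ tg 2 emp) ⊔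
  ((m =ᵢ nm 1 ⊓ f =ᵢ tg 3 emp) ⊔
  ((m =ᵢ nm 1 ⊓ f =ᵢ tg 4 emp) ⊔
  ((⨆ k, k ∈ᵢ om ⊓ ⨆ p, FmIn C (sc k) p ⊓ (m =ᵢ sc k ⊓ f =ᵢ tg 5 p)) ⊔
  (⨆ k, k ∈ᵢ om ⊓ ⨆ p, FmIn C (sc (sc k)) p ⊓ (m =ᵢ sc k ⊓ f =ᵢ tg 6 p)))))))

set_option synthInstance.maxSize 1000 in
instance {a b c : X → D} [TDef a] [TDef b] [TDef c] :
    Def fun x => SymForm (a x) (b x) (c x) := by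
  refine Def.comp₃ ?_
  unfold SymForm
  infer_instance

include hM

theorem Inac.symForm (hf : u ⊩ SymIn (synSet M) m f) : u ⊩ SymForm (synSet M) m f := by
  let C := synSet M
  let A := IZF.sep (fun j => ⨅ m, ⨅ f, j =ᵢ tg 0 (op m f) ⇨ SymForm C m f) C
  have hA : ∀ j, j ∈ᵢ A = j ∈ᵢ C ⊓ ⨅ m, ⨅ f, j =ᵢ tg 0 (op m f) ⇨ SymForm C m f :=
    fun j => mem_sep _ _ _
  have hAC : ∀ v : Ω, v ⊩ Sub A C := fun v => ballI fun w _ x hx => by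
    rw [hA] at hx
    exact hx.left
  have hother : ∀ {i : ℕ} {v : Ω} {x : D}, i ≠ 0 → v ⊩ tg i x ∈ᵢ C → v ⊩ tg i x ∈ᵢ A := by
    intro i v x hi hx
    rw [hA]
    refine hx.and (.all fun m => .all fun f => ?_)
    rw [tg_ne hi]
    exact impI fun _ _ h => h.elim
  have hsym : ∀ {v : Ω} {m f : D}, v ⊩ SymIn C m f → v ⊩ SymForm C m f → v ⊩ SymIn A m f := by
    intro v m f hx h
    rw [SymIn, hA]
    refine hx.and (.all fun m' => .all fun f' => ?_)
    rw [tg_eq, op_eq]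
    exact impI fun w _ e => e.right.leib (fun f => SymForm C m' f)
      (e.left.leib (fun m => SymForm C m f) h.up)
  have hC : ∀ {v : Ω}, SynAt v C := hM.synAt
  have hAs : SynAt u A :=
    { empty := hsym hC.empty (.inl (eq_rfl.and eq_rfl))
      omega := hsym hC.omega (.inr (.inl (eq_rfl.and eq_rfl)))
      pair := hsym hC.pair (.inr (.inr (.inl (eq_rfl.and eq_rfl))))
      union := hsym hC.union (.inr (.inr (.inr (.inl (eq_rfl.and eq_rfl)))))
      power := hsym hC.power (.inr (.inr (.inr (.inr (.inl (eq_rfl.and eq_rfl))))))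
      sep := fun v e m p hm hp => hsym (hC.sep _ le_rfl _ _ hm ((hAC v).ball hp))
        (.inr (.inr (.inr (.inr (.inr (.inl (.bex hm (.bex ((hAC v).ball hp) (eq_rfl.and eq_rfl)))))))))
      repl := fun v e m p hm hp => hsym (hC.repl _ le_rfl _ _ hm ((hAC v).ball hp))
        (.inr (.inr (.inr (.inr (.inr (.inr (.bex hm (.bex ((hAC v).ball hp) (eq_rfl.and eq_rfl)))))))))
      var := fun v e k i hk hi => hother (by decide) (hC.var _ le_rfl _ _ hk hi)
      app := fun v e k m f w hk hm hf hw => hother (by decide)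
        (hC.app _ le_rfl _ _ _ _ hk hm ((hAC v).ball hf) (hw.tmSeqIn_mono (hAC v)))
      atom := fun v e k t s hk ht hs => by
        have := hC.atom _ le_rfl _ _ _ hk ((hAC v).ball ht) ((hAC v).ball hs)
        exact (hother (by decide) this.left).and (hother (by decide) this.right)
      bot := fun v e k hk => hother (by decide) (hC.bot _ le_rfl _ hk)
      conn := fun v e k t s hk ht hs => by
        have := hC.conn _ le_rfl _ _ _ hk ((hAC v).ball ht) ((hAC v).ball hs)
        exact (hother (by decide) this.left).and ((hother (by decide) this.right.left).and
          (hother (by decide) this.right.right))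
      quant := fun v e k p hk hp => by
        have := hC.quant _ le_rfl _ _ hk ((hAC v).ball hp)
        exact (hother (by decide) this.left).and (hother (by decide) this.right) }
  have h1 : u ⊩ tg 0 (op m f) ∈ᵢ A := (synSet_least hAs.forces).ball hf
  rw [hA] at h1
  exact (h1.right.at m).ball eq_rfl

end CodedSyntax

/-! ## Codes -/

section Codes

variable {K Ω D : Type} [Str K Ω D]

mutual
/-- The code of a function symbol, as a set. -/
def Sym.cd : {m : ℕ} → Sym Empty m → D
  | _, .const k => k.elim
  | _, .empty => tg 0 emp
  | _, .omega => tg 1 emp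
  | _, .pair => tg 2 emp
  | _, .union => tg 3 emp
  | _, .power => tg 4 emp
  | _, .sep φ => tg 5 φ.cd
  | _, .repl φ => tg 6 φ.cd

/-- The code of a term, as a set. -/
def Tm.cd : {n : ℕ} → Tm Empty n → D
  | _, .var i => tg 0 (nm i)
  | _, .app f u => tg 1 (op f.cd (seq fun j => (u j).cd))

/-- The code of a formula, as a set. -/
def Fm.cd : {n : ℕ} → Fm Empty n → D
  | _, .mem t s => tg 0 (op t.cd s.cd)
  | _, .eq t s => tg 1 (op t.cd s.cd)
  | _, .bot => tg 2 emp
  | _, .and φ ψ => tg 3 (op φ.cd ψ.cd)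
  | _, .or φ ψ => tg 4 (op φ.cd ψ.cd)
  | _, .imp φ ψ => tg 5 (op φ.cd ψ.cd)
  | _, .all φ => tg 6 φ.cd
  | _, .ex φ => tg 7 φ.cd
end

mutual
theorem Sym.eval_code {l : ℕ} (e : Fin l → D) :
    {m : ℕ} → (f : Sym Empty m) → (f.code : Tm K l).eval e = f.cd
  | _, .const k => k.elim
  | _, .empty => by simp [Sym.code, Sym.cd]
  | _, .omega => by simp [Sym.code, Sym.cd]
  | _, .pair => by simp [Sym.code, Sym.cd]
  | _, .union => by simp [Sym.code, Sym.cd]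
  | _, .power => by simp [Sym.code, Sym.cd]
  | _, .sep φ => by simp [Sym.code, Sym.cd, φ.eval_code e]
  | _, .repl φ => by simp [Sym.code, Sym.cd, φ.eval_code e]

theorem Tm.eval_code {l : ℕ} (e : Fin l → D) :
    {n : ℕ} → (t : Tm Empty n) → (t.code : Tm K l).eval e = t.cd
  | _, .var i => by simp [Tm.code, Tm.cd]
  | _, .app f u => by simp [Tm.code, Tm.cd, f.eval_code e, fun j => (u j).eval_code e]

theorem Fm.eval_code {l : ℕ} (e : Fin l → D) :
    {n : ℕ} → (φ : Fm Empty n) → (φ.code : Tm K l).eval e = φ.cd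
  | _, .mem t s => by simp [Fm.code, Fm.cd, t.eval_code e, s.eval_code e]
  | _, .eq t s => by simp [Fm.code, Fm.cd, t.eval_code e, s.eval_code e]
  | _, .bot => by simp [Fm.code, Fm.cd]
  | _, .and φ ψ => by simp [Fm.code, Fm.cd, φ.eval_code e, ψ.eval_code e]
  | _, .or φ ψ => by simp [Fm.code, Fm.cd, φ.eval_code e, ψ.eval_code e]
  | _, .imp φ ψ => by simp [Fm.code, Fm.cd, φ.eval_code e, ψ.eval_code e]
  | _, .all φ => by simp [Fm.code, Fm.cd, φ.eval_code e]
  | _, .ex φ => by simp [Fm.code, Fm.cd, φ.eval_code e]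
end

variable [Order.Frame Ω] [IsModelIZF D] {M : D}

theorem tmSeqIn_seq {C : D} {u : Ω} {k m : ℕ} {w : Fin m → D} (h : ∀ j, u ⊩ TmIn C (nm k) (w j)) :
    u ⊩ TmSeqIn C (nm k) (nm m) (seq w) := by
  let d := sep (fun t => TmIn C (nm k) t) (un (un (un (un C))))
  refine .bex (x := d) (isFun_seq fun j => ?_) (ballI fun v _ t ht => ?_)
  · rw [mem_sep]
    refine .and ?_ (h j)
    rw [mem_un]
    refine .bex (x := pr (nm k) (w j)) ?_ mem_pr_right
    rw [mem_un]
    refine .bex (x := op (nm k) (w j)) ?_ mem_pr_right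
    rw [mem_un]
    refine .bex (x := pr (nm 1) (op (nm k) (w j))) ?_ mem_pr_right
    rw [mem_un]
    exact .bex (h j) mem_pr_right
  · rw [mem_sep] at ht
    exact ht.right

mutual
theorem Sym.cd_mem (hM : Inac M) (u : Ω) : {m : ℕ} → (f : Sym Empty m) → u ⊩ SymIn (synSet M) (nm m) f.cd
  | _, .const k => k.elim
  | _, .empty => hM.synAt.empty
  | _, .omega => hM.synAt.omega
  | _, .pair => hM.synAt.pair
  | _, .union => hM.synAt.union
  | _, .power => hM.synAt.power
  | _, .sep φ => hM.synAt.sep u le_rfl _ _ (nm_mem_om _) (φ.cd_mem hM u)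
  | _, .repl φ => hM.synAt.repl u le_rfl _ _ (nm_mem_om _) (φ.cd_mem hM u)

theorem Tm.cd_mem (hM : Inac M) (u : Ω) : {n : ℕ} → (t : Tm Empty n) → u ⊩ TmIn (synSet M) (nm n) t.cd
  | _, .var i => hM.synAt.var u le_rfl _ _ (nm_mem_om _) (nm_mem_nm i.2)
  | _, .app f w => hM.synAt.app u le_rfl _ _ _ _ (nm_mem_om _) (nm_mem_om _) (f.cd_mem hM u)
      (tmSeqIn_seq fun j => (w j).cd_mem hM u)

theorem Fm.cd_mem (hM : Inac M) (u : Ω) : {n : ℕ} → (φ : Fm Empty n) → u ⊩ FmIn (synSet M) (nm n) φ.cd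
  | _, .mem t s => (hM.synAt.atom u le_rfl _ _ _ (nm_mem_om _) (t.cd_mem hM u) (s.cd_mem hM u)).left
  | _, .eq t s => (hM.synAt.atom u le_rfl _ _ _ (nm_mem_om _) (t.cd_mem hM u) (s.cd_mem hM u)).right
  | _, .bot => hM.synAt.bot u le_rfl _ (nm_mem_om _)
  | _, .and φ ψ => (hM.synAt.conn u le_rfl _ _ _ (nm_mem_om _) (φ.cd_mem hM u) (ψ.cd_mem hM u)).left
  | _, .or φ ψ => (hM.synAt.conn u le_rfl _ _ _ (nm_mem_om _) (φ.cd_mem hM u) (ψ.cd_mem hM u)).right.left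
  | _, .imp φ ψ => (hM.synAt.conn u le_rfl _ _ _ (nm_mem_om _) (φ.cd_mem hM u) (ψ.cd_mem hM u)).right.right
  | _, .all φ => (hM.synAt.quant u le_rfl _ _ (nm_mem_om _) (φ.cd_mem hM u)).left
  | _, .ex φ => (hM.synAt.quant u le_rfl _ _ (nm_mem_om _) (φ.cd_mem hM u)).right
end

end Codes

section Equivalence

variable {Ω ι : Type} [Order.Frame Ω] {u p p' q q' : Ω} {P Q : ι → Ω}

theorem bi_rfl : u ⊩ p ⇔ᵢ p := iffI (fun _ _ h => h) fun _ _ h => h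

theorem bi_inf (h : u ⊩ p ⇔ᵢ p') (h' : u ⊩ q ⇔ᵢ q') : u ⊩ p ⊓ q ⇔ᵢ p' ⊓ q' :=
  iffI (fun _ _ hp => (h.left.mp hp.left).and (h'.left.mp hp.right))
    fun _ _ hp => (h.right.mp hp.left).and (h'.right.mp hp.right)

theorem bi_inf_of (h' : ∀ v, Ext v u → v ⊩ p → v ⊩ q ⇔ᵢ q') : u ⊩ p ⊓ q ⇔ᵢ p ⊓ q' :=
  iffI (fun v e hp => hp.left.and ((h' v e hp.left).left.mp hp.right))
    fun v e hp => hp.left.and ((h' v e hp.left).right.mp hp.right)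

theorem bi_sup (h : u ⊩ p ⇔ᵢ p') (h' : u ⊩ q ⇔ᵢ q') : u ⊩ p ⊔ q ⇔ᵢ p' ⊔ q' :=
  iffI (fun _ _ hp => hp.orE (fun _ _ hp => .inl (h.left.mp hp)) fun _ _ hp => .inr (h'.left.mp hp))
    fun _ _ hp => hp.orE (fun _ _ hp => .inl (h.right.mp hp)) fun _ _ hp => .inr (h'.right.mp hp)

theorem bi_himp (h : u ⊩ p ⇔ᵢ p') (h' : u ⊩ q ⇔ᵢ q') : u ⊩ (p ⇨ q) ⇔ᵢ (p' ⇨ q') :=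
  iffI (fun _ _ hp => impI fun _ _ hq => h'.left.mp (hp.mp (h.right.mp hq)))
    fun _ _ hp => impI fun _ _ hq => h'.right.mp (hp.mp (h.left.mp hq))

theorem bi_himp_of (h' : ∀ v, Ext v u → v ⊩ p → v ⊩ q ⇔ᵢ q') : u ⊩ (p ⇨ q) ⇔ᵢ (p ⇨ q') := by
  refine iffI (fun v e hp => impI fun w e' hq => ?_) fun v e hp => impI fun w e' hq => ?_
  · exact (h' w ⟨e'.le.trans e.le⟩ hq).left.mp (hp.mp hq)
  · exact (h' w ⟨e'.le.trans e.le⟩ hq).right.mp (hp.mp hq)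

theorem bi_iInf (h : ∀ x, u ⊩ P x ⇔ᵢ Q x) : u ⊩ (⨅ x, P x) ⇔ᵢ (⨅ x, Q x) :=
  iffI (fun _ _ hp => .all fun x => (h x).left.mp (hp.at x))
    fun _ _ hp => .all fun x => (h x).right.mp (hp.at x)

theorem bi_iSup (h : ∀ x, u ⊩ P x ⇔ᵢ Q x) : u ⊩ (⨆ x, P x) ⇔ᵢ (⨆ x, Q x) :=
  iffI (fun _ _ hp => hp.exE fun _ _ x hx => .ex x ((h x).left.mp hx))
    fun _ _ hp => hp.exE fun _ _ x hx => .ex x ((h x).right.mp hx)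

theorem bi_biimp (h : u ⊩ p ⇔ᵢ p') (h' : u ⊩ q ⇔ᵢ q') : u ⊩ (p ⇔ᵢ q) ⇔ᵢ (p' ⇔ᵢ q') :=
  bi_inf (bi_himp h h') (bi_himp h' h)

end Equivalence

section Satisfaction

variable {K Ω D X : Type} [Order.Frame Ω] [Str K Ω D] [Env D X]

/-! ## The clauses of the definition of satisfaction

A set `S` of pairs codes three relations: the value of the term `t` in the environment `e` is `v`; the
formula `p` holds in the environment `e`; the value of the function symbol `f` at `w` is `y`. -/

abbrev TmVal (S t e v : D) : Ω := op t (tg 0 (op e v)) ∈ᵢ S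

abbrev Holds (S p e : D) : Ω := op p (tg 1 e) ∈ᵢ S

abbrev SymVal (S f w y : D) : Ω := op f (tg 2 (op w y)) ∈ᵢ S

/-- `w` consists of the values of the terms in `l`. -/
def ArgVal (S l e m w : D) : Ω :=
  ⨅ j, j ∈ᵢ m ⇨ ⨅ t, ⨅ y, op j t ∈ᵢ l ⊓ op j y ∈ᵢ w ⇨ TmVal S t e y

instance {a b c d e : X → D} [TDef a] [TDef b] [TDef c] [TDef d] [TDef e] :
    Def fun x => ArgVal (a x) (b x) (c x) (d x) (e x) := by
  refine Def.comp₅ ?_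
  unfold ArgVal
  infer_instance

section Decoding

variable [IsModelIZF D]

theorem iSup_op (F : D → D → Ω) [hF : Def fun p : D × D => F p.1 p.2] (a b : D) :
    (⨆ x, ⨆ y, op a b =ᵢ op x y ⊓ F x y) = F a b := by
  have : ∀ {X : Type} [Env D X] {a b : X → D} [TDef a] [TDef b], Def fun x => F (a x) (b x) :=
    fun {_ _ _ _ ha hb} => hF.app₂ ha hb
  refine eq_of_forces (fun u h => h.exE fun v _ x h => h.bexE fun v _ y e h => ?_) fun u h =>
    .ex a (.bex eq_rfl h)
  exact e.op_snd.symm.leib (fun y => F a y) (e.op_fst.symm.leib (fun x => F x y) h)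

theorem iSup_tg {k : ℕ} (F : D → Ω) [hF : Def F] (a : D) :
    (⨆ x, tg k a =ᵢ tg k x ⊓ F x) = F a := by
  simp only [tg_eq]
  refine eq_of_forces (fun u h => h.bexE fun v _ x e h => e.symm.leib F h) fun u h => .bex eq_rfl h

theorem iSup_tg_op {k : ℕ} (F : D → D → Ω) [hF : Def fun p : D × D => F p.1 p.2] (a b : D) :
    (⨆ x, ⨆ y, tg k (op a b) =ᵢ tg k (op x y) ⊓ F x y) = F a b := by
  simp only [tg_eq]
  exact iSup_op F a b

theorem iSup_tg_ne {i j : ℕ} (h : i ≠ j) (F : D → Ω) (a : D) :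
    (⨆ x, tg i a =ᵢ tg j x ⊓ F x) = ⊥ := by
  simp [tg_ne h]

theorem iSup_tg_op_ne {i j : ℕ} (h : i ≠ j) (F : D → D → Ω) (a : D) :
    (⨆ x, ⨆ y, tg i a =ᵢ tg j (op x y) ⊓ F x y) = ⊥ := by
  simp [tg_ne h]

end Decoding

variable [IsModelIZF D] (M : D)

/-- The membership relation on `M`. -/
noncomputable def elRel : D := sep (fun s => ⨆ x, ⨆ y, s =ᵢ op x y ⊓ x ∈ᵢ y) M

/-- The equality relation on `M`. -/
noncomputable def eqRel : D := sep (fun s => ⨆ x, ⨆ y, s =ᵢ op x y ⊓ x =ᵢ y) M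

theorem op_mem_elRel (x y : D) : op x y ∈ᵢ elRel M = op x y ∈ᵢ M ⊓ x ∈ᵢ y := by
  rw [elRel, mem_sep, iSup_op]

theorem op_mem_eqRel (x y : D) : op x y ∈ᵢ eqRel M = op x y ∈ᵢ M ⊓ x =ᵢ y := by
  rw [eqRel, mem_sep, iSup_op]

/-- The value of the application of `f` to the terms in `l` is `v`. -/
def AppClause (S f l e v : D) : Ω :=
  ⨆ m, m ∈ᵢ om ⊓ (IsFun l m M ⊓ ⨆ w, IsFun w m M ⊓ (ArgVal S l e m w ⊓ SymVal S f w v))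

instance {a b c d e : X → D} [TDef a] [TDef b] [TDef c] [TDef d] [TDef e] :
    Def fun x => AppClause M (a x) (b x) (c x) (d x) (e x) := by
  refine Def.comp₅ ?_
  unfold AppClause
  infer_instance

/-- The value of the term `x` in the environment `e` is `v`. -/
def TmClause (x e v S : D) : Ω :=
  (⨆ i, x =ᵢ tg 0 i ⊓ op i v ∈ᵢ e) ⊔ ⨆ f, ⨆ l, x =ᵢ tg 1 (op f l) ⊓ AppClause M S f l e v

instance {a b c d : X → D} [TDef a] [TDef b] [TDef c] [TDef d] :
    Def fun x => TmClause M (a x) (b x) (c x) (d x) := by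
  refine Def.comp₄ ?_
  unfold TmClause
  infer_instance

/-- The atomic formula on the terms `t` and `s` holds in the environment `e`. -/
def AtomClause (E S t s e : D) : Ω :=
  ⨆ a, ⨆ b, TmVal S t e a ⊓ (TmVal S s e b ⊓ op a b ∈ᵢ E)

instance Def.atomClause {a b c d e : X → D} [TDef a] [TDef b] [TDef c] [TDef d] [TDef e] :
    Def fun x => AtomClause (a x) (b x) (c x) (d x) (e x) := by
  refine Def.comp₅ ?_
  unfold AtomClause
  infer_instance

/-- The universal quantification of `p` holds in the environment `e`. -/
def AllClause (S p e : D) : Ω :=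
  ⨆ k, k ∈ᵢ om ⊓ (IsFun e k M ⊓ ⨅ x, x ∈ᵢ M ⇨ Holds S p (ext e k x))

instance {a b c : X → D} [TDef a] [TDef b] [TDef c] :
    Def fun x => AllClause M (a x) (b x) (c x) := by
  refine Def.comp₃ ?_
  unfold AllClause
  infer_instance

/-- The existential quantification of `p` holds in the environment `e`. -/
def ExClause (S p e : D) : Ω :=
  ⨆ k, k ∈ᵢ om ⊓ (IsFun e k M ⊓ ⨆ x, x ∈ᵢ M ⊓ Holds S p (ext e k x))

instance {a b c : X → D} [TDef a] [TDef b] [TDef c] :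
    Def fun x => ExClause M (a x) (b x) (c x) := by
  refine Def.comp₃ ?_
  unfold ExClause
  infer_instance

/-- The formula `x` holds in the environment `e`. -/
noncomputable def FmClause (x e S : D) : Ω :=
  (⨆ t, ⨆ s, x =ᵢ tg 0 (op t s) ⊓ AtomClause (elRel M) S t s e) ⊔
  ((⨆ t, ⨆ s, x =ᵢ tg 1 (op t s) ⊓ AtomClause (eqRel M) S t s e) ⊔
  ((⨆ p, ⨆ q, x =ᵢ tg 3 (op p q) ⊓ (Holds S p e ⊓ Holds S q e)) ⊔
  ((⨆ p, ⨆ q, x =ᵢ tg 4 (op p q) ⊓ (Holds S p e ⊔ Holds S q e)) ⊔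
  ((⨆ p, ⨆ q, x =ᵢ tg 5 (op p q) ⊓ (Holds S p e ⇨ Holds S q e)) ⊔
  ((⨆ p, x =ᵢ tg 6 p ⊓ AllClause M S p e) ⊔
  (⨆ p, x =ᵢ tg 7 p ⊓ ExClause M S p e))))))

set_option synthInstance.maxSize 1000 in
instance {a b c : X → D} [TDef a] [TDef b] [TDef c] :
    Def fun x => FmClause M (a x) (b x) (c x) := by
  refine Def.comp₃ ?_
  unfold FmClause
  infer_instance

/-- The set `c` belongs to the value of the symbol `S_p` at `w`. -/
def SepClause (S p w c : D) : Ω :=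
  ⨆ k, k ∈ᵢ om ⊓ ⨆ f, IsFun f k M ⊓ ⨆ a, a ∈ᵢ M ⊓
    (w =ᵢ ext f k a ⊓ (c ∈ᵢ a ⊓ Holds S p (ext f k c)))

instance {a b c d : X → D} [TDef a] [TDef b] [TDef c] [TDef d] :
    Def fun x => SepClause M (a x) (b x) (c x) (d x) := by
  refine Def.comp₄ ?_
  unfold SepClause
  infer_instance

/-- The formula `p` defines a function on `a`. -/
noncomputable def ReplCond (S p k f a : D) : Ω :=
  ⨅ x, x ∈ᵢ M ⇨ op x a ∈ᵢ elRel M ⇨ ⨆ y, y ∈ᵢ M ⊓ (Holds S p (ext (ext f k x) (sc k) y) ⊓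
    ⨅ z, z ∈ᵢ M ⇨ Holds S p (ext (ext f k x) (sc k) z) ⇨ op z y ∈ᵢ eqRel M)

instance {a b c d e : X → D} [TDef a] [TDef b] [TDef c] [TDef d] [TDef e] :
    Def fun x => ReplCond M (a x) (b x) (c x) (d x) (e x) := by
  refine Def.comp₅ ?_
  unfold ReplCond
  infer_instance

instance {a b c d : D} : Def (ReplCond M a b c d) := by
  unfold ReplCond
  infer_instance

/-- The set `c` belongs to the value of the symbol `R_p` at `w`. -/
noncomputable def ReplClause (S p w c : D) : Ω :=
  ⨆ k, k ∈ᵢ om ⊓ ⨆ f, IsFun f k M ⊓ ⨆ a, a ∈ᵢ M ⊓ (w =ᵢ ext f k a ⊓ (ReplCond M S p k f a ⊓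
    ⨆ x, x ∈ᵢ M ⊓ (op x a ∈ᵢ elRel M ⊓ Holds S p (ext (ext f k x) (sc k) c))))

instance {a b c d : X → D} [TDef a] [TDef b] [TDef c] [TDef d] :
    Def fun x => ReplClause M (a x) (b x) (c x) (d x) := by
  refine Def.comp₄ ?_
  unfold ReplClause
  infer_instance

/-- The set `c` belongs to the value of the symbol `x` at `w`. -/
noncomputable def ElClause (x w c S : D) : Ω :=
  (x =ᵢ tg 1 emp ⊓ c ∈ᵢ om) ⊔
  ((x =ᵢ tg 2 emp ⊓ (op (nm 0) c ∈ᵢ w ⊔ op (nm 1) c ∈ᵢ w)) ⊔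
  ((x =ᵢ tg 3 emp ⊓ ⨆ a, op (nm 0) a ∈ᵢ w ⊓ ⨆ b, b ∈ᵢ a ⊓ c ∈ᵢ b) ⊔
  ((x =ᵢ tg 4 emp ⊓ ⨆ a, op (nm 0) a ∈ᵢ w ⊓ ⨅ b, b ∈ᵢ c ⇨ b ∈ᵢ a) ⊔
  ((⨆ p, x =ᵢ tg 5 p ⊓ SepClause M S p w c) ⊔
  (⨆ p, x =ᵢ tg 6 p ⊓ ReplClause M S p w c)))))

set_option synthInstance.maxSize 1000 in
instance {a b c d : X → D} [TDef a] [TDef b] [TDef c] [TDef d] :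
    Def fun x => ElClause M (a x) (b x) (c x) (d x) := by
  refine Def.comp₄ ?_
  unfold ElClause
  infer_instance

/-- The value of the symbol `x` at `w` is `y`. -/
noncomputable def SymClause (x w y S : D) : Ω := y ∈ᵢ M ⊓ ⨅ c, c ∈ᵢ y ⇔ᵢ c ∈ᵢ M ⊓ ElClause M x w c S

instance {a b c d : X → D} [TDef a] [TDef b] [TDef c] [TDef d] :
    Def fun x => SymClause M (a x) (b x) (c x) (d x) := by
  refine Def.comp₄ ?_
  unfold SymClause
  infer_instance

/-- The joint recursion clause. -/
noncomputable def EvalClause (x z S : D) : Ω :=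
  (⨆ e, ⨆ v, z =ᵢ tg 0 (op e v) ⊓ TmClause M x e v S) ⊔
  ((⨆ e, z =ᵢ tg 1 e ⊓ FmClause M x e S) ⊔
  (⨆ w, ⨆ y, z =ᵢ tg 2 (op w y) ⊓ SymClause M x w y S))

instance : Def fun p : (D × D) × D => EvalClause M p.1.1 p.1.2 p.2 := by
  unfold EvalClause
  infer_instance

/-- The relation coding values of terms, satisfaction of formulas and values of symbols. -/
noncomputable def evalSet : D := recSet M (EvalClause M)

variable {M} {u : Ω} {x y S R : D}

theorem Forces.agree (h : u ⊩ Restr S R x) (hy : u ⊩ TrC y x) (z : D) :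
    u ⊩ op y z ∈ᵢ S ⇔ᵢ op y z ∈ᵢ R :=
  iffI (fun _ _ => (h.up.op_mem_restr hy.up z).1) fun _ _ => (h.up.op_mem_restr hy.up z).2

theorem iSup_restr (F : D → Ω) (hF : ∀ u S, u ⊩ Restr S R x → u ⊩ F S ⇔ᵢ F R) :
    (⨆ S, Restr S R x ⊓ F S) = F R := by
  refine eq_of_forces (fun u h => h.bexE fun v _ S hS h => (hF v S hS).left.mp h) fun u h => ?_
  obtain ⟨S, hS⟩ := exists_restr R x
  exact .bex (hS u) ((hF u S (hS u)).right.mp h)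

theorem trC_tg {k : ℕ} : u ⊩ TrC y (tg k y) := trC_op_right

theorem trC_tg_left {k : ℕ} : u ⊩ TrC x (tg k (op x y)) := trC_op_right.trC_fst

theorem trC_tg_right {k : ℕ} : u ⊩ TrC y (tg k (op x y)) := trC_op_right.trC_snd

variable (hM : Inac M)

include hM

theorem Inac.tmVal_eq (x e v : D) : TmVal (evalSet M) x e v =
    (x ∈ᵢ M ⊓ tg 0 (op e v) ∈ᵢ M) ⊓ ⨆ S, Restr S (evalSet M) x ⊓ TmClause M x e v S := by
  rw [TmVal, evalSet, op_mem_recSet _ hM, RecClause]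
  simp only [EvalClause, iSup_tg_op_ne (show 0 ≠ 2 by decide), iSup_tg_ne (show 0 ≠ 1 by decide),
    sup_bot_eq]
  congr 2
  funext S
  rw [iSup_tg_op]

theorem Inac.holds_eq (x e : D) : Holds (evalSet M) x e =
    (x ∈ᵢ M ⊓ tg 1 e ∈ᵢ M) ⊓ ⨆ S, Restr S (evalSet M) x ⊓ FmClause M x e S := by
  rw [Holds, evalSet, op_mem_recSet _ hM, RecClause]
  simp only [EvalClause, iSup_tg_op_ne (show 1 ≠ 0 by decide), iSup_tg_op_ne (show 1 ≠ 2 by decide),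
    sup_bot_eq, bot_sup_eq]
  congr 2
  funext S
  rw [iSup_tg]

theorem Inac.symVal_eq (x w y : D) : SymVal (evalSet M) x w y =
    (x ∈ᵢ M ⊓ tg 2 (op w y) ∈ᵢ M) ⊓ ⨆ S, Restr S (evalSet M) x ⊓ SymClause M x w y S := by
  rw [SymVal, evalSet, op_mem_recSet _ hM, RecClause]
  simp only [EvalClause, iSup_tg_op_ne (show 2 ≠ 0 by decide), iSup_tg_ne (show 2 ≠ 1 by decide),
    bot_sup_eq]
  congr 2
  funext S
  rw [iSup_tg_op]

/-! ### The recursion equations -/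

theorem Inac.tmVal_var (i e v : D) : TmVal (evalSet M) (tg 0 i) e v =
    (tg 0 i ∈ᵢ M ⊓ tg 0 (op e v) ∈ᵢ M) ⊓ op i v ∈ᵢ e := by
  rw [hM.tmVal_eq]
  simp only [TmClause, iSup_tg, iSup_tg_op_ne (show 0 ≠ 1 by decide), sup_bot_eq]
  rw [iSup_restr (fun _ => op i v ∈ᵢ e) fun _ _ _ => bi_rfl]

theorem Inac.tmVal_app (f l e v : D) : TmVal (evalSet M) (tg 1 (op f l)) e v =
    (tg 1 (op f l) ∈ᵢ M ⊓ tg 0 (op e v) ∈ᵢ M) ⊓ AppClause M (evalSet M) f l e v := by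
  rw [hM.tmVal_eq]
  simp only [TmClause, iSup_tg_op, iSup_tg_ne (show 1 ≠ 0 by decide), bot_sup_eq]
  rw [iSup_restr fun S => AppClause M S f l e v]
  intro u S hS
  refine bi_iSup fun m => bi_inf bi_rfl (bi_inf bi_rfl (bi_iSup fun w => bi_inf bi_rfl (bi_inf ?_
    (hS.agree trC_tg_left _))))
  refine bi_iInf fun j => bi_himp bi_rfl (bi_iInf fun t => bi_iInf fun y => bi_himp_of fun v _ ht => ?_)
  exact hS.up.agree (trC_tg_right.trC_of_mem ht.left).trC_snd _

theorem bi_atomClause {E t s e : D} (hS : u ⊩ Restr S R x) (ht : u ⊩ TrC t x) (hs : u ⊩ TrC s x) :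
    u ⊩ AtomClause E S t s e ⇔ᵢ AtomClause E R t s e :=
  bi_iSup fun _ => bi_iSup fun _ => bi_inf (hS.agree ht _) (bi_inf (hS.agree hs _) bi_rfl)

theorem Inac.holds_mem (t s e : D) : Holds (evalSet M) (tg 0 (op t s)) e =
    (tg 0 (op t s) ∈ᵢ M ⊓ tg 1 e ∈ᵢ M) ⊓ AtomClause (elRel M) (evalSet M) t s e := by
  rw [hM.holds_eq]
  simp only [FmClause, iSup_tg_op, iSup_tg_op_ne (show 0 ≠ 1 by decide),
    iSup_tg_op_ne (show 0 ≠ 3 by decide), iSup_tg_op_ne (show 0 ≠ 4 by decide),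
    iSup_tg_op_ne (show 0 ≠ 5 by decide), iSup_tg_ne (show 0 ≠ 6 by decide),
    iSup_tg_ne (show 0 ≠ 7 by decide), sup_bot_eq]
  rw [iSup_restr (fun S => AtomClause (elRel M) S t s e) fun _ _ hS =>
    bi_atomClause hM hS trC_tg_left trC_tg_right]

theorem Inac.holds_eqT (t s e : D) : Holds (evalSet M) (tg 1 (op t s)) e =
    (tg 1 (op t s) ∈ᵢ M ⊓ tg 1 e ∈ᵢ M) ⊓ AtomClause (eqRel M) (evalSet M) t s e := by
  rw [hM.holds_eq]
  simp only [FmClause, iSup_tg_op, iSup_tg_op_ne (show 1 ≠ 0 by decide),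
    iSup_tg_op_ne (show 1 ≠ 3 by decide), iSup_tg_op_ne (show 1 ≠ 4 by decide),
    iSup_tg_op_ne (show 1 ≠ 5 by decide), iSup_tg_ne (show 1 ≠ 6 by decide),
    iSup_tg_ne (show 1 ≠ 7 by decide), sup_bot_eq, bot_sup_eq]
  rw [iSup_restr (fun S => AtomClause (eqRel M) S t s e) fun _ _ hS =>
    bi_atomClause hM hS trC_tg_left trC_tg_right]

theorem Inac.holds_bot (a e : D) : Holds (evalSet M) (tg 2 a) e = ⊥ := by
  rw [hM.holds_eq]
  simp only [FmClause, iSup_tg_op_ne (show 2 ≠ 0 by decide), iSup_tg_op_ne (show 2 ≠ 1 by decide),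
    iSup_tg_op_ne (show 2 ≠ 3 by decide), iSup_tg_op_ne (show 2 ≠ 4 by decide),
    iSup_tg_op_ne (show 2 ≠ 5 by decide), iSup_tg_ne (show 2 ≠ 6 by decide),
    iSup_tg_ne (show 2 ≠ 7 by decide), sup_bot_eq, inf_bot_eq, iSup_bot]

theorem Inac.holds_and (p q e : D) : Holds (evalSet M) (tg 3 (op p q)) e =
    (tg 3 (op p q) ∈ᵢ M ⊓ tg 1 e ∈ᵢ M) ⊓ (Holds (evalSet M) p e ⊓ Holds (evalSet M) q e) := by
  rw [hM.holds_eq]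
  simp only [FmClause, iSup_tg_op, iSup_tg_op_ne (show 3 ≠ 0 by decide),
    iSup_tg_op_ne (show 3 ≠ 1 by decide), iSup_tg_op_ne (show 3 ≠ 4 by decide),
    iSup_tg_op_ne (show 3 ≠ 5 by decide), iSup_tg_ne (show 3 ≠ 6 by decide),
    iSup_tg_ne (show 3 ≠ 7 by decide), sup_bot_eq, bot_sup_eq]
  rw [iSup_restr (fun S => Holds S p e ⊓ Holds S q e) fun _ _ hS =>
    bi_inf (hS.agree trC_tg_left _) (hS.agree trC_tg_right _)]

theorem Inac.holds_or (p q e : D) : Holds (evalSet M) (tg 4 (op p q)) e =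
    (tg 4 (op p q) ∈ᵢ M ⊓ tg 1 e ∈ᵢ M) ⊓ (Holds (evalSet M) p e ⊔ Holds (evalSet M) q e) := by
  rw [hM.holds_eq]
  simp only [FmClause, iSup_tg_op, iSup_tg_op_ne (show 4 ≠ 0 by decide),
    iSup_tg_op_ne (show 4 ≠ 1 by decide), iSup_tg_op_ne (show 4 ≠ 3 by decide),
    iSup_tg_op_ne (show 4 ≠ 5 by decide), iSup_tg_ne (show 4 ≠ 6 by decide),
    iSup_tg_ne (show 4 ≠ 7 by decide), sup_bot_eq, bot_sup_eq]
  rw [iSup_restr (fun S => Holds S p e ⊔ Holds S q e) fun _ _ hS =>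
    bi_sup (hS.agree trC_tg_left _) (hS.agree trC_tg_right _)]

theorem Inac.holds_imp (p q e : D) : Holds (evalSet M) (tg 5 (op p q)) e =
    (tg 5 (op p q) ∈ᵢ M ⊓ tg 1 e ∈ᵢ M) ⊓ (Holds (evalSet M) p e ⇨ Holds (evalSet M) q e) := by
  rw [hM.holds_eq]
  simp only [FmClause, iSup_tg_op, iSup_tg_op_ne (show 5 ≠ 0 by decide),
    iSup_tg_op_ne (show 5 ≠ 1 by decide), iSup_tg_op_ne (show 5 ≠ 3 by decide),
    iSup_tg_op_ne (show 5 ≠ 4 by decide), iSup_tg_ne (show 5 ≠ 6 by decide),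
    iSup_tg_ne (show 5 ≠ 7 by decide), sup_bot_eq, bot_sup_eq]
  rw [iSup_restr (fun S => Holds S p e ⇨ Holds S q e) fun _ _ hS =>
    bi_himp (hS.agree trC_tg_left _) (hS.agree trC_tg_right _)]

theorem Inac.holds_all (p e : D) : Holds (evalSet M) (tg 6 p) e =
    (tg 6 p ∈ᵢ M ⊓ tg 1 e ∈ᵢ M) ⊓ AllClause M (evalSet M) p e := by
  rw [hM.holds_eq]
  simp only [FmClause, iSup_tg, iSup_tg_op_ne (show 6 ≠ 0 by decide),
    iSup_tg_op_ne (show 6 ≠ 1 by decide), iSup_tg_op_ne (show 6 ≠ 3 by decide),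
    iSup_tg_op_ne (show 6 ≠ 4 by decide), iSup_tg_op_ne (show 6 ≠ 5 by decide),
    iSup_tg_ne (show 6 ≠ 7 by decide), sup_bot_eq, bot_sup_eq]
  rw [iSup_restr (fun S => AllClause M S p e) fun _ _ hS => bi_iSup fun _ => bi_inf bi_rfl (bi_inf
    bi_rfl (bi_iInf fun _ => bi_himp bi_rfl (hS.agree trC_tg _)))]

theorem Inac.holds_ex (p e : D) : Holds (evalSet M) (tg 7 p) e =
    (tg 7 p ∈ᵢ M ⊓ tg 1 e ∈ᵢ M) ⊓ ExClause M (evalSet M) p e := by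
  rw [hM.holds_eq]
  simp only [FmClause, iSup_tg, iSup_tg_op_ne (show 7 ≠ 0 by decide),
    iSup_tg_op_ne (show 7 ≠ 1 by decide), iSup_tg_op_ne (show 7 ≠ 3 by decide),
    iSup_tg_op_ne (show 7 ≠ 4 by decide), iSup_tg_op_ne (show 7 ≠ 5 by decide),
    iSup_tg_ne (show 7 ≠ 6 by decide), bot_sup_eq]
  rw [iSup_restr (fun S => ExClause M S p e) fun _ _ hS => bi_iSup fun _ => bi_inf bi_rfl (bi_inf
    bi_rfl (bi_iSup fun _ => bi_inf bi_rfl (hS.agree trC_tg _)))]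

theorem Inac.symVal (f w y : D) : SymVal (evalSet M) f w y =
    (f ∈ᵢ M ⊓ tg 2 (op w y) ∈ᵢ M) ⊓ SymClause M f w y (evalSet M) := by
  rw [hM.symVal_eq, iSup_restr fun S => SymClause M f w y S]
  intro u S hS
  refine bi_inf bi_rfl (bi_iInf fun c => bi_biimp bi_rfl (bi_inf bi_rfl (bi_sup bi_rfl (bi_sup bi_rfl
    (bi_sup bi_rfl (bi_sup bi_rfl (bi_sup ?_ ?_)))))))
  · refine bi_iSup fun p => bi_inf_of fun v _ hp => ?_
    have := fun z => hS.up.agree (hp.symm.leib (fun x => TrC p x) trC_tg) z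
    exact bi_iSup fun _ => bi_inf bi_rfl (bi_iSup fun _ => bi_inf bi_rfl (bi_iSup fun _ =>
      bi_inf bi_rfl (bi_inf bi_rfl (bi_inf bi_rfl (this _)))))
  · refine bi_iSup fun p => bi_inf_of fun v _ hp => ?_
    have := fun z => hS.up.agree (hp.symm.leib (fun x => TrC p x) trC_tg) z
    exact bi_iSup fun _ => bi_inf bi_rfl (bi_iSup fun _ => bi_inf bi_rfl (bi_iSup fun _ =>
      bi_inf bi_rfl (bi_inf bi_rfl (bi_inf (bi_iInf fun _ => bi_himp bi_rfl (bi_himp bi_rfl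
        (bi_iSup fun _ => bi_inf bi_rfl (bi_inf (this _) (bi_iInf fun _ => bi_himp bi_rfl
          (bi_himp (this _) bi_rfl)))))) (bi_iSup fun _ => bi_inf bi_rfl (bi_inf bi_rfl (this _)))))))

end Satisfaction

/-! ## Models inside set theory -/

section ModelPredicates

variable {K Ω D : Type} [Order.Frame Ω] [Str K Ω D]

/-- `G` interprets the function symbols in `M`. -/
def IsStruct (C M G : D) : Ω :=
  ⨅ m, m ∈ᵢ om ⇨ ⨅ f, ⨅ w, SymIn C m f ⊓ IsFun w m M ⇨
    ⨆ y, y ∈ᵢ M ⊓ ⨅ z, op (op f w) z ∈ᵢ G ⇔ᵢ z =ᵢ y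

/-- `H` is the evaluation of terms. -/
def IsEval (C M G H : D) : Ω :=
  ⨅ k, k ∈ᵢ om ⇨ ⨅ e, IsFun e k M ⇨
    (⨅ i, i ∈ᵢ k ⇨ ⨅ v, op (op (tg 0 i) e) v ∈ᵢ H ⇔ᵢ op i v ∈ᵢ e) ⊓
    (⨅ m, m ∈ᵢ om ⇨ ⨅ f, ⨅ l, SymIn C m f ⊓ TmSeqIn C k m l ⇨
      ⨅ v, op (op (tg 1 (op f l)) e) v ∈ᵢ H ⇔ᵢ
        ⨆ w, IsFun w m M ⊓ ((⨅ j, j ∈ᵢ m ⇨ ⨅ t, ⨅ y,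
          op j t ∈ᵢ l ⊓ op j y ∈ᵢ w ⇨ op (op t e) y ∈ᵢ H) ⊓ op (op f w) v ∈ᵢ G))

/-- `T` is the satisfaction relation. -/
def IsSat (C M E Q H T : D) : Ω :=
  ⨅ k, k ∈ᵢ om ⇨ ⨅ e, IsFun e k M ⇨
    (⨅ t, ⨅ s, TmIn C k t ⊓ TmIn C k s ⇨
      (op (tg 0 (op t s)) e ∈ᵢ T ⇔ᵢ ⨆ x, ⨆ y,
        op (op t e) x ∈ᵢ H ⊓ (op (op s e) y ∈ᵢ H ⊓ op x y ∈ᵢ E)) ⊓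
      (op (tg 1 (op t s)) e ∈ᵢ T ⇔ᵢ ⨆ x, ⨆ y,
        op (op t e) x ∈ᵢ H ⊓ (op (op s e) y ∈ᵢ H ⊓ op x y ∈ᵢ Q))) ⊓
    ((op (tg 2 emp) e ∈ᵢ T ⇔ᵢ ⊥) ⊓
    ((⨅ p, ⨅ q, FmIn C k p ⊓ FmIn C k q ⇨
      (op (tg 3 (op p q)) e ∈ᵢ T ⇔ᵢ op p e ∈ᵢ T ⊓ op q e ∈ᵢ T) ⊓
      ((op (tg 4 (op p q)) e ∈ᵢ T ⇔ᵢ op p e ∈ᵢ T ⊔ op q e ∈ᵢ T) ⊓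
      (op (tg 5 (op p q)) e ∈ᵢ T ⇔ᵢ (op p e ∈ᵢ T ⇨ op q e ∈ᵢ T)))) ⊓
    (⨅ p, FmIn C (sc k) p ⇨
      (op (tg 6 p) e ∈ᵢ T ⇔ᵢ ⨅ x, x ∈ᵢ M ⇨ op p (ext e k x) ∈ᵢ T) ⊓
      (op (tg 7 p) e ∈ᵢ T ⇔ᵢ ⨆ x, x ∈ᵢ M ⊓ op p (ext e k x) ∈ᵢ T))))

/-- The Leibniz axioms are satisfied. -/
def SatLeibniz (C M Q T : D) : Ω :=
  ⨅ k, k ∈ᵢ om ⇨ ⨅ p, ⨅ f, FmIn C (sc k) p ⊓ IsFun f k M ⇨ ⨅ a, a ∈ᵢ M ⇨ ⨅ b, b ∈ᵢ M ⇨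
    op a b ∈ᵢ Q ⊓ op p (ext f k a) ∈ᵢ T ⇨ op p (ext f k b) ∈ᵢ T

/-- The Separation axioms are satisfied. -/
def SatSep (C M E G T : D) : Ω :=
  ⨅ k, k ∈ᵢ om ⇨ ⨅ p, ⨅ f, FmIn C (sc k) p ⊓ IsFun f k M ⇨ ⨅ a, a ∈ᵢ M ⇨ ⨅ c, c ∈ᵢ M ⇨
    ⨅ s, op (op (tg 5 p) (ext f k a)) s ∈ᵢ G ⇨
      (op c s ∈ᵢ E ⇔ᵢ op c a ∈ᵢ E ⊓ op p (ext f k c) ∈ᵢ T)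

/-- The Replacement axioms are satisfied. -/
def SatRepl (C M E Q G T : D) : Ω :=
  ⨅ k, k ∈ᵢ om ⇨ ⨅ p, ⨅ f, FmIn C (sc (sc k)) p ⊓ IsFun f k M ⇨ ⨅ a, a ∈ᵢ M ⇨ ⨅ c, c ∈ᵢ M ⇨
    ⨅ r, op (op (tg 6 p) (ext f k a)) r ∈ᵢ G ⇨
      (op c r ∈ᵢ E ⇔ᵢ
        (⨅ x, x ∈ᵢ M ⇨ op x a ∈ᵢ E ⇨ ⨆ y, y ∈ᵢ M ⊓ (op p (ext (ext f k x) (sc k) y) ∈ᵢ T ⊓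
          ⨅ z, z ∈ᵢ M ⇨ op p (ext (ext f k x) (sc k) z) ∈ᵢ T ⇨ op z y ∈ᵢ Q)) ⊓
        ⨆ x, x ∈ᵢ M ⊓ (op x a ∈ᵢ E ⊓ op p (ext (ext f k x) (sc k) c) ∈ᵢ T))

/-- The Induction axioms are satisfied. -/
def SatInd (C M E T : D) : Ω :=
  ⨅ k, k ∈ᵢ om ⇨ ⨅ p, ⨅ f, FmIn C (sc k) p ⊓ IsFun f k M ⇨
    (⨅ a, a ∈ᵢ M ⇨ (⨅ b, b ∈ᵢ M ⇨ op b a ∈ᵢ E ⇨ op p (ext f k b) ∈ᵢ T) ⇨ op p (ext f k a) ∈ᵢ T) ⇨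
      ⨅ a, a ∈ᵢ M ⇨ op p (ext f k a) ∈ᵢ T

/-- The sentences of the list `A` are satisfied. -/
def SatAll (T : D) : List (Fm Empty 0) → Ω
  | [] => ⊥ ⇨ ⊥
  | φ :: A => op φ.cd emp ∈ᵢ T ⊓ SatAll T A

/-- `(M, E, Q, G)` is a model of `IZF_R` and of the sentences of the list `A`. -/
def IsModelOf (A : List (Fm Empty 0)) (C M E Q G : D) : Ω :=
  IsStruct C M G ⊓ ⨆ H, IsEval C M G H ⊓ ⨆ T, IsSat C M E Q H T ⊓
    (SatAll T finAx ⊓ (SatLeibniz C M Q T ⊓ (SatSep C M E G T ⊓ (SatRepl C M E Q G T ⊓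
    (SatInd C M E T ⊓ SatAll T A)))))

/-- `M`, with the relations of the universe, is a model of `IZF_R` and of the sentences of `A`. -/
def SetModels (M : D) (A : List (Fm Empty 0)) : Ω :=
  ⨆ C, IsSyntax C ⊓ ⨆ E, ⨆ Q, ⨆ G,
    (⨅ x, x ∈ᵢ M ⇨ ⨅ y, y ∈ᵢ M ⇨ (op x y ∈ᵢ E ⇔ᵢ x ∈ᵢ y)) ⊓
    ((⨅ x, x ∈ᵢ M ⇨ ⨅ y, y ∈ᵢ M ⇨ (op x y ∈ᵢ Q ⇔ᵢ x =ᵢ y)) ⊓ IsModelOf A C M E Q G)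

variable [IsModelIZF D] {n : ℕ} (e : Fin n → D)

theorem eval_isStruct (C M G : Tm K n) :
    (isStruct C M G).eval e = IsStruct (C.eval e) (M.eval e) (G.eval e) := by
  simp only [isStruct, IsStruct, eval_ball, eval_allx, eval_bex, eval_imp, eval_and, eval_iff, eval_mem,
    eval_eq, eval_symIn, eval_isFun, eval_opT, eval_omegaT, Tm.eval_lift, eval_var_last]

theorem eval_isEval (C M G H : Tm K n) :
    (isEval C M G H).eval e = IsEval (C.eval e) (M.eval e) (G.eval e) (H.eval e) := by
  simp only [isEval, IsEval, eval_ball, eval_allx, eval_exx, eval_imp, eval_and, eval_iff,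
    eval_mem, eval_symIn, eval_tmSeqIn, eval_isFun, eval_opT, eval_tag, eval_omegaT,
    Tm.eval_lift, eval_var_last]

theorem eval_isSat (C M E Q H T : Tm K n) : (isSat C M E Q H T).eval e =
    IsSat (C.eval e) (M.eval e) (E.eval e) (Q.eval e) (H.eval e) (T.eval e) := by
  simp only [isSat, IsSat, eval_ball, eval_bex, eval_allx, eval_exx, eval_imp, eval_and, eval_or,
    eval_bot, eval_iff, eval_mem, eval_tmIn, eval_fmIn, eval_isFun, eval_opT, eval_tag, eval_extT,
    eval_sucT, eval_emptyT, eval_omegaT, Tm.eval_lift, eval_var_last]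

theorem eval_satLeibniz (C M Q T : Tm K n) : (satLeibniz C M Q T).eval e =
    SatLeibniz (C.eval e) (M.eval e) (Q.eval e) (T.eval e) := by
  simp only [satLeibniz, SatLeibniz, holds₁, eval_ball, eval_allx, eval_imp, eval_and,
    eval_mem, eval_fmIn, eval_isFun, eval_opT, eval_extT, eval_sucT, eval_omegaT, Tm.eval_lift,
    eval_var_last]

theorem eval_satSep (C M E G T : Tm K n) : (satSep C M E G T).eval e =
    SatSep (C.eval e) (M.eval e) (E.eval e) (G.eval e) (T.eval e) := by
  simp only [satSep, SatSep, holds₁, eval_ball, eval_allx, eval_imp, eval_and, eval_iff,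
    eval_mem, eval_fmIn, eval_isFun, eval_opT, eval_tag, eval_extT, eval_sucT, eval_omegaT,
    Tm.eval_lift, eval_var_last]

theorem eval_satRepl (C M E Q G T : Tm K n) : (satRepl C M E Q G T).eval e =
    SatRepl (C.eval e) (M.eval e) (E.eval e) (Q.eval e) (G.eval e) (T.eval e) := by
  simp only [satRepl, SatRepl, holds₂, eval_ball, eval_bex, eval_allx, eval_imp, eval_and, eval_iff,
    eval_mem, eval_fmIn, eval_isFun, eval_opT, eval_tag, eval_extT, eval_sucT, eval_omegaT,
    Tm.eval_lift, eval_var_last]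

theorem eval_satInd (C M E T : Tm K n) : (satInd C M E T).eval e =
    SatInd (C.eval e) (M.eval e) (E.eval e) (T.eval e) := by
  simp only [satInd, SatInd, holds₁, eval_ball, eval_allx, eval_imp, eval_and,
    eval_mem, eval_fmIn, eval_isFun, eval_opT, eval_extT, eval_sucT, eval_omegaT, Tm.eval_lift,
    eval_var_last]

theorem eval_satAll (T : Tm K n) (A : List (Fm Empty 0)) :
    (satAll T A).eval e = SatAll (T.eval e) A := by
  induction A with
  | nil => rfl
  | cons φ A ih =>
    simp only [satAll, SatAll, eval_and, eval_mem, eval_opT, eval_emptyT, Fm.eval_code, ih]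

theorem eval_isModel (A : List (Fm Empty 0)) (C M E Q G : Tm K n) : (isModel A C M E Q G).eval e =
    IsModelOf A (C.eval e) (M.eval e) (E.eval e) (Q.eval e) (G.eval e) := by
  simp only [isModel, IsModelOf, eval_and, eval_exx, eval_isStruct, eval_isEval, eval_isSat,
    eval_satLeibniz, eval_satSep, eval_satRepl, eval_satInd, eval_satAll, Tm.eval_lift, eval_var_last]

theorem eval_hasModel (A : List (Fm Empty 0)) (e : Fin 0 → D) : (hasModel A : Fm K 0).eval e =
    ⨆ C : D, IsSyntax C ⊓ ⨆ M, ⨆ E, ⨆ Q, ⨆ G, IsModelOf A C M E Q G := by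
  simp only [hasModel, eval_and, eval_exx, eval_isSyntax, eval_isModel, Tm.eval_lift, eval_var_last]

theorem eval_setModels (v : Tm K n) (A : List (Fm Empty 0)) :
    (setModels v A).eval e = SetModels (v.eval e) A := by
  simp only [setModels, SetModels, eval_and, eval_exx, eval_ball, eval_iff, eval_mem, eval_eq, eval_opT,
    eval_isSyntax, eval_isModel, Tm.eval_lift, eval_var_last]

theorem Forces.hasModel {u : Ω} {M : D} {A : List (Fm Empty 0)} (h : u ⊩ SetModels M A)
    (e : Fin 0 → D) : u ⊩ (IZF.hasModel A : Fm K 0).eval e := by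
  rw [eval_hasModel]
  exact h.bexE fun _ _ C hC h => .bex hC (h.exE fun _ _ E h => h.exE fun _ _ Q h => h.exE fun _ _ G h =>
    .ex M (.ex E (.ex Q (.ex G h.right.right))))

end ModelPredicates

/-! ## The model given by an inaccessible set -/

section Construction

variable {K Ω D : Type} [Order.Frame Ω] [Str K Ω D] [IsModelIZF D]

section Sets

variable (M : D)

/-- The evaluation of terms in `M`. -/
noncomputable def valSet : D :=
  sep (fun s => ⨆ r, ⨆ v, s =ᵢ op r v ⊓ ⨆ t, ⨆ e, r =ᵢ op t e ⊓ TmVal (evalSet M) t e v) M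

/-- The satisfaction relation of `M`. -/
noncomputable def truthSet : D :=
  sep (fun s => ⨆ p, ⨆ e, s =ᵢ op p e ⊓ Holds (evalSet M) p e) M

/-- The interpretation of the function symbols in `M`. -/
noncomputable def symSet : D :=
  sep (fun s => ⨆ r, ⨆ y, s =ᵢ op r y ⊓ ⨆ f, ⨆ w, r =ᵢ op f w ⊓ SymVal (evalSet M) f w y) M

/-- The value of the function symbol `f` at `w`. -/
noncomputable def symApp (f w : D) : D := sep (fun c => ElClause M f w c (evalSet M)) M

end Sets

variable {M : D} (hM : Inac M) {u : Ω} {a b c e f g k l m p q s t v w x y z : D}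

theorem mem_symApp (f w c : D) : c ∈ᵢ symApp M f w = c ∈ᵢ M ⊓ ElClause M f w c (evalSet M) :=
  mem_sep _ _ _

theorem symApp_congr (h : u ⊩ f =ᵢ g) : u ⊩ symApp M f w =ᵢ symApp M g w := by
  refine eqI (fun v _ c hc => ?_) fun v _ c hc => ?_ <;> rw [mem_symApp] at hc ⊢
  · exact hc.left.and (h.up.leib (fun f => ElClause M f w c (evalSet M)) hc.right)
  · exact hc.left.and (h.up.symm.leib (fun f => ElClause M f w c (evalSet M)) hc.right)

include hM

theorem Inac.op_mem_valSet (t e v : D) : op (op t e) v ∈ᵢ valSet M = TmVal (evalSet M) t e v := by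
  rw [valSet, mem_sep, iSup_op, iSup_op]
  refine inf_eq_right.2 ?_
  rw [hM.tmVal_eq]
  refine inf_le_left.trans (?_ : _ ⊩ _)
  have h := Forces.self (u := t ∈ᵢ M ⊓ tg 0 (op e v) ∈ᵢ M)
  have h' := hM.snd_mem h.right
  exact hM.op_mem (hM.op_mem h.left (hM.fst_mem h')) (hM.snd_mem h')

theorem Inac.op_mem_truthSet (p e : D) : op p e ∈ᵢ truthSet M = Holds (evalSet M) p e := by
  rw [truthSet, mem_sep, iSup_op]
  refine inf_eq_right.2 ?_
  rw [hM.holds_eq]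
  refine inf_le_left.trans (?_ : _ ⊩ _)
  have h := Forces.self (u := p ∈ᵢ M ⊓ tg 1 e ∈ᵢ M)
  exact hM.op_mem h.left (hM.snd_mem h.right)

theorem Inac.op_mem_symSet (f w y : D) : op (op f w) y ∈ᵢ symSet M = SymVal (evalSet M) f w y := by
  rw [symSet, mem_sep, iSup_op, iSup_op]
  refine inf_eq_right.2 ?_
  rw [hM.symVal]
  refine inf_le_left.trans (?_ : _ ⊩ _)
  have h := Forces.self (u := f ∈ᵢ M ⊓ tg 2 (op w y) ∈ᵢ M)
  have h' := hM.snd_mem h.right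
  exact hM.op_mem (hM.op_mem h.left (hM.fst_mem h')) (hM.snd_mem h')

theorem Inac.symVal_iff (hf : u ⊩ f ∈ᵢ M) (hw : u ⊩ w ∈ᵢ M) (y : D) :
    u ⊩ SymVal (evalSet M) f w y ↔ u ⊩ y ∈ᵢ M ⊓ y =ᵢ symApp M f w := by
  have : SymClause M f w y (evalSet M) = y ∈ᵢ M ⊓ y =ᵢ symApp M f w := by
    simp only [SymClause, eq_def, mem_symApp]
  rw [hM.symVal, this]
  exact ⟨fun h => h.right, fun h => .and (hf.and (hM.tg_op_mem hw h.left)) h⟩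

omit hM

/-! ### Values of the function symbols -/

theorem elClause_empty : ElClause M (tg 0 emp) w c s = ⊥ := by
  simp only [ElClause, tg_ne (show 0 ≠ 1 by decide), tg_ne (show 0 ≠ 2 by decide),
    tg_ne (show 0 ≠ 3 by decide), tg_ne (show 0 ≠ 4 by decide), tg_ne (show 0 ≠ 5 by decide),
    tg_ne (show 0 ≠ 6 by decide), bot_inf_eq, iSup_bot, sup_bot_eq]

theorem elClause_omega : ElClause M (tg 1 emp) w c s = c ∈ᵢ om := by
  simp only [ElClause, eq_self, tg_ne (show 1 ≠ 2 by decide),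
    tg_ne (show 1 ≠ 3 by decide), tg_ne (show 1 ≠ 4 by decide), tg_ne (show 1 ≠ 5 by decide),
    tg_ne (show 1 ≠ 6 by decide), bot_inf_eq, iSup_bot, sup_bot_eq, top_inf_eq]

theorem elClause_pair :
    ElClause M (tg 2 emp) w c s = op (nm 0) c ∈ᵢ w ⊔ op (nm 1) c ∈ᵢ w := by
  simp only [ElClause, eq_self, tg_ne (show 2 ≠ 1 by decide),
    tg_ne (show 2 ≠ 3 by decide), tg_ne (show 2 ≠ 4 by decide), tg_ne (show 2 ≠ 5 by decide),
    tg_ne (show 2 ≠ 6 by decide), bot_inf_eq, iSup_bot, sup_bot_eq, bot_sup_eq, top_inf_eq]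

theorem elClause_union : ElClause M (tg 3 emp) w c s =
    ⨆ a, op (nm 0) a ∈ᵢ w ⊓ ⨆ b, b ∈ᵢ a ⊓ c ∈ᵢ b := by
  simp only [ElClause, eq_self, tg_ne (show 3 ≠ 1 by decide),
    tg_ne (show 3 ≠ 2 by decide), tg_ne (show 3 ≠ 4 by decide), tg_ne (show 3 ≠ 5 by decide),
    tg_ne (show 3 ≠ 6 by decide), bot_inf_eq, iSup_bot, sup_bot_eq, bot_sup_eq, top_inf_eq]

theorem elClause_power : ElClause M (tg 4 emp) w c s =
    ⨆ a, op (nm 0) a ∈ᵢ w ⊓ ⨅ b, b ∈ᵢ c ⇨ b ∈ᵢ a := by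
  simp only [ElClause, eq_self, tg_ne (show 4 ≠ 1 by decide),
    tg_ne (show 4 ≠ 2 by decide), tg_ne (show 4 ≠ 3 by decide), tg_ne (show 4 ≠ 5 by decide),
    tg_ne (show 4 ≠ 6 by decide), bot_inf_eq, iSup_bot, sup_bot_eq, bot_sup_eq, top_inf_eq]

theorem elClause_sep : ElClause M (tg 5 p) w c s = SepClause M s p w c := by
  simp only [ElClause, iSup_tg, tg_ne (show 5 ≠ 1 by decide),
    tg_ne (show 5 ≠ 2 by decide), tg_ne (show 5 ≠ 3 by decide), tg_ne (show 5 ≠ 4 by decide),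
    tg_ne (show 5 ≠ 6 by decide), bot_inf_eq, iSup_bot, sup_bot_eq, bot_sup_eq]

theorem elClause_repl : ElClause M (tg 6 p) w c s = ReplClause M s p w c := by
  simp only [ElClause, iSup_tg, tg_ne (show 6 ≠ 1 by decide),
    tg_ne (show 6 ≠ 2 by decide), tg_ne (show 6 ≠ 3 by decide), tg_ne (show 6 ≠ 4 by decide),
    tg_ne (show 6 ≠ 5 by decide), bot_inf_eq, iSup_bot, bot_sup_eq]

theorem sepClause_iff (hk : u ⊩ k ∈ᵢ om) (hf : u ⊩ IsFun f k M) (ha : u ⊩ a ∈ᵢ M) :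
    u ⊩ SepClause M s p (ext f k a) c ↔ u ⊩ c ∈ᵢ a ⊓ Holds s p (ext f k c) := by
  refine ⟨fun h => ?_, fun h => .bex hk (.bex hf (.bex ha (eq_rfl.and h)))⟩
  refine h.bexE fun v _ k' hk' h => h.bexE fun v _ f' hf' h => h.bexE fun v _ a' ha' h => ?_
  obtain ⟨e1, e2, e3⟩ := ext_inj hf.up ha.up hf'.up ha' h.left
  exact e1.symm.leib (fun f => c ∈ᵢ a ⊓ Holds s p (ext f k c))
    (e2.symm.leib (fun k => c ∈ᵢ a ⊓ Holds s p (ext f' k c))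
      (e3.symm.leib (fun a => c ∈ᵢ a ⊓ Holds s p (ext f' k' c)) h.right))

theorem replClause_iff (hk : u ⊩ k ∈ᵢ om) (hf : u ⊩ IsFun f k M) (ha : u ⊩ a ∈ᵢ M) :
    u ⊩ ReplClause M s p (ext f k a) c ↔ u ⊩ ReplCond M s p k f a ⊓
      ⨆ x, x ∈ᵢ M ⊓ (op x a ∈ᵢ elRel M ⊓ Holds s p (ext (ext f k x) (sc k) c)) := by
  refine ⟨fun h => ?_, fun h => .bex hk (.bex hf (.bex ha (eq_rfl.and h)))⟩
  refine h.bexE fun v _ k' hk' h => h.bexE fun v _ f' hf' h => h.bexE fun v _ a' ha' h => ?_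
  obtain ⟨e1, e2, e3⟩ := ext_inj hf.up ha.up hf'.up ha' h.left
  exact e1.symm.leib (fun f => ReplCond M s p k f a ⊓
      ⨆ x, x ∈ᵢ M ⊓ (op x a ∈ᵢ elRel M ⊓ Holds s p (ext (ext f k x) (sc k) c)))
    (e2.symm.leib (fun k => ReplCond M s p k f' a ⊓
        ⨆ x, x ∈ᵢ M ⊓ (op x a ∈ᵢ elRel M ⊓ Holds s p (ext (ext f' k x) (sc k) c)))
      (e3.symm.leib (fun a => ReplCond M s p k' f' a ⊓
        ⨆ x, x ∈ᵢ M ⊓ (op x a ∈ᵢ elRel M ⊓ Holds s p (ext (ext f' k' x) (sc k') c))) h.right))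

theorem mem_un_un (h : u ⊩ op x y ∈ᵢ w) : u ⊩ y ∈ᵢ un (un w) := by
  rw [mem_un]
  refine .bex (x := pr x y) ?_ mem_pr_right
  rw [mem_un]
  exact .bex h mem_pr_right

theorem mem_unI (h : u ⊩ x ∈ᵢ y) (h' : u ⊩ y ∈ᵢ w) : u ⊩ x ∈ᵢ un w := by
  rw [mem_un]
  exact .bex h' h

include hM

theorem Inac.op_mem_elRel (hy : u ⊩ y ∈ᵢ M) : u ⊩ op x y ∈ᵢ elRel M ↔ u ⊩ x ∈ᵢ y := by
  rw [IZF.op_mem_elRel]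
  exact ⟨fun h => h.right, fun h => (hM.op_mem (hM.trans h hy) hy).and h⟩

theorem Inac.op_mem_eqRel (hx : u ⊩ x ∈ᵢ M) (hy : u ⊩ y ∈ᵢ M) :
    u ⊩ op x y ∈ᵢ eqRel M ↔ u ⊩ x =ᵢ y := by
  rw [IZF.op_mem_eqRel]
  exact ⟨fun h => h.right, fun h => (hM.op_mem hx hy).and h⟩

theorem Inac.symApp_repl_mem (hk : u ⊩ k ∈ᵢ om) (hw : u ⊩ IsFun w (sc k) M) :
    u ⊩ symApp M (tg 6 p) w ∈ᵢ M := by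
  refine (exists_ext hw).bexE fun v _ f hf h => h.bexE fun v _ a ha ew => ?_
  let a' := sep (fun _ => ReplCond M (evalSet M) p k f a) a
  have ha' : ∀ x, x ∈ᵢ a' = x ∈ᵢ a ⊓ ReplCond M (evalSet M) p k f a := fun x => mem_sep _ _ _
  have ha'M : v ⊩ a' ∈ᵢ M := hM.sub_mem ha fun v _ c hc => by
    rw [ha'] at hc
    exact hc.left
  refine hM.range_mem (fun x y => Holds (evalSet M) p (ext (ext f k x) (sc k) y)) ha'M
    (fun v _ x hx => ?_) (fun v _ x y z hx hy hz hxy hxz => ?_) fun v _ c hc => ?_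
  · rw [ha'] at hx
    have := (hx.right.ball (hM.trans hx.left ha.up)).mp ((hM.op_mem_elRel ha.up).2 hx.left)
    exact this.bexE fun v _ y hy h => .bex hy h.left
  · rw [ha'] at hx
    have := (hx.right.ball (hM.trans hx.left ha.up)).mp ((hM.op_mem_elRel ha.up).2 hx.left)
    refine this.bexE fun v _ y' hy' h => ?_
    have h1 := (hM.op_mem_eqRel hy.up hy').1 ((h.right.ball (v := v) hy.up).mp hxy.up)
    have h2 := (hM.op_mem_eqRel hz.up hy').1 ((h.right.ball (v := v) hz.up).mp hxz.up)
    exact h2.trans h1.symm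
  · rw [mem_symApp, elClause_repl] at hc
    have := ew.up.leib (fun w => ReplClause M (evalSet M) p w c) hc.right
    rw [replClause_iff hk.up hf.up ha.up] at this
    refine hc.left.and (this.right.bexE fun v _ x hx h => .bex ?_ h.right)
    rw [ha']
    exact ((hM.op_mem_elRel ha.up).1 h.left).and this.left.up

theorem Inac.symApp_mem (hf : u ⊩ SymIn (synSet M) m f) (hm : u ⊩ m ∈ᵢ om) (hw : u ⊩ IsFun w m M) :
    u ⊩ symApp M f w ∈ᵢ M := by
  have hwM := hM.fun_mem (hM.om_sub hm) hw
  have hf' := hM.symForm hf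
  have bound : ∀ {v : Ω} {f' b : D}, v ≤ u → v ⊩ f =ᵢ f' → v ⊩ b ∈ᵢ M →
      (∀ v' ≤ v, ∀ c, v' ⊩ ElClause M f' w c (evalSet M) → v' ⊩ c ∈ᵢ b) → v ⊩ symApp M f w ∈ᵢ M := by
    intro v f' b hv ef hb h
    refine hM.sub_mem hb fun v' e c hc => h v' e.le c ?_
    rw [mem_symApp] at hc
    exact ef.up.leib (fun f => ElClause M f w c (evalSet M)) hc.right
  refine hf'.orE (fun v e h => ?_) fun v _ h => h.orE (fun v _ h => ?_) fun v _ h =>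
    h.orE (fun v _ h => ?_) fun v _ h => h.orE (fun v _ h => ?_) fun v _ h =>
    h.orE (fun v _ h => ?_) fun v _ h => h.orE (fun v _ h => ?_) fun v _ h => ?_
  · refine bound Below.le h.right hM.emp_mem fun v' hv c hc => ?_
    rw [elClause_empty] at hc
    exact hc.elim
  · refine bound Below.le h.right hM.om_mem fun v' hv c hc => ?_
    rwa [elClause_omega] at hc
  · refine bound Below.le h.right (hM.un_mem (hM.un_mem hwM.up)) fun v' hv c hc => ?_
    rw [elClause_pair] at hc
    exact hc.orE (fun _ _ h => mem_un_un h) fun _ _ h => mem_un_un h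
  · refine bound Below.le h.right (hM.un_mem (hM.un_mem (hM.un_mem (hM.un_mem hwM.up))))
      fun v' hv c hc => ?_
    rw [elClause_union] at hc
    exact hc.bexE fun _ _ a ha h => h.bexE fun _ _ b hb h =>
      mem_unI h (mem_unI hb (mem_un_un ha.up))
  · refine bound Below.le h.right (hM.pw_mem (hM.un_mem (hM.un_mem (hM.un_mem hwM.up))))
      fun v' hv c hc => ?_
    rw [elClause_power] at hc
    refine hc.bexE fun _ _ a ha h => ?_
    rw [mem_pw]
    exact ballI fun _ _ b hb => mem_unI (h.ball hb) (mem_un_un ha.up)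
  · refine h.bexE fun v _ k hk h => h.bexE fun v _ p hp h => ?_
    refine bound Below.le h.right (hM.un_mem (hM.un_mem (hM.un_mem hwM.up))) fun v' hv c hc => ?_
    rw [elClause_sep] at hc
    refine hc.bexE fun _ _ k hk h => h.bexE fun _ _ f hf h => h.bexE fun _ _ a ha h => ?_
    refine mem_unI h.right.left (mem_un_un (x := k) ?_)
    refine Forces.mem_right ?_ h.left.symm
    rw [mem_ext]
    exact .inr eq_rfl
  · refine h.bexE fun v _ k hk h => h.bexE fun v _ p hp h => ?_
    refine Forces.mem_left ?_ (symApp_congr h.right).symm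
    exact hM.symApp_repl_mem hk.up (h.left.leib (fun m => IsFun w m M) hw.up)

end Construction

section ConstructionProperties

variable {K Ω D : Type} [Order.Frame Ω] [Str K Ω D] [IsModelIZF D]
variable {M : D} (hM : Inac M) {u : Ω}

include hM

theorem Inac.isStruct : u ⊩ IsStruct (synSet M) M (symSet M) := by
  refine ballI fun v _ m hm => .all fun f => ballI fun v _ w h => ?_
  refine .bex (x := symApp M f w) (hM.symApp_mem h.left hm.up h.right) (.all fun z => ?_)
  rw [hM.op_mem_symSet]
  have hf := hM.of_tg_op h.left
  have hw := hM.fun_mem (hM.om_sub hm.up) h.right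
  have happ := hM.symApp_mem h.left hm.up h.right
  refine iffI (fun v _ hz => ((hM.symVal_iff hf.up hw.up z).1 hz).right) fun v _ hz =>
    (hM.symVal_iff hf.up hw.up z).2 (.and ?_ hz)
  exact happ.up.mem_left hz.symm

theorem Inac.isEval : u ⊩ IsEval (synSet M) M (symSet M) (valSet M) := by
  refine ballI fun v _ k hk => ballI fun v _ e he => ?_
  replace hk := hk.up (v := v)
  have heM := hM.fun_mem (hM.om_sub hk) he
  refine Forces.and (ballI fun v _ i hi => .all fun a => ?_) (ballI fun v _ m hm => .all fun f =>
    ballI fun v _ l h => .all fun a => ?_)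
  · rw [hM.op_mem_valSet, hM.tmVal_var]
    refine iffI (fun _ _ h => h.right) fun v _ h => .and (.and ?_ ?_) h
    · exact hM.tg_mem (hM.trans hi.up (hM.om_sub hk.up))
    · exact hM.tg_op_mem heM.up (he.up.fun_cod h)
  · simp only [hM.op_mem_valSet, hM.op_mem_symSet]
    replace hm := hm.up (v := v)
    have hl := hM.tmSeq_isFun h.right
    have hlM := hM.tmSeq_mem hm h.right
    rw [hM.tmVal_app]
    refine iffI (fun v _ ha => ?_) fun v _ ha => .and (.and ?_ ?_) (.bex hm.up (hl.up.and ha))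
    · refine ha.right.bexE fun v _ m' hm' h' => ?_
      exact (dom_unique h'.left hl.up).leib (fun m => ⨆ w, IsFun w m M ⊓
        (ArgVal (evalSet M) l e m w ⊓ SymVal (evalSet M) f w a)) h'.right
    · exact hM.tg_op_mem (hM.of_tg_op h.left.up) hlM.up
    · refine hM.tg_op_mem heM.up (ha.bexE fun v _ w hw h => ?_)
      have := h.right
      rw [hM.symVal] at this
      exact this.right.left

theorem Inac.isSat :
    u ⊩ IsSat (synSet M) M (elRel M) (eqRel M) (valSet M) (truthSet M) := by
  refine ballI fun v _ k hk => ballI fun v _ e he => ?_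
  replace hk := hk.up (v := v)
  have heM : v ⊩ tg 1 e ∈ᵢ M := hM.tg_mem (hM.fun_mem (hM.om_sub hk) he)
  simp only [hM.op_mem_valSet, hM.op_mem_truthSet]
  have aux : ∀ {v' : Ω} {x : D} {q : Ω}, v' ≤ v → Holds (evalSet M) x e = (x ∈ᵢ M ⊓ tg 1 e ∈ᵢ M) ⊓ q →
      v' ⊩ x ∈ᵢ M → v' ⊩ Holds (evalSet M) x e ⇔ᵢ q := by
    intro v' x q hv h hx
    rw [h]
    exact iffI (fun _ _ h => h.right) fun w e h => (hx.up.and ((heM.mono hv).mono e.le)).and h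
  refine Forces.and (.all fun t => ballI fun v _ s h => ?_) (Forces.and ?_ (Forces.and
    (.all fun p => ballI fun v _ q h => ?_) (ballI fun v _ p hp => ?_)))
  · have h' : ∀ i : ℕ, v ⊩ tg i (op t s) ∈ᵢ M := fun i =>
      hM.tg_op_mem (hM.of_tg_op h.left) (hM.of_tg_op h.right)
    exact .and (aux Below.le (hM.holds_mem t s e) (h' _))
      (aux Below.le (hM.holds_eqT t s e) (h' _))
  · rw [hM.holds_bot]
    exact bi_rfl
  · have h' : ∀ i : ℕ, v ⊩ tg i (op p q) ∈ᵢ M := fun i =>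
      hM.tg_op_mem (hM.of_tg_op h.left) (hM.of_tg_op h.right)
    exact .and (aux Below.le (hM.holds_and p q e) (h' _))
      (.and (aux Below.le (hM.holds_or p q e) (h' _))
        (aux Below.le (hM.holds_imp p q e) (h' _)))
  · have h' : ∀ i : ℕ, v ⊩ tg i p ∈ᵢ M := fun i => hM.tg_mem (hM.of_tg_op hp)
    have h1 := aux Below.le (hM.holds_all p e) (h' _)
    have h2 := aux Below.le (hM.holds_ex p e) (h' _)
    refine .and (iffI (fun v _ h => ?_) fun v _ h => ?_) (iffI (fun v _ h => ?_) fun v _ h => ?_)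
    · refine (h1.left.mp h).bexE fun v _ k' hk' h => ?_
      exact (dom_unique h.left he.up).leib
        (fun k => ⨅ x, x ∈ᵢ M ⇨ Holds (evalSet M) p (ext e k x)) h.right
    · exact h1.right.mp (.bex hk.up (he.up.and h))
    · refine (h2.left.mp h).bexE fun v _ k' hk' h => ?_
      exact (dom_unique h.left he.up).leib
        (fun k => ⨆ x, x ∈ᵢ M ⊓ Holds (evalSet M) p (ext e k x)) h.right
    · exact h2.right.mp (.bex hk.up (he.up.and h))

theorem Inac.satLeibniz : u ⊩ SatLeibniz (synSet M) M (eqRel M) (truthSet M) := by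
  refine ballI fun v _ k hk => .all fun p => ballI fun v _ f hf => ballI fun v _ a ha =>
    ballI fun v _ b hb => impI fun v _ h => ?_
  exact ((hM.op_mem_eqRel ha.up hb.up).1 h.left).leib (fun a => op p (ext f k a) ∈ᵢ truthSet M) h.right

theorem Inac.satSep : u ⊩ SatSep (synSet M) M (elRel M) (symSet M) (truthSet M) := by
  refine ballI fun v _ k hk => .all fun p => ballI fun v _ f hf => ballI fun v _ a ha =>
    ballI fun v _ c hc => ballI fun v _ s hs => ?_
  rw [hM.op_mem_symSet, hM.symVal] at hs
  have hsM := hs.right.left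
  have h := hs.right.right.at c
  rw [elClause_sep] at h
  rw [hM.op_mem_truthSet]
  have hk' := hk.up (v := v)
  have hf' := hf.right.up (v := v)
  have ha' := ha.up (v := v)
  refine iffI (fun v _ h' => ?_) fun v _ h' => ?_
  · rw [hM.op_mem_elRel hsM.up] at h'
    have := (sepClause_iff hk'.up hf'.up ha'.up).1 (h.left.mp h').right
    exact ((hM.op_mem_elRel ha'.up).2 this.left).and this.right
  · rw [hM.op_mem_elRel hsM.up]
    refine h.right.mp (hc.up.and ((sepClause_iff hk'.up hf'.up ha'.up).2 ?_))
    exact ((hM.op_mem_elRel ha'.up).1 h'.left).and h'.right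

theorem Inac.satRepl : u ⊩ SatRepl (synSet M) M (elRel M) (eqRel M) (symSet M) (truthSet M) := by
  refine ballI fun v _ k hk => .all fun p => ballI fun v _ f hf => ballI fun v _ a ha =>
    ballI fun v _ c hc => ballI fun v _ s hs => ?_
  rw [hM.op_mem_symSet, hM.symVal] at hs
  have hsM := hs.right.left
  have h := hs.right.right.at c
  rw [elClause_repl] at h
  simp only [hM.op_mem_truthSet]
  have hk' := hk.up (v := v)
  have hf' := hf.right.up (v := v)
  have ha' := ha.up (v := v)
  refine iffI (fun v _ h' => ?_) fun v _ h' => ?_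
  · rw [hM.op_mem_elRel hsM.up] at h'
    exact (replClause_iff hk'.up hf'.up ha'.up).1 (h.left.mp h').right
  · rw [hM.op_mem_elRel hsM.up]
    exact h.right.mp (hc.up.and ((replClause_iff hk'.up hf'.up ha'.up).2 h'))

theorem Inac.satInd : u ⊩ SatInd (synSet M) M (elRel M) (truthSet M) := by
  refine ballI fun v _ k hk => .all fun p => ballI fun v _ f hf => impI fun v _ h => .all fun a => ?_
  refine induction (fun a => a ∈ᵢ M ⇨ op p (ext f k a) ∈ᵢ truthSet M) (fun v _ a ih =>
    impI fun v _ ha => (h.ball ha).mp (ballI fun v _ b hb => impI fun v _ hba => ?_)) a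
  exact (ih.ball ((hM.op_mem_elRel ha.up).1 hba)).mp hb.up

theorem Inac.setModels {A : List (Fm Empty 0)} (hfin : u ⊩ SatAll (truthSet M) finAx)
    (hA : u ⊩ SatAll (truthSet M) A) : u ⊩ SetModels M A := by
  refine .bex (x := synSet M) hM.isSyntax (.ex (elRel M) (.ex (eqRel M) (.ex (symSet M) (.and
    (ballI fun v _ x hx => ballI fun v _ y hy => ?_) (.and
    (ballI fun v _ x hx => ballI fun v _ y hy => ?_) (hM.isStruct.and
    (.bex (x := valSet M) hM.isEval (.bex (x := truthSet M) hM.isSat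
    (hfin.and (hM.satLeibniz.and (hM.satSep.and (hM.satRepl.and (hM.satInd.and hA)))))))))))))
  · exact iffI (fun _ _ => (hM.op_mem_elRel hy.up).1) fun _ _ => (hM.op_mem_elRel hy.up).2
  · exact iffI (fun _ _ => (hM.op_mem_eqRel hx.up hy.up).1)
      fun _ _ => (hM.op_mem_eqRel hx.up hy.up).2

end ConstructionProperties

/-! ## The inner structure of an inaccessible set -/

section InnerStructure

variable {K Ω D : Type} [Order.Frame Ω] [Str K Ω D] [IsModelIZF D] {M : D}

/-- The global elements of `M`. -/
structure Inner (hM : Inac M) where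
  val : D
  mem : ∀ u : Ω, u ⊩ val ∈ᵢ M

variable (hM : Inac M)

theorem Inac.symApp_mem_of_symbol {m : ℕ} (f : Sym Empty m) (w : Fin m → Inner hM) (u : Ω) :
    u ⊩ symApp M f.cd (seq fun j => (w j).1) ∈ᵢ M :=
  hM.symApp_mem (f.cd_mem hM u) (nm_mem_om m) (isFun_seq fun j => (w j).2 u)

/-- The interpretation of the function symbols in the inner structure. -/
noncomputable def Inner.fn : {m : ℕ} → Sym Empty m → (Fin m → Inner hM) → Inner hM
  | _, .const k, _ => k.elim
  | _, .empty, _ => ⟨emp, fun _ => hM.emp_mem⟩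
  | _, .omega, _ => ⟨om, fun _ => hM.om_mem⟩
  | _, .pair, w => ⟨pr (w 0).1 (w 1).1, fun u => hM.pr_mem ((w 0).2 u) ((w 1).2 u)⟩
  | _, .union, w => ⟨un (w 0).1, fun u => hM.un_mem ((w 0).2 u)⟩
  | _, .power, w => ⟨pw (w 0).1, fun u => hM.pw_mem ((w 0).2 u)⟩
  | _, .sep φ, w => ⟨_, hM.symApp_mem_of_symbol (.sep φ) w⟩
  | _, .repl φ, w => ⟨_, hM.symApp_mem_of_symbol (.repl φ) w⟩

noncomputable instance : Str Empty Ω (Inner hM) where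
  fn f w := Inner.fn hM f w
  mem a b := a.1 ∈ᵢ b.1
  eq a b := a.1 =ᵢ b.1

variable {hM}

theorem Inner.seq_mem {n : ℕ} (e : Fin n → Inner hM) (u : Ω) : u ⊩ seq (fun j => (e j).1) ∈ᵢ M :=
  hM.seq_mem fun j => (e j).2 u

theorem seq_esnoc {n : ℕ} (e : Fin n → Inner hM) (x : Inner hM) :
    seq (fun j => (esnoc e x j).1) = ext (seq fun j => (e j).1) (nm n) x.1 := by
  simp [seq]

theorem eq_of_mem_eq {a b : D} {u : Ω} (h : ∀ c, c ∈ᵢ a = c ∈ᵢ b) : u ⊩ a =ᵢ b :=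
  eqI (fun _ _ c hc => h c ▸ hc) fun _ _ c hc => h c ▸ hc

theorem Inner.mem_inf (a : Inner hM) (c : D) : c ∈ᵢ M ⊓ c ∈ᵢ a.1 = c ∈ᵢ a.1 :=
  inf_eq_right.2 (hM.trans Forces.self (a.2 _))

theorem op_zero_mem_seq {m : ℕ} (w : Fin (m + 1) → D) (c : D) : op (nm 0) c ∈ᵢ seq w = c =ᵢ w 0 :=
  op_mem_seq w 0 c

theorem op_one_mem_seq {m : ℕ} (w : Fin (m + 2) → D) (c : D) : op (nm 1) c ∈ᵢ seq w = c =ᵢ w 1 :=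
  op_mem_seq w 1 c

theorem Inner.fn_eq {u : Ω} : {m : ℕ} → (f : Sym Empty m) → (w : Fin m → Inner hM) →
    u ⊩ (Str.fn f w).1 =ᵢ symApp M f.cd (seq fun j => (w j).1)
  | _, .const k, _ => k.elim
  | _, .empty, _ => eq_of_mem_eq fun c => by
      rw [mem_symApp, Sym.cd, elClause_empty, inf_bot_eq]
      exact mem_emp c
  | _, .omega, w => eq_of_mem_eq fun c => by
      rw [mem_symApp, Sym.cd, elClause_omega]
      exact (Inner.mem_inf (Str.fn .omega w) c).symm
  | _, .pair, w => eq_of_mem_eq fun c => by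
      rw [mem_symApp, Sym.cd, elClause_pair, op_zero_mem_seq, op_one_mem_seq, ← mem_pr]
      exact (Inner.mem_inf (Str.fn .pair w) c).symm
  | _, .union, w => eq_of_mem_eq fun c => by
      rw [mem_symApp, Sym.cd, elClause_union]
      simp only [op_zero_mem_seq]
      rw [iSup_eq_inf, ← mem_un]
      exact (Inner.mem_inf (Str.fn .union w) c).symm
  | _, .power, w => eq_of_mem_eq fun c => by
      rw [mem_symApp, Sym.cd, elClause_power]
      simp only [op_zero_mem_seq]
      rw [iSup_eq_inf, ← mem_pw]
      exact (Inner.mem_inf (Str.fn .power w) c).symm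
  | _, .sep _, _ => eq_rfl
  | _, .repl _, _ => eq_rfl

/-! ### Quantifiers -/

variable (hM) in
theorem Inac.iInf_inner (P : D → Ω) [Def P] : (⨅ x, x ∈ᵢ M ⇨ P x) = ⨅ x : Inner hM, P x.1 := by
  refine eq_of_forces (fun u h => .all fun x => h.ball (x.2 u)) fun u h => ballI fun v _ x hx => ?_
  obtain ⟨r, hr, hxr⟩ := hM.exists_retract x
  exact (hxr v hx).symm.leib P (h.at (⟨r, hr⟩ : Inner hM)).up

variable (hM) in
theorem Inac.iSup_inner (P : D → Ω) [Def P] : (⨆ x, x ∈ᵢ M ⊓ P x) = ⨆ x : Inner hM, P x.1 := by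
  refine eq_of_forces (fun u h => h.bexE fun v _ x hx h => ?_) fun u h =>
    h.exE fun v _ x h => .bex (x.2 v) h
  obtain ⟨r, hr, hxr⟩ := hM.exists_retract x
  exact .ex (⟨r, hr⟩ : Inner hM) ((hxr v hx).leib P h)

theorem Inner.iInf_mem (a : Inner hM) (P : D → Ω) [Def P] :
    (⨅ x, x ∈ᵢ a.1 ⇨ P x) = ⨅ x : Inner hM, x ∈ᵢ a ⇨ P x.1 := by
  refine Eq.trans (iInf_congr fun x => ?_) (hM.iInf_inner fun x => x ∈ᵢ a.1 ⇨ P x)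
  rw [himp_himp, a.mem_inf]

theorem Inner.iSup_mem (a : Inner hM) (P : D → Ω) [Def P] :
    (⨆ x, x ∈ᵢ a.1 ⊓ P x) = ⨆ x : Inner hM, x ∈ᵢ a ⊓ P x.1 := by
  refine Eq.trans (iSup_congr fun x => ?_) (hM.iSup_inner fun x => x ∈ᵢ a.1 ⊓ P x)
  rw [← inf_assoc, a.mem_inf]

theorem Inner.op_mem_elRel (a b : Inner hM) : op a.1 b.1 ∈ᵢ elRel M = a ∈ᵢ b :=
  forces_ext fun u => hM.op_mem_elRel (b.2 u)

theorem Inner.op_mem_eqRel (a b : Inner hM) : op a.1 b.1 ∈ᵢ eqRel M = a =ᵢ b :=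
  forces_ext fun u => hM.op_mem_eqRel (a.2 u) (b.2 u)

/-! ### Satisfaction in `M` and truth in the inner structure -/

theorem eq_of_bi {p q : Ω} (h : ∀ u, u ⊩ p ⇔ᵢ q) : p = q :=
  biimp_eq_top_iff.1 (eq_top_iff_forces.2 h)

theorem Inner.tmVal {n : ℕ} (e : Fin n → Inner hM) : (t : Tm Empty n) → (v : D) →
    TmVal (evalSet M) t.cd (seq fun j => (e j).1) v = v =ᵢ (t.eval e).1
  | .var i, v => by
    rw [Tm.cd, hM.tmVal_var, op_mem_seq]
    refine inf_eq_right.2 (?_ : _ ⊩ _)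
    refine .and (hM.tg_mem (hM.nm_mem i)) (hM.tg_op_mem (Inner.seq_mem e _) ?_)
    exact ((e i).2 _).mem_left Forces.self.symm
  | .app (m := m) f w, v => by
    have ih := fun j v => Inner.tmVal e (w j) v
    have hcd : ∀ (u : Ω) j, u ⊩ (w j).cd ∈ᵢ M := fun u j => hM.of_tg_op ((w j).cd_mem hM u)
    have hf : ∀ u : Ω, u ⊩ f.cd ∈ᵢ M := fun u => hM.of_tg_op (f.cd_mem hM u)
    have hval : ∀ u : Ω, u ⊩ SymVal (evalSet M) f.cd (seq fun j => ((w j).eval e).1) v ↔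
        u ⊩ v =ᵢ ((Tm.app f w).eval e).1 := fun u => by
      rw [hM.symVal_iff (hf u) (Inner.seq_mem _ u)]
      refine ⟨fun h => h.right.trans (Inner.fn_eq f _).symm, fun h => .and ?_ (h.trans (Inner.fn_eq f _))⟩
      exact (((Tm.app f w).eval e).2 u).mem_left h.symm
    rw [Tm.cd, hM.tmVal_app]
    refine eq_of_forces (fun u h => ?_) fun u h => .and (.and ?_ ?_) ?_
    · refine h.right.bexE fun u _ m' hm h => h.right.bexE fun u _ w' hw' h' => ?_
      have em : u ⊩ m' =ᵢ nm m := dom_unique h.left.up (isFun_seq (hcd u))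
      have hw : u ⊩ IsFun w' (nm m) M := em.leib (fun m => IsFun w' m M) hw'
      refine (hval u).1 (Forces.leib (fun w => SymVal (evalSet M) f.cd w v) (eq_seq hw fun j => ?_)
        h'.right)
      refine (hw.fun_value (nm_mem_nm j.2)).bexE fun u _ y hy hjy => ?_
      have hj : u ⊩ op (nm j) ((w j).cd : D) ∈ᵢ seq fun j => ((w j).cd : D) := by
        rw [op_mem_seq]
        exact eq_rfl
      have := ((h'.left.ball (v := u) ((nm_mem_nm j.2).mem_right em.up.symm)).at (w j).cd).ball (hj.and hjy)
      rw [ih] at this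
      exact hjy.mem_left (op_congr eq_rfl this)
    · exact hM.tg_op_mem (hf u) (hM.seq_mem (hcd u))
    · exact hM.tg_op_mem (Inner.seq_mem e u) ((((Tm.app f w).eval e).2 u).mem_left h.symm)
    · refine .bex (nm_mem_om m) (.and (isFun_seq (hcd u)) (.bex (isFun_seq fun j => ((w j).eval e).2 u)
        (.and (ballI fun u _ i hi => .all fun t => ballI fun u _ y h => ?_) ((hval u).2 h))))
      rw [mem_nm] at hi
      refine hi.exE fun u _ j hj => ?_
      have ht := h.left.up.mem_left (op_congr hj eq_rfl)
      have hy := h.right.up.mem_left (op_congr hj eq_rfl)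
      rw [op_mem_seq] at ht hy
      rw [← ih] at hy
      exact ht.symm.leib (fun t => TmVal (evalSet M) t _ y) hy

theorem iSup_iSup_eq (F : D → D → Ω) [hF : Def fun p : D × D => F p.1 p.2] (a b : D) :
    (⨆ x, ⨆ y, x =ᵢ a ⊓ (y =ᵢ b ⊓ F x y)) = F a b := by
  have : ∀ {X : Type} [Env D X] {a b : X → D} [TDef a] [TDef b], Def fun x => F (a x) (b x) :=
    fun {_ _ _ _ ha hb} => hF.app₂ ha hb
  refine eq_of_forces (fun u h => h.exE fun v _ x h => h.exE fun v _ y h => ?_) fun u h =>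
    .ex a (.ex b (eq_rfl.and (eq_rfl.and h)))
  exact h.right.left.leib (fun y => F a y) (h.left.leib (fun x => F x y) h.right.right)

/-- Satisfaction of a formula in `M` is its truth in the inner structure. -/
theorem Inner.truth : {n : ℕ} → (φ : Fm Empty n) → (e : Fin n → Inner hM) →
    op φ.cd (seq fun j => (e j).1) ∈ᵢ truthSet M = φ.eval e
  | n, .mem t s, e => by
    have := fun u : Ω => ((((hM.isSat (u := u)).ball (v := u) (nm_mem_om n)).ball (isFun_seq fun j => (e j).2 u)).left.at
      t.cd).ball ((t.cd_mem hM u).and (s.cd_mem hM u))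
    refine (eq_of_bi fun u => (this u).left).trans ?_
    simp only [hM.op_mem_valSet, Inner.tmVal]
    rw [iSup_iSup_eq, Inner.op_mem_elRel]
    rfl
  | n, .eq t s, e => by
    have := fun u : Ω => ((((hM.isSat (u := u)).ball (v := u) (nm_mem_om n)).ball (isFun_seq fun j => (e j).2 u)).left.at
      t.cd).ball ((t.cd_mem hM u).and (s.cd_mem hM u))
    refine (eq_of_bi fun u => (this u).right).trans ?_
    simp only [hM.op_mem_valSet, Inner.tmVal]
    rw [iSup_iSup_eq, Inner.op_mem_eqRel]
    rfl
  | n, .bot, e => by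
    rw [Fm.cd, hM.op_mem_truthSet, hM.holds_bot]
    rfl
  | n, .and φ ψ, e => by
    have := fun u : Ω => ((((hM.isSat (u := u)).ball (v := u) (nm_mem_om n)).ball
      (isFun_seq fun j => (e j).2 u)).right.right.left.at φ.cd).ball
        ((φ.cd_mem hM u).and (ψ.cd_mem hM u))
    refine (eq_of_bi fun u => (this u).left).trans ?_
    rw [Inner.truth φ e, Inner.truth ψ e]
    rfl
  | n, .or φ ψ, e => by
    have := fun u : Ω => ((((hM.isSat (u := u)).ball (v := u) (nm_mem_om n)).ball
      (isFun_seq fun j => (e j).2 u)).right.right.left.at φ.cd).ball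
        ((φ.cd_mem hM u).and (ψ.cd_mem hM u))
    refine (eq_of_bi fun u => (this u).right.left).trans ?_
    rw [Inner.truth φ e, Inner.truth ψ e]
    rfl
  | n, .imp φ ψ, e => by
    have := fun u : Ω => ((((hM.isSat (u := u)).ball (v := u) (nm_mem_om n)).ball
      (isFun_seq fun j => (e j).2 u)).right.right.left.at φ.cd).ball
        ((φ.cd_mem hM u).and (ψ.cd_mem hM u))
    refine (eq_of_bi fun u => (this u).right.right).trans ?_
    rw [Inner.truth φ e, Inner.truth ψ e]
    rfl
  | n, .all φ, e => by
    have := fun u : Ω => (((hM.isSat (u := u)).ball (v := u) (nm_mem_om n)).ball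
      (isFun_seq fun j => (e j).2 u)).right.right.right.ball (φ.cd_mem hM u)
    refine (eq_of_bi fun u => (this u).left).trans ?_
    rw [hM.iInf_inner]
    simp only [← seq_esnoc, Inner.truth φ]
    rfl
  | n, .ex φ, e => by
    have := fun u : Ω => (((hM.isSat (u := u)).ball (v := u) (nm_mem_om n)).ball
      (isFun_seq fun j => (e j).2 u)).right.right.right.ball (φ.cd_mem hM u)
    refine (eq_of_bi fun u => (this u).right).trans ?_
    rw [hM.iSup_inner]
    simp only [← seq_esnoc, Inner.truth φ]
    rfl

theorem Inner.truth_esnoc {n : ℕ} (φ : Fm Empty (n + 1)) (e : Fin n → Inner hM) (x : Inner hM) :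
    op φ.cd (ext (seq fun j => (e j).1) (nm n) x.1) ∈ᵢ truthSet M = φ.eval (esnoc e x) := by
  rw [← seq_esnoc, Inner.truth]

theorem Inner.truth_esnoc₂ {n : ℕ} (φ : Fm Empty (n + 2)) (e : Fin n → Inner hM) (x y : Inner hM) :
    op φ.cd (ext (ext (seq fun j => (e j).1) (nm n) x.1) (sc (nm n)) y.1) ∈ᵢ truthSet M =
      φ.eval (esnoc (esnoc e x) y) := by
  rw [← seq_esnoc, ← Inner.truth_esnoc]
  rfl

/-! ### The axioms in the inner structure -/

theorem Inner.symVal {m : ℕ} (f : Sym Empty m) (w : Fin m → Inner hM) (u : Ω) :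
    u ⊩ op (op f.cd (seq fun j => (w j).1)) (Str.fn f w).1 ∈ᵢ symSet M := by
  rw [hM.op_mem_symSet, hM.symVal_iff (hM.of_tg_op (f.cd_mem hM u)) (Inner.seq_mem w u)]
  exact ((Str.fn f w).2 u).and (Inner.fn_eq f w)

theorem Inner.axLeibniz {m : ℕ} (φ : Fm Empty (m + 1)) :
    (axLeibniz φ).eval (![] : Fin 0 → Inner hM) = ⊤ := by
  refine (eval_axLeibniz φ).2 fun f a b => ?_
  simp only [← Inner.truth_esnoc]
  have h := Forces.self (u := a =ᵢ b ⊓ op φ.cd (ext (seq fun j => (f j).1) (nm m) a.1) ∈ᵢ truthSet M)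
  exact Forces.leib (fun x => op φ.cd (ext (seq fun j => (f j).1) (nm m) x) ∈ᵢ truthSet M) h.left h.right

theorem Inner.axSep {m : ℕ} (φ : Fm Empty (m + 1)) :
    (axSep φ).eval (![] : Fin 0 → Inner hM) = ⊤ := by
  refine (eval_axSep φ).2 fun f a c => ?_
  refine eq_of_bi fun u => ?_
  have h := ((((hM.satSep (u := u)).ball (v := u) (nm_mem_om m)).at φ.cd).ball ((φ.cd_mem hM u).and
    (isFun_seq fun j => (f j).2 u))).ball (a.2 u)
  have hs := Inner.symVal (.sep φ) (esnoc f a) u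
  rw [seq_esnoc] at hs
  have := (h.ball (c.2 u)).ball hs
  rwa [Inner.op_mem_elRel, Inner.op_mem_elRel, Inner.truth_esnoc] at this

theorem Inner.axRepl {m : ℕ} (φ : Fm Empty (m + 2)) :
    (axRepl φ).eval (![] : Fin 0 → Inner hM) = ⊤ := by
  refine (eval_axRepl φ).2 fun f a c => ?_
  refine eq_of_bi fun u => ?_
  have h := ((((hM.satRepl (u := u)).ball (v := u) (nm_mem_om m)).at φ.cd).ball ((φ.cd_mem hM u).and
    (isFun_seq fun j => (f j).2 u))).ball (a.2 u)
  have hs := Inner.symVal (.repl φ) (esnoc f a) u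
  rw [seq_esnoc] at hs
  have := (h.ball (c.2 u)).ball hs
  simpa only [↓hM.iInf_inner, ↓hM.iSup_inner, Inner.op_mem_elRel, Inner.op_mem_eqRel,
    Inner.truth_esnoc₂] using this

theorem Inner.axInd {m : ℕ} (φ : Fm Empty (m + 1)) :
    (axInd φ).eval (![] : Fin 0 → Inner hM) = ⊤ := by
  refine (eval_axInd φ).2 fun f => ?_
  have h := fun u : Ω => (((hM.satInd (u := u)).ball (v := u) (nm_mem_om m)).at φ.cd).ball ((φ.cd_mem hM u).and
    (isFun_seq fun j => (f j).2 u))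
  simp only [↓hM.iInf_inner, Inner.op_mem_elRel, Inner.truth_esnoc] at h
  exact himp_eq_top_iff.1 (eq_top_iff_forces.2 h)

theorem Inner.finAx {φ : Fm Empty 0} (h : φ ∈ finAx) : φ.eval (![] : Fin 0 → Inner hM) = ⊤ := by
  simp only [IZF.finAx, List.mem_cons, List.not_mem_nil, or_false] at h
  rcases h with rfl | rfl | rfl | rfl | rfl | rfl
  · refine (eval_axExt (Inner hM)).2 fun a b => ?_
    refine Eq.trans (IZF.eq_def a.1 b.1) (Eq.trans ?_ (hM.iInf_inner fun c => c ∈ᵢ a.1 ⇔ᵢ c ∈ᵢ b.1))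
    refine eq_of_forces (fun u h => ballI fun v _ c _ => (h.at c).up) fun u h => .all fun c => ?_
    exact iffI (fun v _ hc => (h.ball (hM.trans hc (a.2 v))).left.mp hc)
      fun v _ hc => (h.ball (hM.trans hc (b.2 v))).right.mp hc
  · exact (eval_axEmpty (Inner hM)).2 fun c => mem_emp c.1
  · exact (eval_axPair (Inner hM)).2 fun a b c => mem_pr a.1 b.1 c.1
  · refine (eval_axInf (Inner hM)).2 fun c => (mem_om c.1).trans (congrArg _ ?_)
    exact Inner.iSup_mem om fun b => c.1 =ᵢ sc b
  · exact (eval_axUnion (Inner hM)).2 fun a c => (mem_un a.1 c.1).trans (a.iSup_mem fun b => c.1 ∈ᵢ b)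
  · exact (eval_axPower (Inner hM)).2 fun a c => (mem_pw a.1 c.1).trans (c.iInf_mem fun b => b ∈ᵢ a.1)

instance : IsModelIZF (Inner hM) where
  out _ h := match h with
    | .fin h => Inner.finAx h
    | .leibniz φ => Inner.axLeibniz φ
    | .sep φ => Inner.axSep φ
    | .repl φ => Inner.axRepl φ
    | .ind φ => Inner.axInd φ

theorem Inner.satAll {A : List (Fm Empty 0)} (h : ∀ φ ∈ A, φ.eval (![] : Fin 0 → Inner hM) = ⊤)
    (u : Ω) : u ⊩ SatAll (truthSet M) A := by
  induction A with
  | nil => exact impI fun _ _ h => h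
  | cons φ A ih =>
    refine .and ?_ (ih fun ψ hψ => h ψ (.tail _ hψ))
    have := Inner.truth φ (![] : Fin 0 → Inner hM)
    rw [h φ (.head _)] at this
    exact this.ge.trans' le_top

theorem Inac.setModels_of_inner {A : List (Fm Empty 0)}
    (h : ∀ φ ∈ A, φ.eval (![] : Fin 0 → Inner hM) = ⊤) (u : Ω) : u ⊩ SetModels M A :=
  hM.setModels (Inner.satAll (hM := hM) (fun _ h => Inner.finAx h) u) (Inner.satAll h u)

/-! ### Absoluteness -/

theorem Inner.isFun {u : Ω} {f a d : Inner hM} (h : u ⊩ IsFun f a d) : u ⊩ IsFun f.1 a.1 d.1 := by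
  refine isFunI (fun v _ x hx => ?_) (fun v _ x y z hy hz => ?_) fun v _ z hz => ?_
  · obtain ⟨r, hr, hxr⟩ := hM.exists_retract x
    have e := hxr v (hM.trans hx (a.2 v))
    refine (h.up.fun_value (x := (⟨r, hr⟩ : Inner hM)) (hx.mem_left e)).bexE fun v _ y hy hxy => ?_
    exact .bex (x := y.1) hy (Forces.mem_left hxy (op_congr e.up.symm eq_rfl))
  · obtain ⟨x', hx', ex⟩ := hM.exists_retract x
    obtain ⟨y', hy', ey⟩ := hM.exists_retract y
    obtain ⟨z', hz', ez⟩ := hM.exists_retract z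
    have ex := ex v (hM.fst_mem (hM.trans hy (f.2 v)))
    have ey := ey v (hM.snd_mem (hM.trans hy (f.2 v)))
    have ez := ez v (hM.snd_mem (hM.trans hz (f.2 v)))
    have := h.up.fun_unique (x := (⟨x', hx'⟩ : Inner hM)) (y := ⟨z', hz'⟩) (z := ⟨y', hy'⟩)
      (hz.mem_left (op_congr ex ez)) (hy.mem_left (op_congr ex ey))
    exact ez.trans (Forces.trans this ey.symm)
  · obtain ⟨r, hr, hzr⟩ := hM.exists_retract z
    have e := hzr v (hM.trans hz (f.2 v))
    refine (h.up.fun_rel (z := (⟨r, hr⟩ : Inner hM)) (hz.mem_left e)).bexE fun v _ x hx h' =>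
      h'.bexE fun v _ y hy e' => ?_
    exact .bex (x := x.1) hx.up (.bex (x := y.1) hy (e.up.trans e'))

theorem Inac.inner {v : Inner hM} (hv : Inac v.1) : Inac v where
  om_mem := hv.om_mem
  trans hx hy := hv.trans hx hy
  un_mem hx := hv.un_mem hx
  pw_mem hx := hv.pw_mem hx
  fun_mem ha hf := hv.fun_mem ha (Inner.isFun hf)

end InnerStructure

/-! ## The hierarchy of inaccessible sets -/

theorem mem_modelAxioms {k : ℕ} {φ : Fm Empty 0} :
    φ ∈ modelAxioms k ↔ ∃ j < k, φ = hasModel (modelAxioms j) := by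
  induction k with
  | zero => simp [modelAxioms]
  | succ k ih =>
    simp only [modelAxioms, List.mem_append, ih, List.mem_singleton]
    constructor
    · rintro (⟨j, hj, rfl⟩ | rfl)
      · exact ⟨j, by omega, rfl⟩
      · exact ⟨k, by omega, rfl⟩
    · rintro ⟨j, hj, rfl⟩
      rcases Nat.lt_succ_iff_lt_or_eq.1 hj with h | rfl
      · exact .inl ⟨j, h, rfl⟩
      · exact .inr rfl

/-- The last set of a chain of `k + 1` inaccessible sets is a model of `IZF_R` and of the first `k`
of the sentences on the existence of models. -/
theorem setModels_of_chain {K Ω D : Type} [Order.Frame Ω] [Str K Ω D] [IsModelIZF D] (k : ℕ)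
    (w : ℕ → D) (hw : ∀ j ≤ k, Inac (w j)) (h : ∀ j < k, ∀ u : Ω, u ⊩ w j ∈ᵢ w (j + 1)) (u : Ω) :
    u ⊩ SetModels (w k) (modelAxioms k) := by
  induction k using Nat.strong_induction_on generalizing K D u with
  | _ k ih =>
    have hM := hw k le_rfl
    have hmem : ∀ i j, j + i + 1 = k → ∀ u : Ω, u ⊩ w j ∈ᵢ w k := by
      intro i
      induction i with
      | zero => exact fun j hj u => hj ▸ h j (by omega) u
      | succ i ih =>
        exact fun j hj u => hM.trans (h j (by omega) u) (ih (j + 1) (by omega) u)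
    refine hM.setModels_of_inner (fun φ hφ => ?_) u
    obtain ⟨j, hj, rfl⟩ := mem_modelAxioms.1 hφ
    let w' : ℕ → Inner hM := fun i =>
      if hi : i < k then ⟨w i, hmem (k - i - 1) i (by omega)⟩ else ⟨emp, fun _ => hM.emp_mem⟩
    have hw' : ∀ i < k, (w' i).1 = w i := fun i hi => by simp only [w', dif_pos hi]
    refine eq_top_iff_forces.2 fun u => (ih j hj w' (fun i hi => Inac.inner ?_) (fun i hi u => ?_) u).hasModel _
    · rw [hw' i (by omega)]
      exact hw i (by omega)
    · change u ⊩ (w' i).1 ∈ᵢ (w' (i + 1)).1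
      rw [hw' i (by omega), hw' (i + 1) (by omega)]
      exact h i (by omega) u

/-- The predicate expressed by `inacClosed`. -/
def InacClosed {K Ω D : Type} [Order.Frame Ω] [Str K Ω D] (p d : D) : Ω :=
  p ∈ᵢ d ⊓ ((⨅ x, ⨅ y, x ∈ᵢ d ⊓ y ∈ᵢ x ⇨ y ∈ᵢ d) ⊓ ((⨅ x, x ∈ᵢ d ⇨ un x ∈ᵢ d) ⊓
    ((⨅ x, x ∈ᵢ d ⇨ pw x ∈ᵢ d) ⊓ ⨅ x, x ∈ᵢ d ⇨ ⨅ f, IsFun f x d ⇨ f ∈ᵢ d)))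

section Constants

variable {Ω D : Type} [Order.Frame Ω] [Str ℕ Ω D] [IsModelIZF D]

/-- The interpretation of the term `V_i`. -/
def vset (D : Type) {Ω : Type} [Str ℕ Ω D] (i : ℕ) : D := (V i : Tm ℕ 0).eval ![]

theorem eval_V {n : ℕ} (e : Fin n → D) (i : ℕ) : (V i : Tm ℕ n).eval e = vset D i := by
  cases i with
  | zero => rw [vset, V, V, eval_omegaT, eval_omegaT]
  | succ i =>
    simp only [vset, V, Tm.eval]
    congr 1
    funext j
    exact j.elim0

theorem eval_axInac {k : ℕ} (h : (axInac k).eval (![] : Fin 0 → D) = ⊤) (c : D) :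
    c ∈ᵢ vset D (k + 1) =
      (c =ᵢ vset D k ⊔ ((⨆ a, a ∈ᵢ vset D (k + 1) ⊓ c ∈ᵢ a) ⊔
        ((⨆ a, a ∈ᵢ vset D (k + 1) ⊓ c =ᵢ un a) ⊔ ((⨆ a, a ∈ᵢ vset D (k + 1) ⊓ c =ᵢ pw a) ⊔
        ⨆ a, a ∈ᵢ vset D (k + 1) ⊓ IsFun c a (vset D (k + 1)))))) ⊓
      ⨅ d, InacClosed (vset D k) d ⇨ c ∈ᵢ d := by
  simp only [axInac, inacIn, inacClosed, eval_allx, eval_iff, eval_and, eval_or, eval_imp, eval_ball,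
    eval_bex, eval_mem, eval_eq, eval_unionT, eval_powerT, eval_isFun, eval_V, Tm.eval_lift,
    eval_var_last, iInf_eq_top, biimp_eq_top_iff] at h
  exact h c

variable (H : ∀ k, (axInac k).eval (![] : Fin 0 → D) = ⊤)

include H

theorem vset_least {u : Ω} {k : ℕ} {c d : D} (hd : u ⊩ InacClosed (vset D k) d)
    (hc : u ⊩ c ∈ᵢ vset D (k + 1)) : u ⊩ c ∈ᵢ d := by
  rw [eval_axInac (H k)] at hc
  exact hc.right.ball hd

theorem vset_mem_succ (k : ℕ) (u : Ω) : u ⊩ vset D k ∈ᵢ vset D (k + 1) := by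
  rw [eval_axInac (H k)]
  exact .and (.inl eq_rfl) (ballI fun _ _ d hd => hd.left)

theorem vset_trans {u : Ω} {k : ℕ} {x y : D} (hx : u ⊩ x ∈ᵢ y) (hy : u ⊩ y ∈ᵢ vset D (k + 1)) :
    u ⊩ x ∈ᵢ vset D (k + 1) := by
  rw [eval_axInac (H k)]
  refine .and (.inr (.inl (.bex hy hx))) (ballI fun _ _ d hd => ?_)
  exact (hd.right.left.at y).ball ((vset_least H hd hy.up).and hx.up)

theorem om_mem_vset (k : ℕ) (u : Ω) : u ⊩ om ∈ᵢ vset D (k + 1) := by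
  induction k with
  | zero =>
    have := vset_mem_succ H 0 u
    rwa [vset, V, eval_omegaT] at this
  | succ k ih => exact vset_trans H ih (vset_mem_succ H (k + 1) u)

theorem inac_vset (k : ℕ) : Inac (vset D (k + 1)) where
  om_mem {u} := om_mem_vset H k u
  trans hx hy := vset_trans H hx hy
  un_mem {u x} hx := by
    rw [eval_axInac (H k)]
    refine .and (.inr (.inr (.inl (.bex hx eq_rfl)))) (ballI fun _ _ d hd => ?_)
    exact hd.right.right.left.ball (vset_least H hd hx.up)
  pw_mem {u x} hx := by
    rw [eval_axInac (H k)]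
    refine .and (.inr (.inr (.inr (.inl (.bex hx eq_rfl))))) (ballI fun _ _ d hd => ?_)
    exact hd.right.right.right.left.ball (vset_least H hd hx.up)
  fun_mem {u f a} ha hf := by
    rw [eval_axInac (H k)]
    refine .and (.inr (.inr (.inr (.inr (.bex ha hf))))) (ballI fun v _ d hd => ?_)
    refine (hd.right.right.right.right.ball (vset_least H hd ha.up)).ball
      (hf.up.fun_cod_change fun _ _ _ _ _ hy => vset_least H hd.up hy)

end Constants

end IZF

theorem mainTheorem5 (i : ℕ) (hi : 0 < i) :
    IZF.Derives IZF.IZFRomega (IZF.setModels (IZF.V i) (IZF.modelAxioms (i - 1))) := by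
  obtain ⟨k, rfl⟩ := Nat.exists_eq_add_of_lt hi
  refine IZF.derives_of_forall_frame _ _ fun Ω D _ _ h => ?_
  have : IZF.IsModelIZF D := ⟨fun φ hφ => h φ (.inl hφ)⟩
  have H : ∀ k, (IZF.axInac k).eval (![] : Fin 0 → D) = ⊤ := fun k => h _ (.inr ⟨k, rfl⟩)
  rw [IZF.eval_setModels, IZF.eval_V, IZF.eq_top_iff_forces]
  simp only [zero_add, Nat.add_sub_cancel]
  exact IZF.setModels_of_chain k (fun j => IZF.vset D (j + 1)) (fun j _ => IZF.inac_vset H j)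
    fun j _ => IZF.vset_mem_succ H (j + 1)
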